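/- Let $\mathcal R=(X,R,Y,R^\vee,\Delta)$ be a based root datum ($X,Y$ lattices in perfect duality, $R$ a finite reduced root system with basis $\Delta$), with Weyl group $W$. Let $\ell$ be the length function on $W\ltimes X$ that extends the Coxeter length of the affine Weyl group $W\ltimes\mathbb ZR$, whose simple reflections are $s_\alpha$ ($\alpha\in\Delta$) and $s'_\alpha:x\mapsto s_\alpha(x)+\alpha$ ($\alpha^\vee$ maximal in $R^\vee$ with respect to $\Delta^\vee$). Let $q>1$ be real and let $\lambda,\lambda^*:R\to\mathbb R$ be $W$-invariant functions with $\lambda^*(\alpha)=\lambda(\alpha)$ whenever $\alpha^\vee\notin 2Y$. Put $q_{s_\alpha}=q^{\lambda(\alpha)}$, $q_{s'_\alpha}=q^{\lambda^*(\alpha)}$, and assume that $q_s\ge 1$ for every simple affine reflection $s$. Let $\mathcal H=\mathcal H(\mathcal R,\lambda,\lambda^*,q)$ be the affine Hecke algebra: the complex algebra with basis $\{N_w:w\in W\ltimes X\}$ and unit $N_e$, in which, for every $w\in W\ltimes X$ and every simple affine reflection $s$, $N_wN_s=N_{ws}$ if $\ell(ws)=\ell(w)+1$ and $N_wN_s=N_{ws}+(q_s^{1/2}-q_s^{-1/2})N_w$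 if $\ell(ws)=\ell(w)-1$, and $N_wN_\omega=N_{w\omega}$ if $\ell(\omega)=0$. For $x=x_1-x_2\in X$ with $\langle x_i,\alpha^\vee\rangle\ge 0$ for all $\alpha\in\Delta$, let $\theta_x=N_{x_1}N_{x_2}^{-1}$. For $P\subset\Delta$ let $W_P=\langle s_\alpha:\alpha\in P\rangle$, let $\mathcal H^P\subset\mathcal H$ be the subalgebra generated by all $\theta_x$ $(x\in X)$ and all $N_w$ $(w\in W_P)$, and let $\mathcal H(W_P,q^\lambda)$ be the Iwahori–Hecke algebra of $W_P$, spanned by the $N_w$ with $w\in W_P$; for $P=\Delta$ it is denoted $\mathcal H(W,q^\lambda)$. Its Steinberg representation is the character $\mathrm{St}$ with $\mathrm{St}(N_{s})=-q_{s}^{-1/2}$ for every simple reflection $s=s_\alpha$, $\alpha\in P$. An $\mathcal H^P$-module is called generic if its restriction to $\mathcal H(W_P,q^\lambda)$ contains $\mathrm{St}$; in particular (for $P=\Delta$) an $\mathcal H$-module is generic if its restriction to $\mathcal H(W,q^\lambda)$ contains $\mathrm{St}$. Write $\mathrm{ind}_{\mathcal H^P}^{\mathcal H}V=\mathcal H\otimes_{\mathcal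 H^P}V$. Let $P\subset\Delta$ and let $V$ be an $\mathcal H^P$-module. (a) $V$ is generic if and only if $\mathrm{ind}_{\mathcal H^P}^{\mathcal H}V$ is generic. (b) Suppose that $V$ is irreducible and generic. Then $\dim_{\mathbb C}\mathrm{Hom}_{\mathcal H(W,q^\lambda)}(\mathrm{ind}_{\mathcal H^P}^{\mathcal H}V,\mathrm{St})=1$. Moreover $\mathrm{ind}_{\mathcal H^P}^{\mathcal H}V$ has, up to isomorphism, a unique generic irreducible subquotient, and this subquotient occurs in $\mathrm{ind}_{\mathcal H^P}^{\mathcal H}V$ with multiplicity one. -/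

import Mathlib

open scoped TensorProduct

noncomputable section

namespace AffHecke

/-! ### Iwahori--Hecke algebras -/

/-- Relations of the Iwahori--Hecke algebra of a group `G` with length function `len`, simple
reflections `s j` and parameters `q j`. The generators are the symbols `N_w`, `w ∈ G`; elements
of length zero multiply as in the group. -/
inductive IHRel {G J : Type*} [Group G] (len : G → ℕ) (s : J → G) (q : J → ℝ) :
    FreeAlgebra ℂ G → FreeAlgebra ℂ G → Prop
  | one : IHRel len s q (FreeAlgebra.ι ℂ 1) 1
  | up (w : G) (j : J) (h : len (w * s j) = len w + 1) :
      IHRel len s q (FreeAlgebra.ι ℂ w * FreeAlgebra.ι ℂ (s j)) (FreeAlgebra.ι ℂ (w * s j))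
  | down (w : G) (j : J) (h : len (w * s j) + 1 = len w) :
      IHRel len s q (FreeAlgebra.ι ℂ w * FreeAlgebra.ι ℂ (s j))
        (FreeAlgebra.ι ℂ (w * s j) +
          ((q j ^ (1 / 2 : ℝ) - q j ^ (-(1 / 2) : ℝ) : ℝ) : ℂ) • FreeAlgebra.ι ℂ w)
  | lenZero (w u : G) (h : len u = 0) :
      IHRel len s q (FreeAlgebra.ι ℂ w * FreeAlgebra.ι ℂ u) (FreeAlgebra.ι ℂ (w * u))

/-- The Iwahori--Hecke algebra over `ℂ`: generators `N_w` (`w ∈ G`) and the relations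
`N_w N_s = N_{ws}` or `N_w N_s = N_{ws} + (q_s^{1/2} - q_s^{-1/2}) N_w`, according to whether
right multiplication by the simple reflection `s` raises or lowers the length. -/
abbrev IwahoriHecke {G J : Type*} [Group G] (len : G → ℕ) (s : J → G) (q : J → ℝ) : Type _ :=
  RingQuot (IHRel len s q)

instance {G J : Type*} [Group G] (len : G → ℕ) (s : J → G) (q : J → ℝ) :
    Ring (IwahoriHecke len s q) :=
  Algebra.semiringToRing ℂ

/-- The element `N_w`. -/
def IwahoriHecke.N {G J : Type*} [Group G] (len : G → ℕ) (s : J → G) (q : J → ℝ) (w : G) :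
    IwahoriHecke len s q :=
  RingQuot.mkAlgHom ℂ (IHRel len s q) (FreeAlgebra.ι ℂ w)

section RootDatum

variable {ι X Y : Type*} [AddCommGroup X] [AddCommGroup Y]

/-! ### The extended affine Weyl group -/

/-- The action of the Weyl group on `X`, with `X` written multiplicatively. -/
def weylAct (𝓡 : RootDatum ι X Y) : 𝓡.weylGroup →* MulAut (Multiplicative X) :=
  (MulAutMultiplicative X).symm.toMonoidHom.comp (DistribMulAction.toAddAut 𝓡.weylGroup X)

/-- The extended affine Weyl group `W ⋉ X`. The pair `⟨x, w⟩` is the affine transformation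
`y ↦ x + w y` of `X`. -/
abbrev ExtWeyl (𝓡 : RootDatum ι X Y) : Type _ := Multiplicative X ⋊[weylAct 𝓡] 𝓡.weylGroup

variable {𝓡 : RootDatum ι X Y}

/-- The action of `W ⋉ X` on affine roots. The pair `(i, k)` is the affine function
`y ↦ ⟨y, α_i^∨⟩ + k` on `X`, and `g` acts by `(g f)(y) = f (g⁻¹ y)`. -/
def affAct (g : ExtWeyl 𝓡) (a : ι × ℤ) : ι × ℤ :=
  (g.right • a.1,
    a.2 - 𝓡.toLinearMap (Multiplicative.toAdd g.left) (𝓡.coroot (g.right • a.1)))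

variable (b : 𝓡.Base)

/-- The affine roots that are positive on the fundamental alcove. -/
def AffPos (a : ι × ℤ) : Prop := 0 < a.2 ∨ (a.2 = 0 ∧ b.IsPos a.1)

/-- The length function of `W ⋉ X`: the number of positive affine roots made negative,
equivalently the number of reflection hyperplanes that separate the fundamental alcove from its
image. On the affine Weyl group it is the Coxeter length. -/
def len (g : ExtWeyl 𝓡) : ℕ := {a : ι × ℤ | AffPos b a ∧ ¬ AffPos b (affAct g a)}.ncard

/-- The coroot `α_i^∨` is maximal for the ordering of the coroots determined by `Δ^∨`. -/
def IsMaxCoroot (i : ι) : Prop :=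
  ∀ j, 𝓡.coroot j - 𝓡.coroot i ∈ AddSubmonoid.closure (𝓡.coroot '' b.support) → j = i

/-- Index set of the simple affine reflections: `s_α` for `α ∈ Δ`, and `s'_α` for maximal
`α^∨`. -/
abbrev SAff : Type _ := {i : ι // i ∈ b.support} ⊕ {i : ι // IsMaxCoroot b i}

/-- The simple affine reflections: `s_α`, and `s'_α : x ↦ s_α x + α`. -/
def sAff : SAff b → ExtWeyl 𝓡
  | Sum.inl i => SemidirectProduct.inr (RootPairing.weylGroup.ofIdx 𝓡 i.1)
  | Sum.inr i => ⟨Multiplicative.ofAdd (𝓡.root i.1), RootPairing.weylGroup.ofIdx 𝓡 i.1⟩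

/-! ### Parameters and the affine Hecke algebra -/

/-- Parameters of an affine Hecke algebra: a real number `q > 1` and `W`-invariant functions
`λ, λ* : R → ℝ` that agree at `α` unless `α^∨ ∈ 2Y`. -/
structure Params (𝓡 : RootDatum ι X Y) where
  q : ℝ
  one_lt_q : 1 < q
  lam : ι → ℝ
  lamStar : ι → ℝ
  lam_smul : ∀ (w : 𝓡.weylGroup) (i : ι), lam (w • i) = lam i
  lamStar_smul : ∀ (w : 𝓡.weylGroup) (i : ι), lamStar (w • i) = lamStar i
  lamStar_eq : ∀ i, (¬ ∃ y : Y, 𝓡.coroot i = 2 • y) → lamStar i = lam i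

variable (p : Params 𝓡)

/-- The parameters `q_{s_α} = q ^ λ(α)` and `q_{s'_α} = q ^ λ*(α)`. -/
def qAff : SAff b → ℝ
  | Sum.inl i => p.q ^ p.lam i.1
  | Sum.inr i => p.q ^ p.lamStar i.1

/-- The affine Hecke algebra `ℋ`. -/
abbrev Hecke : Type _ := IwahoriHecke (len b) (sAff b) (qAff b p)

/-- The elements `N_w` of `ℋ`, for `w ∈ W ⋉ X`. -/
abbrev heckeN (w : ExtWeyl 𝓡) : Hecke b p := IwahoriHecke.N (len b) (sAff b) (qAff b p) w

/-- `⟨x, α^∨⟩ ≥ 0` for all simple roots `α`. -/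
def Dominant (x : X) : Prop := ∀ i ∈ b.support, 0 ≤ 𝓡.toLinearMap x (𝓡.coroot i)

/-- `IsTheta b p x h` says that `h = θ_x`, that is, `h = N_{x₁} N_{x₂}⁻¹` for some dominant
`x₁, x₂` with `x = x₁ - x₂`. -/
def IsTheta (x : X) (h : Hecke b p) : Prop :=
  ∃ x₁ x₂ : X, Dominant b x₁ ∧ Dominant b x₂ ∧ x = x₁ - x₂ ∧
    ∃ u : (Hecke b p)ˣ,
      (u : Hecke b p) = heckeN b p (SemidirectProduct.inl (Multiplicative.ofAdd x₂)) ∧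
      h = heckeN b p (SemidirectProduct.inl (Multiplicative.ofAdd x₁)) * ((u⁻¹ : (Hecke b p)ˣ))

/-- The parabolic subgroup `W_Q` of `W`, for a set `Q` of simple roots. -/
def WPar (Q : Set b.support) : Subgroup 𝓡.weylGroup :=
  Subgroup.closure ((fun i : b.support => RootPairing.weylGroup.ofIdx 𝓡 i.1) '' Q)

/-- The parabolic subalgebra `ℋ^Q` of `ℋ`, generated by the `θ_x` with `x ∈ X` and the `N_w` with
`w ∈ W_Q`. -/
def heckePar (Q : Set b.support) : Subalgebra ℂ (Hecke b p) :=
  Algebra.adjoin ℂ ({h | ∃ x : X, IsTheta b p x h} ∪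
    {h | ∃ w ∈ WPar b Q, h = heckeN b p (SemidirectProduct.inr w)})

/-! ### The finite Hecke algebras `ℋ(W_Q, q^λ)` -/

/-- The length function of `W_Q`. -/
def finLen (Q : Set b.support) (w : WPar b Q) : ℕ :=
  len b (SemidirectProduct.inr (w : 𝓡.weylGroup))

/-- The simple reflections of `W_Q`. -/
def finS (Q : Set b.support) (i : Q) : WPar b Q :=
  ⟨RootPairing.weylGroup.ofIdx 𝓡 i.1.1, Subgroup.subset_closure ⟨i.1, i.2, rfl⟩⟩

/-- The parameters `q_{s_α} = q ^ λ(α)` for `α ∈ Q`. -/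
def finQ (Q : Set b.support) (i : Q) : ℝ := p.q ^ p.lam i.1.1

/-- The Iwahori--Hecke algebra `ℋ(W_Q, q^λ)`; for the set `Q = Δ` of all simple roots this is
`ℋ(W, q^λ)`. -/
abbrev FinHecke (Q : Set b.support) : Type _ :=
  IwahoriHecke (finLen b Q) (finS b Q) (finQ b p Q)

/-- The elements `N_w` of `ℋ(W_Q, q^λ)`. -/
abbrev finN (Q : Set b.support) (w : WPar b Q) : FinHecke b p Q :=
  IwahoriHecke.N (finLen b Q) (finS b Q) (finQ b p Q) w

/-- The homomorphism `ℋ(W_Q, q^λ) → ℋ`, `N_w ↦ N_w`. -/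
def finToHecke (Q : Set b.support) : FinHecke b p Q →ₐ[ℂ] Hecke b p :=
  RingQuot.liftAlgHom ℂ ⟨FreeAlgebra.lift ℂ
    (fun w : WPar b Q => heckeN b p (SemidirectProduct.inr (w : 𝓡.weylGroup))), by
      intro x y h
      have key : ∀ {x y}, IHRel (len b) (sAff b) (qAff b p) x y →
          RingQuot.mkAlgHom ℂ (IHRel (len b) (sAff b) (qAff b p)) x =
          RingQuot.mkAlgHom ℂ (IHRel (len b) (sAff b) (qAff b p)) y :=
        fun h => RingQuot.mkAlgHom_rel ℂ h
      cases h with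
      | one => simpa [IwahoriHecke.N] using key IHRel.one
      | up w i h =>
        have := key (IHRel.up (s := sAff b) (q := qAff b p)
          (SemidirectProduct.inr (w : 𝓡.weylGroup)) (Sum.inl i.1)
          (by simpa [finLen, sAff, finS] using h))
        simpa [IwahoriHecke.N, sAff, finS] using this
      | down w i h =>
        have := key (IHRel.down (s := sAff b) (q := qAff b p)
          (SemidirectProduct.inr (w : 𝓡.weylGroup)) (Sum.inl i.1)
          (by simpa [finLen, sAff, finS] using h))
        simpa [IwahoriHecke.N, sAff, finS, qAff, finQ] using this
      | lenZero w u h =>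
        have := key (IHRel.lenZero (s := sAff b) (q := qAff b p)
          (SemidirectProduct.inr (w : 𝓡.weylGroup))
          (SemidirectProduct.inr (u : 𝓡.weylGroup)) h)
        simpa [IwahoriHecke.N] using this⟩

theorem finToHecke_N (Q : Set b.support) (w : WPar b Q) :
    finToHecke b p Q (finN b p Q w) =
      heckeN b p (SemidirectProduct.inr (w : 𝓡.weylGroup)) := by
  simp [finToHecke, IwahoriHecke.N]

theorem finToHecke_mem (Q : Set b.support) (h : FinHecke b p Q) :
    finToHecke b p Q h ∈ heckePar b p Q := by
  obtain ⟨x, rfl⟩ := RingQuot.mkAlgHom_surjective ℂ _ h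
  induction x using FreeAlgebra.induction with
  | grade0 r => simp
  | grade1 w =>
    have := finToHecke_N b p Q w
    rw [finN, IwahoriHecke.N] at this
    rw [this]
    exact Algebra.subset_adjoin (Or.inr ⟨w, w.2, rfl⟩)
  | mul x y hx hy => rw [map_mul, map_mul]; exact mul_mem hx hy
  | add x y hx hy => rw [map_add, map_add]; exact add_mem hx hy

/-- The homomorphism `ℋ(W_Q, q^λ) → ℋ^Q`, `N_w ↦ N_w`. -/
def finToPar (Q : Set b.support) : FinHecke b p Q →ₐ[ℂ] heckePar b p Q :=
  (finToHecke b p Q).codRestrict (heckePar b p Q) (finToHecke_mem b p Q)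

/-! ### The Steinberg representation -/

/-- The positive roots made negative by `w`. -/
def posNeg (w : 𝓡.weylGroup) : Set ι := {i | b.IsPos i ∧ ¬ b.IsPos (w • i)}

/-- The value `-q_s^{-1/2}`, for a reflection `s = s_α`. -/
def stVal (i : ι) : ℂ := -(((p.q ^ p.lam i) ^ (-(1 / 2) : ℝ) : ℝ) : ℂ)

/-- The value of the Steinberg representation at `N_w`. -/
def stChar (w : 𝓡.weylGroup) : ℂ := ∏ᶠ i ∈ posNeg b w, stVal p i

theorem index_neg {i j : ι} (h : 𝓡.root i = -𝓡.root j) : b.IsPos i ↔ ¬ b.IsPos j := by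
  have hi : i = 𝓡.reflectionPerm j j := 𝓡.root.injective (by simp [h])
  subst hi
  exact RootPairing.Base.IsPos.neg_iff_not b j

theorem root_smul (w : 𝓡.weylGroup) (i : ι) : 𝓡.root (w • i) = w • 𝓡.root i :=
  (RootPairing.weylGroup_apply_root 𝓡 w i).symm

theorem root_refl_self (i : ι) :
    𝓡.root (RootPairing.weylGroup.ofIdx 𝓡 i • i) = -𝓡.root i := by
  rw [root_smul]; simp

theorem refl_refl (i : ι) :
    RootPairing.weylGroup.ofIdx 𝓡 i * RootPairing.weylGroup.ofIdx 𝓡 i = 1 := by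
  apply Subtype.ext
  have := RootPairing.Equiv.reflection_inv 𝓡 i
  change RootPairing.Equiv.reflection 𝓡 i * RootPairing.Equiv.reflection 𝓡 i = 1
  nth_rewrite 1 [← this]
  exact inv_mul_cancel _

theorem isPos_refl [Finite ι] {i j : ι} (hi : b.IsPos i) (hj : j ∈ b.support) (hij : i ≠ j) :
    b.IsPos (RootPairing.weylGroup.ofIdx 𝓡 j • i) := by
  classical
  have : Module.IsReflexive ℤ X := Module.IsReflexive.of_isPerfPair 𝓡.toLinearMap
  have : Module.IsReflexive ℤ Y := Module.IsReflexive.of_isPerfPair 𝓡.toLinearMap.flip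
  have : IsAddTorsionFree X := Module.isTorsionFree_int_iff_isAddTorsionFree.1 inferInstance
  have : IsAddTorsionFree Y := Module.isTorsionFree_int_iff_isAddTorsionFree.1 inferInstance
  obtain ⟨f, hf, hs, hr⟩ := b.exists_root_eq_sum_int i
  have hpos : 0 < f := by
    refine hs.resolve_right fun hlt => ?_
    rw [RootPairing.Base.isPos_iff, b.height_eq_sum hr] at hi
    exact absurd hi (not_lt.2 (Finset.sum_nonpos fun k _ => hlt.le k))
  set z := 𝓡.pairing i j
  have hr' : 𝓡.root (RootPairing.weylGroup.ofIdx 𝓡 j • i) =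
      ∑ k ∈ b.support, (f - (Pi.single j z : ι → ℤ)) k • 𝓡.root k := by
    have h1 : ∑ k ∈ b.support, (Pi.single j z : ι → ℤ) k • 𝓡.root k = z • 𝓡.root j := by
      rw [Finset.sum_eq_single_of_mem j hj (fun k _ hk => by simp [hk])]; simp
    simp only [Pi.sub_apply, sub_smul, Finset.sum_sub_distrib]
    rw [h1, ← hr, root_smul]
    simp [RootPairing.reflection_apply, z]
  have hsupp : Function.support (f - (Pi.single j z : ι → ℤ)) ⊆ b.support := by
    intro k hk
    by_contra hkb
    have h1 : f k = 0 := by by_contra h; exact hkb (hf h)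
    have h2 : k ≠ j := fun h => hkb (h ▸ hj)
    simp [h1, h2] at hk
  rw [RootPairing.Base.isPos_iff', b.height_eq_sum hr']
  rcases b.pos_or_neg_of_sum_smul_root_mem _ (hr' ▸ Set.mem_range_self _) hsupp with h | h
  · exact Finset.sum_nonneg fun k _ => h.le k
  · exfalso
    have h0 : ∀ k, k ≠ j → f k = 0 := fun k hk =>
      le_antisymm (by simpa [hk] using h.le k) (hpos.le k)
    have h1 : 𝓡.root i = f j • 𝓡.root j := by
      rw [hr]
      exact Finset.sum_eq_single_of_mem j hj (fun k _ hk => by simp [h0 k hk])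
    rcases b.eq_one_or_neg_one_of_mem_support_of_smul_mem j hj (f j)
      (h1 ▸ Set.mem_range_self _) with h2 | h2
    · rw [h2, one_smul] at h1
      exact hij (𝓡.root.injective h1)
    · have := hpos.le j
      simp [h2] at this

theorem isPos_of_len_eq_zero (w : 𝓡.weylGroup) (h : posNeg b w = ∅) (i : ι) :
    b.IsPos (w • i) ↔ b.IsPos i := by
  have key : ∀ i, b.IsPos i → b.IsPos (w • i) := fun i hi => by
    by_contra hc
    have : i ∈ posNeg b w := ⟨hi, hc⟩
    simp [h] at this
  refine ⟨fun hi => ?_, key i⟩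
  by_contra hc
  have h1 : 𝓡.root i = -𝓡.root (RootPairing.weylGroup.ofIdx 𝓡 i • i) := by
    rw [root_refl_self, neg_neg]
  have h2 : b.IsPos (RootPairing.weylGroup.ofIdx 𝓡 i • i) := by
    by_contra h3
    exact hc ((index_neg b h1).2 h3)
  have h3 : 𝓡.root (w • i) = -𝓡.root (w • RootPairing.weylGroup.ofIdx 𝓡 i • i) := by
    rw [root_smul, h1, smul_neg, root_smul w (RootPairing.weylGroup.ofIdx 𝓡 i • i)]
  exact (index_neg b h3).1 hi (key _ h2)

theorem posNeg_mul_refl [Finite ι] (w : 𝓡.weylGroup) {j : ι} (hj : j ∈ b.support)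
    (hw : b.IsPos (w • j)) :
    posNeg b (w * RootPairing.weylGroup.ofIdx 𝓡 j) =
      insert j ((fun i => RootPairing.weylGroup.ofIdx 𝓡 j • i) '' posNeg b w) := by
  set s := RootPairing.weylGroup.ofIdx 𝓡 j with hs
  have hss : ∀ i : ι, s • s • i = i := fun i => by rw [smul_smul, refl_refl, one_smul]
  have hneg : ¬ b.IsPos (w • s • j) := by
    have : 𝓡.root (w • s • j) = -𝓡.root (w • j) := by
      rw [root_smul, root_refl_self, smul_neg, root_smul]
    rw [index_neg b this]; simpa using hw
  have hjp : b.IsPos j := RootPairing.Base.isPos_of_mem_support hj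
  have hsj : ¬ b.IsPos (s • j) := by
    rw [index_neg b (root_refl_self j)]; simpa using hjp
  ext i
  simp only [posNeg, Set.mem_ofPred_eq, Set.mem_insert_iff, Set.mem_image, mul_smul]
  constructor
  · rintro ⟨h1, h2⟩
    by_cases hij : i = j
    · exact Or.inl hij
    · exact Or.inr ⟨s • i, ⟨isPos_refl b h1 hj hij, h2⟩, hss i⟩
  · rintro (rfl | ⟨k, ⟨h1, h2⟩, rfl⟩)
    · exact ⟨hjp, hneg⟩
    · refine ⟨isPos_refl b h1 hj (fun h => h2 (h ▸ hw)), by rwa [hss]⟩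

theorem stChar_ncard_mul_refl [Finite ι] (w : 𝓡.weylGroup) {j : ι} (hj : j ∈ b.support)
    (hw : b.IsPos (w • j)) :
    stChar b p (w * RootPairing.weylGroup.ofIdx 𝓡 j) = stChar b p w * stVal p j ∧
    (posNeg b (w * RootPairing.weylGroup.ofIdx 𝓡 j)).ncard = (posNeg b w).ncard + 1 := by
  have hinj : Function.Injective (fun i : ι => RootPairing.weylGroup.ofIdx 𝓡 j • i) :=
    MulAction.injective _
  have hn : j ∉ (fun i => RootPairing.weylGroup.ofIdx 𝓡 j • i) '' posNeg b w := by
    rintro ⟨k, ⟨h1, h2⟩, h3⟩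
    have hk : k = RootPairing.weylGroup.ofIdx 𝓡 j • j := by
      have := congrArg (fun i => RootPairing.weylGroup.ofIdx 𝓡 j • i) h3
      simpa only [smul_smul, refl_refl, one_smul] using this
    have := (index_neg b (root_refl_self j)).not.2
      (by simpa using RootPairing.Base.isPos_of_mem_support hj)
    exact this (hk ▸ h1)
  constructor
  · rw [stChar, posNeg_mul_refl b w hj hw, finprod_mem_insert _ hn (Set.toFinite _),
      finprod_mem_image hinj.injOn, mul_comm, stChar]
    simp [stVal, p.lam_smul]
  · rw [posNeg_mul_refl b w hj hw, Set.ncard_insert_of_notMem hn (Set.toFinite _),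
      Set.ncard_image_of_injective _ hinj]

theorem len_inr (w : 𝓡.weylGroup) :
    len b (SemidirectProduct.inr w : ExtWeyl 𝓡) = (posNeg b w).ncard := by
  have : {a : ι × ℤ | AffPos b a ∧ ¬ AffPos b (affAct (SemidirectProduct.inr w : ExtWeyl 𝓡) a)} =
      (fun i : ι => (i, (0 : ℤ))) '' posNeg b w := by
    ext ⟨i, k⟩
    simp only [AffPos, affAct, posNeg, Set.mem_ofPred_eq, Set.mem_image, SemidirectProduct.right_inr,
      SemidirectProduct.left_inr, toAdd_one, map_zero, LinearMap.zero_apply, sub_zero,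
      Prod.mk.injEq]
    constructor
    · rintro ⟨h1 | ⟨h1, h2⟩, h3⟩
      · exact absurd (Or.inl h1) h3
      · exact ⟨i, ⟨h2, fun h => h3 (Or.inr ⟨h1, h⟩)⟩, rfl, h1.symm⟩
    · rintro ⟨j, ⟨h1, h2⟩, rfl, rfl⟩
      exact ⟨Or.inr ⟨rfl, h1⟩, by simpa using h2⟩
  rw [len, this, Set.ncard_image_of_injective]
  intro i j h
  simpa using h

theorem stVal_sq (i : ι) : stVal p i * stVal p i =
    1 + (((p.q ^ p.lam i) ^ (1 / 2 : ℝ) - (p.q ^ p.lam i) ^ (-(1 / 2) : ℝ) : ℝ) : ℂ) *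
      stVal p i := by
  have hq : 0 < p.q ^ p.lam i := Real.rpow_pos_of_pos (by linarith [p.one_lt_q]) _
  have h1 : (p.q ^ p.lam i) ^ (1 / 2 : ℝ) * (p.q ^ p.lam i) ^ (-(1 / 2) : ℝ) = 1 := by
    rw [← Real.rpow_add hq]; norm_num
  have h2 := congrArg (fun r : ℝ => (r : ℂ)) h1
  simp only [Complex.ofReal_mul, Complex.ofReal_one] at h2
  simp only [stVal, Complex.ofReal_sub]
  linear_combination h2

theorem posNeg_one : posNeg b (1 : 𝓡.weylGroup) = ∅ := by
  ext i; simp [posNeg]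

theorem stChar_one : stChar b p (1 : 𝓡.weylGroup) = 1 := by
  rw [stChar, posNeg_one, finprod_mem_empty]

theorem stChar_refl [Finite ι] {j : ι} (hj : j ∈ b.support) :
    stChar b p (RootPairing.weylGroup.ofIdx 𝓡 j) = stVal p j := by
  have := (stChar_ncard_mul_refl b p (1 : 𝓡.weylGroup) hj
    (by simpa using RootPairing.Base.isPos_of_mem_support hj)).1
  simpa [stChar_one] using this

theorem stChar_mul_of_len_eq_zero (w u : 𝓡.weylGroup) (h : posNeg b u = ∅) :
    stChar b p (w * u) = stChar b p w := by
  have h1 : posNeg b w = (fun i => u • i) '' posNeg b (w * u) := by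
    ext i
    simp only [posNeg, Set.mem_ofPred_eq, Set.mem_image, mul_smul]
    constructor
    · rintro ⟨h1, h2⟩
      refine ⟨u⁻¹ • i, ⟨?_, by rwa [smul_inv_smul]⟩, smul_inv_smul u i⟩
      rw [← isPos_of_len_eq_zero b u h, smul_inv_smul]; exact h1
    · rintro ⟨k, ⟨h1, h2⟩, rfl⟩
      exact ⟨(isPos_of_len_eq_zero b u h k).2 h1, h2⟩
  rw [stChar, stChar, h1, finprod_mem_image (MulAction.injective u).injOn]
  simp [stVal, p.lam_smul]

/-- The Steinberg representation `St : ℋ(W_Q, q^λ) → ℂ`, the one-dimensional representation with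
`St(N_s) = -q_s^{-1/2}` for all simple reflections `s` (see `steinberg_simple`). -/
def steinberg [Finite ι] (Q : Set b.support) : FinHecke b p Q →ₐ[ℂ] ℂ :=
  RingQuot.liftAlgHom ℂ ⟨FreeAlgebra.lift ℂ (fun w : WPar b Q => stChar b p w), by
    intro x y h
    have flip : ∀ (w : 𝓡.weylGroup) (j : ι), ¬ b.IsPos (w • j) →
        b.IsPos ((w * RootPairing.weylGroup.ofIdx 𝓡 j) • j) := by
      intro w j hw
      have : 𝓡.root ((w * RootPairing.weylGroup.ofIdx 𝓡 j) • j) = -𝓡.root (w • j) := by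
        rw [mul_smul, root_smul, root_refl_self, smul_neg, root_smul]
      exact (index_neg b this).2 hw
    have two : ∀ (w : 𝓡.weylGroup) (j : ι),
        w * RootPairing.weylGroup.ofIdx 𝓡 j * RootPairing.weylGroup.ofIdx 𝓡 j = w :=
      fun w j => by rw [mul_assoc, refl_refl, mul_one]
    cases h with
    | one => simp [stChar_one]
    | up w i h =>
      simp only [finLen, len_inr, finS, Subgroup.coe_mul] at h
      simp only [map_mul, FreeAlgebra.lift_ι_apply, Subgroup.coe_mul, finS,
        stChar_refl b p i.1.2]
      by_cases hw : b.IsPos ((w : 𝓡.weylGroup) • (i.1.1 : ι))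
      · exact (stChar_ncard_mul_refl b p (w : 𝓡.weylGroup) i.1.2 hw).1.symm
      · have := (stChar_ncard_mul_refl b p _ i.1.2 (flip _ _ hw)).2
        rw [two] at this
        omega
    | down w i h =>
      simp only [finLen, len_inr, finS, Subgroup.coe_mul] at h
      simp only [map_mul, map_add, map_smul, FreeAlgebra.lift_ι_apply, Subgroup.coe_mul, finS,
        stChar_refl b p i.1.2, smul_eq_mul, finQ]
      by_cases hw : b.IsPos ((w : 𝓡.weylGroup) • (i.1.1 : ι))
      · have := (stChar_ncard_mul_refl b p (w : 𝓡.weylGroup) i.1.2 hw).2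
        omega
      · have := (stChar_ncard_mul_refl b p _ i.1.2 (flip _ _ hw)).1
        rw [two] at this
        rw [this, mul_assoc, stVal_sq]
        ring
    | lenZero w u h =>
      simp only [finLen, len_inr, Set.ncard_eq_zero (Set.toFinite _)] at h
      have hu : stChar b p (u : 𝓡.weylGroup) = 1 := by rw [stChar, h, finprod_mem_empty]
      simp only [map_mul, FreeAlgebra.lift_ι_apply, Subgroup.coe_mul, hu, mul_one,
        stChar_mul_of_len_eq_zero b p _ _ h]⟩

theorem steinberg_simple [Finite ι] (Q : Set b.support) (i : Q) :
    steinberg b p Q (finN b p Q (finS b Q i)) =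
      -(((finQ b p Q i) ^ (-(1 / 2) : ℝ) : ℝ) : ℂ) := by
  simp [steinberg, IwahoriHecke.N, finS, stChar_refl b p i.1.2, stVal, finQ]

/-! ### Genericity and parabolic induction -/

/-- Let `A` be an algebra with a homomorphism `φ : ℋ(W_Q, q^λ) → A`. The restriction to
`ℋ(W_Q, q^λ)` of the `A`-module `V` contains `St`: some line in `V` is an `ℋ(W_Q, q^λ)`-submodule
isomorphic to `St`. -/
def ContainsSt [Finite ι] (Q : Set b.support) {A : Type*} [Ring A] [Algebra ℂ A]
    (φ : FinHecke b p Q →ₐ[ℂ] A) (V : Type*) [AddCommGroup V] [Module A V] : Prop :=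
  ∃ v : V, v ≠ 0 ∧ ∀ h : FinHecke b p Q, φ h • v = algebraMap ℂ A (steinberg b p Q h) • v

/-- An `ℋ^Q`-module is generic if its restriction to `ℋ(W_Q, q^λ)` contains `St`. -/
def IsGenericPar [Finite ι] (Q : Set b.support) (V : Type*) [AddCommGroup V]
    [Module (heckePar b p Q) V] : Prop :=
  ContainsSt b p Q (finToPar b p Q) V

/-- An `ℋ`-module is generic if its restriction to `ℋ(W, q^λ)` contains `St`. -/
def IsGeneric [Finite ι] (M : Type*) [AddCommGroup M] [Module (Hecke b p) M] : Prop :=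
  ContainsSt b p Set.univ (finToHecke b p Set.univ) M

/-- The complex vector space `Hom_{ℋ(W, q^λ)}(M, St)`, for an `ℋ`-module `M`. -/
def homSt [Finite ι] (M : Type*) [AddCommGroup M] [Module ℂ M] [Module (Hecke b p) M] :
    Submodule ℂ (Module.Dual ℂ M) where
  carrier := {f | ∀ (h : FinHecke b p Set.univ) (m : M),
    f (finToHecke b p Set.univ h • m) = steinberg b p Set.univ h * f m}
  zero_mem' := by intro h m; simp
  add_mem' := by intro f g hf hg h m; simp [hf h m, hg h m, mul_add]
  smul_mem' := by intro c f hf h m; simp [hf h m, mul_left_comm]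

/-- The `ℋ`-submodule of `ℋ ⊗_ℂ V` generated by all `h a ⊗ v - h ⊗ a v` with `a ∈ ℋ^Q`. -/
def indRel (Q : Set b.support) (V : Type*) [AddCommGroup V] [Module ℂ V]
    [Module (heckePar b p Q) V] : Submodule (Hecke b p) (Hecke b p ⊗[ℂ] V) :=
  Submodule.span (Hecke b p) {t | ∃ (h : Hecke b p) (a : heckePar b p Q) (v : V),
    t = (h * (a : Hecke b p)) ⊗ₜ[ℂ] v - h ⊗ₜ[ℂ] (a • v)}

/-- Parabolic induction: `ind_{ℋ^Q}^ℋ V = ℋ ⊗_{ℋ^Q} V`. -/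
abbrev Ind (Q : Set b.support) (V : Type*) [AddCommGroup V] [Module ℂ V]
    [Module (heckePar b p Q) V] : Type _ :=
  (Hecke b p ⊗[ℂ] V) ⧸ indRel b p Q V

end RootDatum

/-! ### Multiplicities -/

/-- The quotient `B / A` for submodules `A ≤ B`. -/
abbrev Subquot {R M : Type*} [Ring R] [AddCommGroup M] [Module R M] (A B : Submodule R M) :
    Type _ := ↥B ⧸ A.submoduleOf B

/-- The multiplicity of a simple module `S` as a subquotient of `M`: the supremum, over all finite
chains of submodules of `M`, of the number of successive quotients isomorphic to `S`. -/
def simpleMult (R S M : Type*) [Ring R] [AddCommGroup S] [Module R S] [AddCommGroup M]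
    [Module R M] : ℕ∞ :=
  ⨆ c : LTSeries (Submodule R M),
    (Nat.card {i : Fin c.length //
      Nonempty (Subquot (c i.castSucc) (c i.succ) ≃ₗ[R] S)} : ℕ∞)

end AffHecke
end

open scoped TensorProduct

noncomputable section

namespace AffHecke

/-! ### Iwahori--Hecke algebras of groups with a length function -/

/-! Genericity is detected by an idempotent. In `ℋ(W_P, q^λ)` the sum of all `St(N_w) N_w` is an
eigenvector for `St` under multiplication from both sides. Its own `St`-value is a sum of squares of
real numbers with the term 1 at `w = 1`, so it rescales to an idempotent `e_P`; write `e` for `e_Δ`.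
A module `M` is generic exactly when `e M ≠ 0`, and `Hom(M, St)` consists of the functionals `f`
with `f(e m) = f(m)`.

The first main point is that `e · ind V` is a copy of `e_P V`. Let `𝒜` be the span of the `θ_x`. The
Bernstein decomposition writes `ℋ` as `ℋ(W, q^λ) 𝒜`, so `e ℋ = e 𝒜`. The elements `e θ_x` are
linearly independent, so `e h = e Φ(h)` for a unique `Φ(h)` in `𝒜` (`exists_thetaPart`). Together
with `e e_P = e` this shows that `e · ind V` consists of the vectors `e ⊗ e_P v`. Conversely, a
functional `f` on `V` with `f ∘ e_P = f` extends to the induced module by `h ⊗ v ↦ f(Φ(h) v)`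
(`exists_functional_ind`), so no vector of `e_P V` is lost. This proves (a).

The second main point is that `e_P V` is a line when `V` is simple and generic. Here `ℋ^P e_P = 𝒜
e_P`, so `V = 𝒜 v` for every nonzero `v` in `e_P V`. Since `𝒜` is commutative and finitely
generated, the Nullstellensatz provides a nonzero functional on `V` on which `𝒜` acts by a
character. Its kernel is `𝒜`-stable and proper, so it contains no nonzero vector of `e_P V`, and
`e_P V` embeds in `ℂ` (`exists_smul_eq_of_isSimpleModule`).

Hence `e` has rank one on `M = ind V`, say with image `ℂ m₀`. The Hom space is then one-dimensional,
and a subquotient `B/A` is generic exactly when `m₀` lies in `B` but not in `A`. In a chain of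
submodules this happens at one step at most. The submodule `ℋ m₀` modulo its largest submodule
avoiding `m₀` is simple and generic, and any other generic simple subquotient is isomorphic to it.

The foundations are that the `N_w` form a basis, shown by a regular representation, and a weak
Bernstein relation `N_s θ_x - θ_{s x} N_s ∈ 𝒜`, obtained from alcove walks. The explicit form of the
correction term is never needed. -/

/-- The properties of a length function, of simple reflections and of parameters for which the
symbols `N_w` form a basis of the Iwahori--Hecke algebra. -/
structure LengthSystem {G J : Type*} [Group G] (len : G → ℕ) (s : J → G) (q : J → ℝ) : Prop where
  mul_self : ∀ j, s j * s j = 1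
  step : ∀ g j, len (g * s j) = len g + 1 ∨ len (g * s j) + 1 = len g
  descent : ∀ g, len g ≠ 0 → ∃ j, len (g * s j) + 1 = len g
  inv : ∀ g, len g⁻¹ = len g
  mul_of_zero : ∀ g u, len u = 0 → len (g * u) = len g
  exchange : ∀ g i j, len (s i * g) = len (g * s j) → len (s i * g * s j) = len g →
    s i * g = g * s j
  q_conj : ∀ g i j, s i * g = g * s j → q i = q j

/-- The coefficient `q_s^{1/2} - q_s^{-1/2}` of the quadratic relation. -/
def quadCoeff {J : Type*} (q : J → ℝ) (j : J) : ℂ :=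
  ((q j ^ (1 / 2 : ℝ) - q j ^ (-(1 / 2) : ℝ) : ℝ) : ℂ)

/-! ### The defining relations. -/

namespace IwahoriHecke

variable {G J : Type*} [Group G] {len : G → ℕ} {s : J → G} {q : J → ℝ}

theorem N_one : N len s q 1 = 1 := by
  simpa only [N, map_one] using
    RingQuot.mkAlgHom_rel ℂ (IHRel.one (len := len) (s := s) (q := q))

theorem N_up {w : G} {j : J} (h : len (w * s j) = len w + 1) :
    N len s q w * N len s q (s j) = N len s q (w * s j) := by
  have := RingQuot.mkAlgHom_rel ℂ (IHRel.up (len := len) (s := s) (q := q) w j h)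
  simpa [N] using this

theorem N_down {w : G} {j : J} (h : len (w * s j) + 1 = len w) :
    N len s q w * N len s q (s j) = N len s q (w * s j) + quadCoeff q j • N len s q w := by
  have := RingQuot.mkAlgHom_rel ℂ (IHRel.down (len := len) (s := s) (q := q) w j h)
  simpa only [N, quadCoeff, map_mul, map_add, map_smul] using this

theorem N_lenZero (w : G) {u : G} (h : len u = 0) :
    N len s q w * N len s q u = N len s q (w * u) := by
  have := RingQuot.mkAlgHom_rel ℂ (IHRel.lenZero (len := len) (s := s) (q := q) w u h)
  simpa [N] using this

theorem induction_adjoin {S : Subalgebra ℂ (IwahoriHecke len s q)}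
    (h : ∀ w, N len s q w ∈ S) (x : IwahoriHecke len s q) : x ∈ S := by
  obtain ⟨x, rfl⟩ := RingQuot.mkAlgHom_surjective ℂ _ x
  induction x using FreeAlgebra.induction with
  | grade0 r => simp
  | grade1 w => exact h w
  | mul x y hx hy => rw [map_mul]; exact mul_mem hx hy
  | add x y hx hy => rw [map_add]; exact add_mem hx hy

end IwahoriHecke

/-! ### Length functions. -/

namespace LengthSystem

open IwahoriHecke

variable {G J : Type*} [Group G] {len : G → ℕ} {s : J → G} {q : J → ℝ}
variable (L : LengthSystem len s q)
include L

theorem mul_s_mul_s (g : G) (j : J) : g * s j * s j = g := by rw [mul_assoc, L.mul_self, mul_one]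

theorem s_inv (j : J) : (s j)⁻¹ = s j := inv_eq_of_mul_eq_one_left (L.mul_self j)

/-- Descent cannot go on forever, so some `g` has length zero. Right multiplication by `g` preserves
length, and `1 = g⁻¹ g`. -/
theorem len_one : len 1 = 0 := by
  by_contra h
  obtain ⟨j, hj⟩ := L.descent 1 h
  have h1 := L.inv (s j)
  obtain ⟨g, hg⟩ : ∃ g, len g = 0 := by
    by_contra hc
    push Not at hc
    have : ∀ n g, len g = n → False := by
      intro n
      induction n with
      | zero => exact fun g hg => hc g hg
      | succ n ih =>
        intro g hg
        obtain ⟨j, hj⟩ := L.descent g (hc g)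
        exact ih _ (by omega : len (g * s j) = n)
    exact this _ 1 rfl
  have := L.mul_of_zero g⁻¹ g hg
  rw [inv_mul_cancel, L.inv, hg] at this
  exact h this

theorem left_step (g : G) (j : J) : len (s j * g) = len g + 1 ∨ len (s j * g) + 1 = len g := by
  have := L.step g⁻¹ j
  rwa [← L.inv, mul_inv_rev, inv_inv, L.s_inv, L.inv g] at this

theorem zero_mul (g u : G) (h : len u = 0) : len (u * g) = len g := by
  have := L.mul_of_zero g⁻¹ u⁻¹ (by rwa [L.inv])
  rwa [← mul_inv_rev, L.inv, L.inv] at this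

/-- Induction on the length, by multiplication with simple reflections on the right. -/
theorem induction_right {p : G → Prop} (h0 : ∀ u, len u = 0 → p u)
    (hs : ∀ g j, len (g * s j) = len g + 1 → p g → p (g * s j)) (g : G) : p g := by
  induction h : len g generalizing g with
  | zero => exact h0 g h
  | succ n ih =>
    obtain ⟨j, hj⟩ := L.descent g (by omega)
    have := hs (g * s j) j (by rw [L.mul_s_mul_s]; omega) (ih _ (by omega))
    rwa [L.mul_s_mul_s] at this

/-- Induction on the length, by multiplication with simple reflections on the left. -/
theorem induction_left {p : G → Prop} (h0 : ∀ u, len u = 0 → p u)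
    (hs : ∀ g j, len (s j * g) = len g + 1 → p g → p (s j * g)) (g : G) : p g := by
  have := L.induction_right (p := fun g => p g⁻¹) (fun u hu => h0 _ (by rwa [L.inv]))
    (fun g j hg ih => by
      have := hs g⁻¹ j (by rw [← L.inv, mul_inv_rev, inv_inv, L.s_inv, hg, L.inv]) ih
      rwa [mul_inv_rev, L.s_inv]) g⁻¹
  simpa using this

theorem len_mul_le (g h : G) : len (g * h) ≤ len g + len h := by
  induction h using L.induction_right with
  | h0 u hu => rw [L.mul_of_zero g u hu]; omega
  | hs h j hj ih =>
    have := L.step (g * h) j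
    rw [← mul_assoc]
    omega

theorem len_s (j : J) : len (s j) = 1 := by
  have := L.step 1 j
  rw [one_mul, L.len_one] at this
  omega

/-! ### The regular representation and the basis theorem. -/

omit L in
/-- The operator on `ℂ[G]` of right multiplication by `N_s`. -/
def rightOp (len : G → ℕ) (s : J → G) (q : J → ℝ) (j : J) : Module.End ℂ (G →₀ ℂ) :=
  Finsupp.linearCombination ℂ fun g => Finsupp.single (g * s j) 1 +
    if len (g * s j) < len g then quadCoeff q j • Finsupp.single g 1 else 0

omit L in
/-- The operator on `ℂ[G]` of left multiplication by `N_s`. -/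
def leftOp (len : G → ℕ) (s : J → G) (q : J → ℝ) (j : J) : Module.End ℂ (G →₀ ℂ) :=
  Finsupp.linearCombination ℂ fun g => Finsupp.single (s j * g) 1 +
    if len (s j * g) < len g then quadCoeff q j • Finsupp.single g 1 else 0

omit L in
/-- The endomorphisms of `ℂ[G]` that commute with all right multiplications. -/
def rightCentralizer (len : G → ℕ) (s : J → G) (q : J → ℝ) : Subalgebra ℂ (Module.End ℂ (G →₀ ℂ)) :=
  Subalgebra.centralizer ℂ (Set.range (rightOp len s q) ∪
    {φ | ∃ u, len u = 0 ∧ φ = Finsupp.lmapDomain ℂ ℂ (· * u)})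

omit L in
theorem mem_rightCentralizer {φ : Module.End ℂ (G →₀ ℂ)} :
    φ ∈ rightCentralizer len s q ↔
      (∀ j x, φ (rightOp len s q j x) = rightOp len s q j (φ x)) ∧
      ∀ u, len u = 0 → ∀ x, φ (Finsupp.mapDomain (· * u) x) = Finsupp.mapDomain (· * u) (φ x) := by
  simp only [rightCentralizer, Subalgebra.mem_centralizer_iff, Set.mem_union, Set.mem_range,
    Set.mem_ofPred_eq, LinearMap.ext_iff, Module.End.mul_apply]
  constructor
  · exact fun h => ⟨fun j x => (h _ (Or.inl ⟨j, fun _ => rfl⟩) x).symm,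
      fun u hu x => (h _ (Or.inr ⟨u, hu, fun _ => rfl⟩) x).symm⟩
  · rintro ⟨h1, h2⟩ ψ (⟨j, hj⟩ | ⟨u, hu, hφ⟩) x
    · rw [← hj, ← hj]
      exact (h1 j x).symm
    · rw [hφ, hφ]
      exact (h2 u hu x).symm

omit L in
theorem rightOp_single (j : J) (g : G) : rightOp len s q j (Finsupp.single g 1) =
    Finsupp.single (g * s j) 1 +
      if len (g * s j) < len g then quadCoeff q j • Finsupp.single g 1 else 0 := by
  simp [rightOp]

omit L in
theorem leftOp_single (j : J) (g : G) : leftOp len s q j (Finsupp.single g 1) =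
    Finsupp.single (s j * g) 1 +
      if len (s j * g) < len g then quadCoeff q j • Finsupp.single g 1 else 0 := by
  simp [leftOp]

omit [Group G] L in
theorem end_ext {φ ψ : (G →₀ ℂ) →ₗ[ℂ] (G →₀ ℂ)}
    (h : ∀ g, φ (Finsupp.single g 1) = ψ (Finsupp.single g 1)) (x : G →₀ ℂ) : φ x = ψ x := by
  have : φ = ψ := Finsupp.lhom_ext' fun g => LinearMap.ext_ring (h g)
  rw [this]

/-- Left and right multiplications commute. The only critical configuration is `len (s_i g) = len (g
s_j)` with `len (s_i g s_j) = len g`. Outside it, whether `s_i` lowers the length is not affected by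
`s_j` and conversely, so both composites have the same terms. -/
theorem leftOp_mem (i : J) : leftOp len s q i ∈ rightCentralizer len s q := by
  refine mem_rightCentralizer.2 ⟨fun j x => ?_, fun u hu x => ?_⟩
  · refine end_ext (φ := leftOp len s q i * rightOp len s q j)
      (ψ := rightOp len s q j * leftOp len s q i) (fun g => ?_) x
    have e1 := L.left_step g i
    have e2 := L.step g j
    have e3 := L.left_step (g * s j) i
    have e4 := L.step (s i * g) j
    have e5 := L.exchange g i j
    simp only [Module.End.mul_apply, rightOp_single, leftOp_single, map_add, ← mul_assoc]
      at e3 e4 ⊢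
    by_cases hx : len (s i * g) = len (g * s j) ∧ len (s i * g * s j) = len g
    · have e6 := e5 hx.1 hx.2
      -- In the critical case the exchange property gives `s_i g = g s_j`, and the quadratic terms
      -- match because conjugate reflections have equal parameters.
      have hq := L.q_conj g i j e6
      have hc : quadCoeff q i = quadCoeff q j := by simp only [quadCoeff, hq]
      rw [hc, e6, L.mul_s_mul_s]
      split_ifs
      all_goals first
        | omega
        | simp only [map_smul, leftOp_single, rightOp_single, hc, e6, map_zero]
    · have h1 : len (s i * g * s j) < len (g * s j) ↔ len (s i * g) < len g := by omega
      have h2 : len (s i * g * s j) < len (s i * g) ↔ len (g * s j) < len g := by omega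
      simp only [h1, h2]
      split_ifs <;>
        simp_all only [map_smul, leftOp_single, rightOp_single, map_zero, add_zero, if_true,
          if_false, smul_add, smul_smul, mul_comm (quadCoeff q i) (quadCoeff q j)] <;>
        abel
  · refine end_ext (φ := leftOp len s q i * Finsupp.lmapDomain ℂ ℂ (· * u))
      (ψ := Finsupp.lmapDomain ℂ ℂ (· * u) * leftOp len s q i) (fun g => ?_) x
    simp only [Module.End.mul_apply, Finsupp.lmapDomain_apply, Finsupp.mapDomain_single,
      leftOp_single, Finsupp.mapDomain_add, ← mul_assoc, L.mul_of_zero _ u hu]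
    split_ifs
    · simp
    · simp

theorem leftMul_mem (v : G) (hv : len v = 0) :
    (Finsupp.lmapDomain ℂ ℂ (v * ·) : Module.End ℂ (G →₀ ℂ)) ∈ rightCentralizer len s q := by
  refine mem_rightCentralizer.2 ⟨fun j x => ?_, fun u hu x => ?_⟩
  · refine end_ext (φ := Finsupp.lmapDomain ℂ ℂ (v * ·) * rightOp len s q j)
      (ψ := rightOp len s q j * Finsupp.lmapDomain ℂ ℂ (v * ·)) (fun g => ?_) x
    simp only [Module.End.mul_apply, Finsupp.lmapDomain_apply, Finsupp.mapDomain_single,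
      rightOp_single, Finsupp.mapDomain_add, mul_assoc, L.zero_mul _ v hv]
    split_ifs
    · simp
    · simp
  · simp only [Finsupp.lmapDomain_apply, ← Finsupp.mapDomain_comp]
    congr 1
    funext g
    simp [mul_assoc]

theorem exists_mem_apply_one (g : G) :
    ∃ φ ∈ rightCentralizer len s q, φ (Finsupp.single 1 1) = Finsupp.single g 1 := by
  induction g using L.induction_left with
  | h0 u hu => exact ⟨_, L.leftMul_mem u hu, by simp⟩
  | hs g j hj ih =>
    obtain ⟨φ, hφ, h1⟩ := ih
    refine ⟨_, mul_mem (L.leftOp_mem j) hφ, ?_⟩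
    rw [Module.End.mul_apply, h1, leftOp_single, if_neg (by omega), add_zero]

/-- The basis vector at 1 generates `ℂ[G]` under right multiplications, so an operator commuting
with these is determined by one value. Relations between such operators need checking only there. -/
theorem rightCentralizer_ext {φ ψ : Module.End ℂ (G →₀ ℂ)} (hφ : φ ∈ rightCentralizer len s q)
    (hψ : ψ ∈ rightCentralizer len s q)
    (h : φ (Finsupp.single 1 1) = ψ (Finsupp.single 1 1)) : φ = ψ := by
  rw [mem_rightCentralizer] at hφ hψ
  refine LinearMap.ext (end_ext fun g => ?_)
  induction g using L.induction_right with
  | h0 u hu =>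
    have := congrArg (Finsupp.mapDomain (· * u)) h
    rw [← hφ.2 u hu, ← hψ.2 u hu] at this
    simpa using this
  | hs g j hj ih =>
    have := congrArg (rightOp len s q j) ih
    rw [← hφ.1, ← hψ.1, rightOp_single, if_neg (by omega), add_zero] at this
    exact this

/-- The coordinates in the basis `N_g` of the Iwahori--Hecke algebra. -/
theorem exists_coord :
    ∃ Ψ : IwahoriHecke len s q →ₗ[ℂ] (G →₀ ℂ), ∀ g, Ψ (N len s q g) = Finsupp.single g 1 := by
  -- `N_g` is to act by the operator in the centralizer that sends the basis vector at 1 to the one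
  -- at `g`. Evaluation at the vector at 1 then recovers coordinates.
  choose ℓ hℓ h1 using L.exists_mem_apply_one
  have hrel : ∀ ⦃x y⦄, IHRel len s q x y → FreeAlgebra.lift ℂ ℓ x = FreeAlgebra.lift ℂ ℓ y := by
    intro x y h
    have hc := fun g => mem_rightCentralizer.1 (hℓ g)
    cases h with
    | one =>
      simp only [FreeAlgebra.lift_ι_apply, map_one]
      exact L.rightCentralizer_ext (hℓ _) (one_mem _) (by simp [h1])
    | up w j h =>
      simp only [FreeAlgebra.lift_ι_apply, map_mul]
      refine L.rightCentralizer_ext (mul_mem (hℓ _) (hℓ _)) (hℓ _) ?_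
      -- The vector at `s_j` is a right multiple of the vector at 1, so the operator `ℓ w` can be
      -- moved past that right multiplication.
      have h2 := rightOp_single (len := len) (s := s) (q := q) j 1
      rw [if_neg (by rw [L.len_one]; omega), add_zero, one_mul] at h2
      rw [Module.End.mul_apply, h1, ← h2, (hc w).1, h1, h1, rightOp_single,
        if_neg (by omega), add_zero]
    | down w j h =>
      simp only [FreeAlgebra.lift_ι_apply, map_mul, map_add, map_smul]
      refine L.rightCentralizer_ext (mul_mem (hℓ _) (hℓ _))
        (add_mem (hℓ _) (Subalgebra.smul_mem _ (hℓ _) _)) ?_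
      have h2 := rightOp_single (len := len) (s := s) (q := q) j 1
      rw [if_neg (by rw [L.len_one]; omega), add_zero, one_mul] at h2
      rw [Module.End.mul_apply, h1, ← h2, (hc w).1, h1, rightOp_single, if_pos (by omega),
        LinearMap.add_apply, LinearMap.smul_apply, h1, h1]
      rfl
    | lenZero w u h =>
      simp only [FreeAlgebra.lift_ι_apply, map_mul]
      refine L.rightCentralizer_ext (mul_mem (hℓ _) (hℓ _)) (hℓ _) ?_
      have h2 := (hc w).2 u h (Finsupp.single 1 1)
      rw [Finsupp.mapDomain_single, one_mul, h1, Finsupp.mapDomain_single] at h2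
      rw [Module.End.mul_apply, h1, h1, h2]
  let ρ : IwahoriHecke len s q →ₐ[ℂ] Module.End ℂ (G →₀ ℂ) :=
    RingQuot.liftAlgHom ℂ ⟨FreeAlgebra.lift ℂ ℓ, hrel⟩
  refine ⟨(LinearMap.applyₗ (Finsupp.single (1 : G) (1 : ℂ))).comp ρ.toLinearMap, fun g => ?_⟩
  simp [ρ, N, h1]

end LengthSystem

/-- A map `N` to an algebra whose values form a basis that multiplies by the rules of the
Iwahori--Hecke algebra. -/
structure HeckeBasis {G J H : Type*} [Group G] [Ring H] [Algebra ℂ H] (len : G → ℕ) (s : J → G)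
    (q : J → ℝ) (N : G → H) : Prop extends LengthSystem len s q where
  one : N 1 = 1
  up : ∀ {w j}, len (w * s j) = len w + 1 → N w * N (s j) = N (w * s j)
  down : ∀ {w j}, len (w * s j) + 1 = len w → N w * N (s j) = N (w * s j) + quadCoeff q j • N w
  lenZero : ∀ (w) {u}, len u = 0 → N w * N u = N (w * u)
  adjoin : Algebra.adjoin ℂ (Set.range N) = ⊤
  coord : ∃ Ψ : H →ₗ[ℂ] (G →₀ ℂ), ∀ g, Ψ (N g) = Finsupp.single g 1

theorem LengthSystem.heckeBasis {G J : Type*} [Group G] {len : G → ℕ} {s : J → G} {q : J → ℝ}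
    (L : LengthSystem len s q) : HeckeBasis len s q (IwahoriHecke.N len s q) where
  toLengthSystem := L
  one := IwahoriHecke.N_one
  up := IwahoriHecke.N_up
  down := IwahoriHecke.N_down
  lenZero := IwahoriHecke.N_lenZero
  adjoin := Algebra.eq_top_iff.2 fun x =>
    IwahoriHecke.induction_adjoin (S := Algebra.adjoin ℂ (Set.range (IwahoriHecke.N len s q)))
      (fun w => Algebra.subset_adjoin (Set.mem_range_self w)) x
  coord := L.exists_coord

/-! ### Products, inverses and spanning of the basis elements. -/

namespace HeckeBasis

variable {G J H : Type*} [Group G] [Ring H] [Algebra ℂ H] {len : G → ℕ} {s : J → G} {q : J → ℝ}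
  {N : G → H} (L : HeckeBasis len s q N)
include L

theorem N_mul {g h : G} (hl : len (g * h) = len g + len h) :
    N g * N h = N (g * h) := by
  induction h using L.induction_right with
  | h0 u hu => exact L.lenZero g hu
  | hs h j hj ih =>
    have h1 := L.len_mul_le g h
    have h2 := L.step (g * h) j
    rw [← mul_assoc] at hl ⊢
    have h3 : len (g * h) = len g + len h := by omega
    rw [← L.up hj, ← mul_assoc, ih h3, L.up (by omega)]

theorem N_s_sq (j : J) :
    N (s j) * N (s j) = 1 + quadCoeff q j • N (s j) := by
  rw [L.down (by rw [L.mul_self, L.len_one, L.len_s]), L.mul_self, L.one]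

theorem N_s_mul_sub (j : J) :
    N (s j) * (N (s j) - algebraMap ℂ _ (quadCoeff q j)) = 1 := by
  rw [mul_sub, L.N_s_sq, ← Algebra.commutes, ← Algebra.smul_def]
  abel

theorem N_sub_mul_s (j : J) :
    (N (s j) - algebraMap ℂ _ (quadCoeff q j)) * N (s j) = 1 := by
  rw [sub_mul, L.N_s_sq, ← Algebra.smul_def]
  abel

theorem isUnit_N (g : G) : IsUnit (N g) := by
  induction g using L.induction_right with
  | h0 u hu =>
    have hu' : len u⁻¹ = 0 := by rwa [L.inv]
    exact ⟨⟨N u, N u⁻¹, by rw [L.lenZero _ hu', mul_inv_cancel, L.one],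
      by rw [L.lenZero _ hu, inv_mul_cancel, L.one]⟩, rfl⟩
  | hs g j hj ih =>
    rw [← L.up hj]
    exact ih.mul ⟨⟨_, _, L.N_s_mul_sub j, L.N_sub_mul_s j⟩, rfl⟩

/-- The unit `N_g` of the Iwahori--Hecke algebra. -/
def U (g : G) : Hˣ := (L.isUnit_N g).unit

@[simp] theorem coe_U (g : G) : (L.U g : H) = N g := rfl

theorem U_mul {g h : G} (hl : len (g * h) = len g + len h) : L.U g * L.U h = L.U (g * h) :=
  Units.ext (L.N_mul hl)

theorem coe_U_s_inv (j : J) : (((L.U (s j))⁻¹ : Hˣ) : H) =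
    N (s j) - quadCoeff q j • (1 : H) := by
  rw [Units.inv_eq_of_mul_eq_one_right]
  have := L.N_s_mul_sub j
  rwa [Algebra.algebraMap_eq_smul_one] at this

/-- The span is stable under right multiplication by every `N_h`, by induction on the length of `h`.
It is therefore a subalgebra containing the generators. -/
theorem span_N : Submodule.span ℂ (Set.range N) = ⊤ := by
  set S := Submodule.span ℂ (Set.range N) with hS
  have key : ∀ h, ∀ x ∈ S, x * N h ∈ S := by
    intro h
    induction h using L.induction_right with
    | h0 u hu =>
      intro x hx
      induction hx using Submodule.span_induction with
      | mem x hx =>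
        obtain ⟨g, rfl⟩ := hx
        rw [L.lenZero g hu]
        exact Submodule.subset_span ⟨_, rfl⟩
      | zero => simp
      | add x y _ _ hx hy => rw [add_mul]; exact add_mem hx hy
      | smul c x _ hx => rw [Algebra.smul_mul_assoc]; exact S.smul_mem c hx
    | hs h j hj ih =>
      intro x hx
      rw [← L.up hj, ← mul_assoc]
      replace ih := ih x hx
      generalize x * N h = y at ih
      induction ih using Submodule.span_induction with
      | mem x hx =>
        obtain ⟨g, rfl⟩ := hx
        rcases L.step g j with h | h
        · rw [L.up h]; exact Submodule.subset_span ⟨_, rfl⟩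
        · rw [L.down h]
          exact add_mem (Submodule.subset_span ⟨_, rfl⟩)
            (S.smul_mem _ (Submodule.subset_span ⟨_, rfl⟩))
      | zero => simp
      | add x y _ _ hx hy => rw [add_mul]; exact add_mem hx hy
      | smul c x _ hx => rw [Algebra.smul_mul_assoc]; exact S.smul_mem c hx
  have hmul : ∀ x ∈ S, ∀ y ∈ S, x * y ∈ S := by
    intro x hx y hy
    induction hy using Submodule.span_induction with
    | mem y hy => obtain ⟨g, rfl⟩ := hy; exact key g x hx
    | zero => simp
    | add y z _ _ hy hz => rw [mul_add]; exact add_mem hy hz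
    | smul c y _ hy => rw [Algebra.mul_smul_comm]; exact S.smul_mem c hy
  let A : Subalgebra ℂ H :=
    S.toSubalgebra (Submodule.subset_span ⟨1, L.one⟩) (fun x y hx hy => hmul x hx y hy)
  have hA : Algebra.adjoin ℂ (Set.range N) ≤ A := Algebra.adjoin_le Submodule.subset_span
  rw [L.adjoin] at hA
  exact Submodule.eq_top_iff'.2 fun x => hA Algebra.mem_top

end HeckeBasis

section RootDatumLemmas

variable {ι X Y : Type*} [AddCommGroup X] [AddCommGroup Y] {𝓡 : RootDatum ι X Y}

/-! ### Roots, coroots and the Weyl group -/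

theorem weylGroup_ext {w u : 𝓡.weylGroup} (h : ∀ x : X, w • x = u • x) : w = u :=
  Subtype.ext (RootPairing.Equiv.weightHom_injective 𝓡 (LinearEquiv.ext h))

theorem ofIdx_smul_apply (i : ι) (x : X) : RootPairing.weylGroup.ofIdx 𝓡 i • x =
    x - 𝓡.toLinearMap x (𝓡.coroot i) • 𝓡.root i := rfl

theorem ofIdx_smul_idx (i j : ι) :
    RootPairing.weylGroup.ofIdx 𝓡 i • j = 𝓡.reflectionPerm i j := rfl

theorem smul_zsmul_weyl (w : 𝓡.weylGroup) (n : ℤ) (x : X) : w • (n • x) = n • w • x :=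
  map_zsmul (DistribSMul.toAddMonoidHom X w) n x

theorem pairing_smul_smul (w : 𝓡.weylGroup) (x : X) (i : ι) :
    𝓡.toLinearMap (w • x) (𝓡.coroot (w • i)) = 𝓡.toLinearMap x (𝓡.coroot i) := by
  have h1 := RootPairing.Hom.weight_coweight_transpose_apply 𝓡 𝓡 (𝓡.coroot (w • i)) w.1.toHom
  have h2 := RootPairing.Hom.coroot_coweightMap_apply 𝓡 𝓡 (w • i) w.1.toHom
  have h3 : w.1.toHom.indexEquiv.symm (w • i) = i := w.1.toHom.indexEquiv.symm_apply_apply i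
  rw [h2, h3] at h1
  exact LinearMap.congr_fun h1 x

theorem pairing_smul_left (w : 𝓡.weylGroup) (x : X) (i : ι) :
    𝓡.toLinearMap (w • x) (𝓡.coroot i) = 𝓡.toLinearMap x (𝓡.coroot (w⁻¹ • i)) := by
  rw [← pairing_smul_smul w x, smul_inv_smul]

theorem pairing_smul_right (w : 𝓡.weylGroup) (x : X) (i : ι) :
    𝓡.toLinearMap x (𝓡.coroot (w • i)) = 𝓡.toLinearMap (w⁻¹ • x) (𝓡.coroot i) := by
  rw [pairing_smul_left, inv_inv]

theorem ofIdx_smul (w : 𝓡.weylGroup) (i : ι) : RootPairing.weylGroup.ofIdx 𝓡 (w • i) =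
    w * RootPairing.weylGroup.ofIdx 𝓡 i * w⁻¹ := by
  refine weylGroup_ext fun x => ?_
  rw [mul_smul, mul_smul, ofIdx_smul_apply, ofIdx_smul_apply, smul_sub, smul_inv_smul,
    smul_zsmul_weyl, root_smul, pairing_smul_right]

/-- The index of the root `-α_i`. -/
def negIdx (𝓡 : RootDatum ι X Y) (i : ι) : ι := RootPairing.weylGroup.ofIdx 𝓡 i • i

theorem root_negIdx (i : ι) : 𝓡.root (negIdx 𝓡 i) = -𝓡.root i := root_refl_self i

theorem coroot_negIdx (i : ι) : 𝓡.coroot (negIdx 𝓡 i) = -𝓡.coroot i := by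
  rw [negIdx, ofIdx_smul_idx, RootPairing.coroot_reflectionPerm,
    RootPairing.coreflection_apply_self]

theorem negIdx_negIdx (i : ι) : negIdx 𝓡 (negIdx 𝓡 i) = i :=
  𝓡.root.injective (by rw [root_negIdx, root_negIdx, neg_neg])

theorem smul_negIdx (w : 𝓡.weylGroup) (i : ι) : w • negIdx 𝓡 i = negIdx 𝓡 (w • i) :=
  𝓡.root.injective (by rw [root_smul, root_negIdx, root_negIdx, smul_neg, root_smul])

theorem ofIdx_negIdx (i : ι) :
    RootPairing.weylGroup.ofIdx 𝓡 (negIdx 𝓡 i) = RootPairing.weylGroup.ofIdx 𝓡 i := by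
  rw [negIdx, ofIdx_smul, mul_assoc, mul_inv_cancel, mul_one]

theorem ofIdx_inv (i : ι) :
    (RootPairing.weylGroup.ofIdx 𝓡 i)⁻¹ = RootPairing.weylGroup.ofIdx 𝓡 i :=
  inv_eq_of_mul_eq_one_left (refl_refl i)

theorem ofIdx_smul_smul (i j : ι) :
    RootPairing.weylGroup.ofIdx 𝓡 i • RootPairing.weylGroup.ofIdx 𝓡 i • j = j := by
  rw [smul_smul, refl_refl, one_smul]

theorem pairing_root_self (i : ι) : 𝓡.toLinearMap (𝓡.root i) (𝓡.coroot i) = 2 :=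
  𝓡.root_coroot_two i

theorem coroot_refl (i j : ι) : 𝓡.coroot (RootPairing.weylGroup.ofIdx 𝓡 j • i) =
    𝓡.coroot i - 𝓡.toLinearMap (𝓡.root j) (𝓡.coroot i) • 𝓡.coroot j :=
  (RootPairing.coroot_reflectionPerm _ _ _).trans (RootPairing.coreflection_apply_coroot _ _ _)

theorem torsionFree_left (𝓡 : RootDatum ι X Y) : IsAddTorsionFree X :=
  have : Module.IsReflexive ℤ X := Module.IsReflexive.of_isPerfPair 𝓡.toLinearMap
  Module.isTorsionFree_int_iff_isAddTorsionFree.1 inferInstance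

theorem torsionFree_right (𝓡 : RootDatum ι X Y) : IsAddTorsionFree Y :=
  have : Module.IsReflexive ℤ Y := Module.IsReflexive.of_isPerfPair 𝓡.toLinearMap.flip
  Module.isTorsionFree_int_iff_isAddTorsionFree.1 inferInstance

theorem pairingIn_int (i j : ι) :
    𝓡.pairingIn ℤ i j = 𝓡.toLinearMap (𝓡.root i) (𝓡.coroot j) :=
  𝓡.algebraMap_pairingIn ℤ i j

theorem pairing_pos_comm [Finite ι] {i j : ι} :
    0 < 𝓡.toLinearMap (𝓡.root i) (𝓡.coroot j) ↔ 0 < 𝓡.toLinearMap (𝓡.root j) (𝓡.coroot i) := by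
  rw [← pairingIn_int, ← pairingIn_int, RootPairing.zero_lt_pairingIn_iff']

theorem pairing_neg_comm [Finite ι] {i j : ι} :
    𝓡.toLinearMap (𝓡.root i) (𝓡.coroot j) < 0 ↔ 𝓡.toLinearMap (𝓡.root j) (𝓡.coroot i) < 0 := by
  rw [← pairingIn_int, ← pairingIn_int, RootPairing.pairingIn_lt_zero_iff]

theorem pairing_zero_comm [Finite ι] {i j : ι} :
    𝓡.toLinearMap (𝓡.root i) (𝓡.coroot j) = 0 ↔ 𝓡.toLinearMap (𝓡.root j) (𝓡.coroot i) = 0 := by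
  have h1 := pairing_pos_comm (𝓡 := 𝓡) (i := i) (j := j)
  have h2 := pairing_neg_comm (𝓡 := 𝓡) (i := i) (j := j)
  omega

theorem exists_coroot_sub [Finite ι] {i j : ι} (hij : i ≠ j)
    (h : 0 < 𝓡.toLinearMap (𝓡.root i) (𝓡.coroot j)) :
    ∃ k, 𝓡.coroot k = 𝓡.coroot i - 𝓡.coroot j := by
  refine 𝓡.flip.root_sub_root_mem_of_pairingIn_pos ?_ hij
  have h1 : 𝓡.flip.pairingIn ℤ i j = 𝓡.toLinearMap (𝓡.root j) (𝓡.coroot i) :=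
    𝓡.flip.algebraMap_pairingIn ℤ i j
  rw [h1]
  exact pairing_pos_comm.1 h

variable (b : 𝓡.Base)

theorem isPos_negIdx (i : ι) : b.IsPos (negIdx 𝓡 i) ↔ ¬ b.IsPos i :=
  index_neg b (root_negIdx i)

theorem isPos_refl_iff [Finite ι] {i j : ι} (hj : j ∈ b.support) (h1 : i ≠ j)
    (h2 : i ≠ negIdx 𝓡 j) : b.IsPos (RootPairing.weylGroup.ofIdx 𝓡 j • i) ↔ b.IsPos i := by
  refine ⟨fun h => ?_, fun h => isPos_refl b h hj h1⟩
  by_contra hc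
  rw [← isPos_negIdx] at hc
  have := isPos_refl b hc hj (fun h => h2 (by rw [← h, negIdx_negIdx]))
  rw [smul_negIdx, isPos_negIdx] at this
  exact this h

theorem root_mem_closure {i : ι} (hi : b.IsPos i) :
    𝓡.root i ∈ AddSubmonoid.closure (𝓡.root '' b.support) := by
  obtain ⟨f, hf, hs, hr⟩ := b.exists_root_eq_sum_int i
  have hpos : 0 < f := by
    refine hs.resolve_right fun hlt => ?_
    rw [RootPairing.Base.isPos_iff, b.height_eq_sum hr] at hi
    exact absurd hi (not_lt.2 (Finset.sum_nonpos fun k _ => hlt.le k))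
  rw [hr]
  refine sum_mem fun j hj => ?_
  obtain ⟨n, hn⟩ := Int.eq_ofNat_of_zero_le (hpos.le j)
  rw [hn, natCast_zsmul]
  exact nsmul_mem (AddSubmonoid.subset_closure (Set.mem_image_of_mem _ hj)) n

/-- Induction on roots by simple reflections. -/
theorem root_induction [Finite ι] {p : ι → Prop} (h0 : ∀ i, p i → p (negIdx 𝓡 i))
    (h1 : ∀ i ∈ b.support, p i)
    (h2 : ∀ i, ∀ j ∈ b.support, p i → p (RootPairing.weylGroup.ofIdx 𝓡 j • i)) (i : ι) : p i := by
  have key : ∀ n i, b.IsPos i → (b.height i).natAbs = n → p i := by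
    intro n
    induction n using Nat.strongRecOn with
    | ind n ih =>
      intro i hi hn
      -- A positive root pairs positively with some simple root. Unless it equals that simple root,
      -- the reflection lowers its height and keeps it positive.
      obtain ⟨j, hj, hj'⟩ := hi.exists_mem_support_pos_pairingIn
      rcases eq_or_ne i j with rfl | hij
      · exact h1 i hj
      have hk := isPos_refl b hi hj hij
      rw [pairingIn_int, pairing_pos_comm] at hj'
      have h3 : 𝓡.root (RootPairing.weylGroup.ofIdx 𝓡 j • i) = 𝓡.root i +
          (-𝓡.toLinearMap (𝓡.root i) (𝓡.coroot j)) • 𝓡.root j := by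
        rw [root_smul, ofIdx_smul_apply, neg_smul, sub_eq_add_neg]
      have h4 := b.height_add_zsmul h3
      rw [RootPairing.Base.height_one_of_mem_support hj, smul_eq_mul] at h4
      have h5 : 0 < b.height i := hi
      have h6 : 0 < b.height (RootPairing.weylGroup.ofIdx 𝓡 j • i) := hk
      have := h2 _ j hj (ih _ (by omega) _ hk rfl)
      rwa [ofIdx_smul_smul] at this
  by_cases hi : b.IsPos i
  · exact key _ i hi rfl
  · have := h0 _ (key _ _ ((isPos_negIdx b i).2 hi) rfl)
    rwa [negIdx_negIdx] at this

/-- Positivity of roots and positivity of coroots agree on simple indices and obey the same rules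
under negation and simple reflections, which reach every root. -/
theorem flip_isPos_iff [Finite ι] (i : ι) : b.flip.IsPos i ↔ b.IsPos i := by
  have hneg : ∀ i, b.flip.IsPos (negIdx 𝓡 i) ↔ ¬ b.flip.IsPos i := fun i => isPos_negIdx b.flip i
  induction i using root_induction b with
  | h0 i hi => exact (hneg i).trans ((not_congr hi).trans (isPos_negIdx b i).symm)
  | h1 i hi =>
    exact iff_of_true (RootPairing.Base.isPos_of_mem_support (b := b.flip) hi)
      (RootPairing.Base.isPos_of_mem_support hi)
  | h2 i j hj h =>
    by_cases h1 : i = j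
    · subst h1
      exact (hneg i).trans ((not_congr h).trans (isPos_negIdx b i).symm)
    by_cases h2 : i = negIdx 𝓡 j
    · have h3 : RootPairing.weylGroup.ofIdx 𝓡 j • i = j := by rw [h2, negIdx, ofIdx_smul_smul]
      rw [h3]
      exact iff_of_true (RootPairing.Base.isPos_of_mem_support (b := b.flip) hj)
        (RootPairing.Base.isPos_of_mem_support hj)
    · exact (isPos_refl_iff b.flip (𝓡 := 𝓡.flip) hj h1 h2).trans
        (h.trans (isPos_refl_iff b hj h1 h2).symm)

theorem coroot_mem_closure [Finite ι] {i : ι} (hi : b.IsPos i) :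
    𝓡.coroot i ∈ AddSubmonoid.closure (𝓡.coroot '' b.support) :=
  root_mem_closure b.flip ((flip_isPos_iff b i).2 hi)

theorem pairing_nonneg_of_dominant [Finite ι] {x : X} (hx : Dominant b x) {i : ι}
    (hi : b.IsPos i) : 0 ≤ 𝓡.toLinearMap x (𝓡.coroot i) := by
  have := coroot_mem_closure b hi
  generalize 𝓡.coroot i = y at this
  induction this using AddSubmonoid.closure_induction with
  | mem y hy => obtain ⟨j, hj, rfl⟩ := hy; exact hx j hj
  | zero => simp
  | add y z _ _ hy hz => rw [map_add]; exact add_nonneg hy hz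

theorem pairing_nonpos_of_dominant [Finite ι] {x : X} (hx : Dominant b x) {i : ι}
    (hi : ¬ b.IsPos i) : 𝓡.toLinearMap x (𝓡.coroot i) ≤ 0 := by
  have := pairing_nonneg_of_dominant b hx ((isPos_negIdx b i).2 hi)
  rw [coroot_negIdx, map_neg] at this
  omega

/-- The sum of the positive roots. -/
def twoRho [Finite ι] (b : 𝓡.Base) : X :=
  letI := Fintype.ofFinite ι
  letI : DecidablePred b.IsPos := Classical.decPred _
  ∑ i with b.IsPos i, 𝓡.root i

/-- The reflection `s_j` permutes the positive roots other than `α_j`. Their sum is fixed by `s_j`,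
hence orthogonal to `α_j^∨`, and `α_j` itself contributes 2. -/
theorem pairing_twoRho [Finite ι] {j : ι} (hj : j ∈ b.support) :
    𝓡.toLinearMap (twoRho b) (𝓡.coroot j) = 2 := by
  let := Fintype.ofFinite ι
  let : DecidablePred b.IsPos := Classical.decPred _
  let : DecidableEq ι := Classical.decEq _
  have hjp := RootPairing.Base.isPos_of_mem_support hj
  have h1 : twoRho b = 𝓡.root j + ∑ i ∈ ({i | b.IsPos i} : Finset ι).erase j, 𝓡.root i := by
    rw [twoRho, Finset.add_sum_erase _ (fun i => 𝓡.root i) (by simpa using hjp)]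
  have h2 : RootPairing.weylGroup.ofIdx 𝓡 j •
      ∑ i ∈ ({i | b.IsPos i} : Finset ι).erase j, 𝓡.root i =
      ∑ i ∈ ({i | b.IsPos i} : Finset ι).erase j, 𝓡.root i := by
    rw [Finset.smul_sum]
    have hmem : ∀ i ∈ ({i | b.IsPos i} : Finset ι).erase j,
        RootPairing.weylGroup.ofIdx 𝓡 j • i ∈ ({i | b.IsPos i} : Finset ι).erase j := by
      intro i hi
      simp only [Finset.mem_erase, Finset.mem_filter, Finset.mem_univ, true_and] at hi ⊢
      refine ⟨fun h => ?_, isPos_refl b hi.2 hj hi.1⟩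
      have : i = negIdx 𝓡 j := by rw [negIdx]; nth_rewrite 2 [← h]; rw [ofIdx_smul_smul]
      rw [this, isPos_negIdx] at hi
      exact hi.2 hjp
    exact Finset.sum_nbij' (fun i => RootPairing.weylGroup.ofIdx 𝓡 j • i)
      (fun i => RootPairing.weylGroup.ofIdx 𝓡 j • i) hmem hmem
      (fun i _ => ofIdx_smul_smul j i) (fun i _ => ofIdx_smul_smul j i)
      (fun i _ => (root_smul _ i).symm)
  have h3 : 𝓡.toLinearMap
      (∑ i ∈ ({i | b.IsPos i} : Finset ι).erase j, 𝓡.root i) (𝓡.coroot j) = 0 := by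
    rw [ofIdx_smul_apply, sub_eq_self] at h2
    have := torsionFree_left 𝓡
    exact (smul_eq_zero.1 h2).resolve_right (𝓡.ne_zero j)
  rw [h1, map_add, LinearMap.add_apply, h3, pairing_root_self, add_zero]

/-- The alternative with zero makes the claim additive, so that induction over the closure applies.
-/
theorem eq_zero_or_pairing_twoRho_pos [Finite ι] {y : Y}
    (hy : y ∈ AddSubmonoid.closure (𝓡.coroot '' b.support)) :
    y = 0 ∨ 0 < 𝓡.toLinearMap (twoRho b) y := by
  induction hy using AddSubmonoid.closure_induction with
  | mem y hy => obtain ⟨j, hj, rfl⟩ := hy; right; rw [pairing_twoRho b hj]; norm_num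
  | zero => exact Or.inl rfl
  | add y z _ _ hy hz =>
    rcases hy with rfl | hy
    · simpa using hz
    · rcases hz with rfl | hz
      · right; simpa using hy
      · right; rw [map_add]; exact add_pos hy hz

theorem pairing_twoRho_pos [Finite ι] {i : ι} (hi : b.IsPos i) :
    0 < 𝓡.toLinearMap (twoRho b) (𝓡.coroot i) :=
  (eq_zero_or_pairing_twoRho_pos b (coroot_mem_closure b hi)).resolve_left (𝓡.ne_zero' i)

theorem pairing_twoRho_neg [Finite ι] {i : ι} (hi : ¬ b.IsPos i) :
    𝓡.toLinearMap (twoRho b) (𝓡.coroot i) < 0 := by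
  have := pairing_twoRho_pos b ((isPos_negIdx b i).2 hi)
  rw [coroot_negIdx, map_neg] at this
  omega

/-! ### Maximal coroots -/

/-- Among the finitely many coroots above the given one, any that maximizes the pairing with `2ρ` is
maximal, since that pairing is strictly increasing for the order. -/
theorem exists_isMaxCoroot [Finite ι] (i : ι) : ∃ m, IsMaxCoroot b m ∧
    𝓡.coroot m - 𝓡.coroot i ∈ AddSubmonoid.closure (𝓡.coroot '' b.support) := by
  obtain ⟨m, hm, hmax⟩ := Set.exists_max_image
    {m | 𝓡.coroot m - 𝓡.coroot i ∈ AddSubmonoid.closure (𝓡.coroot '' b.support)}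
    (fun m => 𝓡.toLinearMap (twoRho b) (𝓡.coroot m)) (Set.toFinite _)
    ⟨i, by simp⟩
  refine ⟨m, fun j hj => ?_, hm⟩
  have h1 : 𝓡.coroot j - 𝓡.coroot i ∈ AddSubmonoid.closure (𝓡.coroot '' b.support) := by
    have := add_mem hj hm
    rwa [sub_add_sub_cancel] at this
  have h2 := hmax j h1
  rcases eq_zero_or_pairing_twoRho_pos b hj with h | h
  · exact 𝓡.coroot.injective (sub_eq_zero.1 h)
  · rw [map_sub] at h
    omega

variable {b}

theorem IsMaxCoroot.isPos [Finite ι] {m : ι} (hm : IsMaxCoroot b m) : b.IsPos m := by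
  by_contra h
  have h1 := coroot_mem_closure b ((isPos_negIdx b m).2 h)
  have h2 := hm (negIdx 𝓡 m) (by
    have := add_mem h1 h1
    rw [coroot_negIdx] at this ⊢
    rwa [sub_eq_add_neg])
  have h3 := isPos_negIdx b m
  rw [h2] at h3
  tauto

/-- If `⟨α_m, α_j^∨⟩ < 0`, then `s_j` adds a positive multiple of `α_j^∨` to `α_m^∨`, against
maximality. -/
theorem IsMaxCoroot.dominant [Finite ι] {m : ι} (hm : IsMaxCoroot b m) :
    Dominant b (𝓡.root m) := by
  intro j hj
  by_contra! hc
  have h1 := pairing_neg_comm.1 hc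
  have h2 := hm (RootPairing.weylGroup.ofIdx 𝓡 j • m) (by
    rw [coroot_refl, sub_sub_cancel_left, ← neg_smul]
    obtain ⟨n, hn⟩ := Int.eq_ofNat_of_zero_le (by omega :
      0 ≤ -𝓡.toLinearMap (𝓡.root j) (𝓡.coroot m))
    rw [hn, natCast_zsmul]
    exact nsmul_mem (AddSubmonoid.subset_closure (Set.mem_image_of_mem _ hj)) n)
  have h3 := coroot_refl (𝓡 := 𝓡) m j
  rw [h2, eq_comm, sub_eq_self] at h3
  have := torsionFree_right 𝓡
  rcases smul_eq_zero.1 h3 with h | h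
  · omega
  · exact 𝓡.ne_zero' j h

/-- If the pairing `n` were at least 2, then `α_m^∨ - α_i^∨` would be a coroot. If it is negative,
`α_i^∨` lies above `α_m^∨`. If it is positive, the coroot `-s_m(α_i^∨) = n α_m^∨ - α_i^∨` lies above
`α_m^∨`. Either way maximality forces `i = m`. No irreducibility is involved, so several maximal
coroots may exist. -/
theorem IsMaxCoroot.pairing_le_one [Finite ι] {m i : ι} (hm : IsMaxCoroot b m) (hi : i ≠ m) :
    𝓡.toLinearMap (𝓡.root m) (𝓡.coroot i) ≤ 1 := by
  by_contra! hc
  obtain ⟨d, hd⟩ := exists_coroot_sub (𝓡 := 𝓡) (Ne.symm hi) (by omega)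
  have hneg : ∀ k, ¬ b.IsPos k → -𝓡.coroot k ∈ AddSubmonoid.closure (𝓡.coroot '' b.support) := by
    intro k hk
    rw [← coroot_negIdx]
    exact coroot_mem_closure b ((isPos_negIdx b k).2 hk)
  by_cases hdp : b.IsPos d
  · have h1 := hm (negIdx 𝓡 (RootPairing.weylGroup.ofIdx 𝓡 m • i)) (by
      rw [coroot_negIdx, coroot_refl]
      obtain ⟨n, hn⟩ := Int.eq_ofNat_of_zero_le (by omega :
        0 ≤ 𝓡.toLinearMap (𝓡.root m) (𝓡.coroot i) - 2)
      have h2 : -(𝓡.coroot i - 𝓡.toLinearMap (𝓡.root m) (𝓡.coroot i) • 𝓡.coroot m) - 𝓡.coroot m =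
          𝓡.coroot d + (𝓡.toLinearMap (𝓡.root m) (𝓡.coroot i) - 2) • 𝓡.coroot m := by
        rw [hd]; module
      rw [h2, hn, natCast_zsmul]
      exact add_mem (coroot_mem_closure b hdp) (nsmul_mem (coroot_mem_closure b hm.isPos) n))
    apply hi
    have h2 : RootPairing.weylGroup.ofIdx 𝓡 m • i = negIdx 𝓡 m := by
      rw [← negIdx_negIdx (𝓡 := 𝓡) (RootPairing.weylGroup.ofIdx 𝓡 m • i), h1]
    rw [negIdx] at h2
    exact MulAction.injective _ h2
  · have h1 := hneg d hdp
    rw [hd, neg_sub] at h1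
    exact hi (hm i h1)

end RootDatumLemmas

section AffineRoots

variable {ι X Y : Type*} [AddCommGroup X] [AddCommGroup Y] {𝓡 : RootDatum ι X Y}

/-! ### Affine roots -/

theorem toAdd_mul_left (g h : ExtWeyl 𝓡) : Multiplicative.toAdd (g * h).left =
    Multiplicative.toAdd g.left + g.right • Multiplicative.toAdd h.left := rfl

theorem extWeyl_ext {g h : ExtWeyl 𝓡}
    (h1 : Multiplicative.toAdd g.left = Multiplicative.toAdd h.left) (h2 : g.right = h.right) :
    g = h := SemidirectProduct.ext h1 h2

theorem affAct_one (a : ι × ℤ) : affAct (1 : ExtWeyl 𝓡) a = a := by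
  simp [affAct]

theorem affAct_mul (g h : ExtWeyl 𝓡) (a : ι × ℤ) :
    affAct (g * h) a = affAct g (affAct h a) := by
  refine Prod.ext ?_ ?_
  · exact mul_smul g.right h.right a.1
  · simp only [affAct, toAdd_mul_left, SemidirectProduct.mul_right, mul_smul, map_add,
      LinearMap.add_apply, pairing_smul_smul]
    ring

theorem affAct_inv_affAct (g : ExtWeyl 𝓡) (a : ι × ℤ) : affAct g⁻¹ (affAct g a) = a := by
  rw [← affAct_mul, inv_mul_cancel, affAct_one]

theorem affAct_affAct_inv (g : ExtWeyl 𝓡) (a : ι × ℤ) : affAct g (affAct g⁻¹ a) = a := by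
  rw [← affAct_mul, mul_inv_cancel, affAct_one]

theorem affAct_injective (g : ExtWeyl 𝓡) : Function.Injective (affAct g) :=
  Function.LeftInverse.injective (affAct_inv_affAct g)

/-- The opposite of an affine root. -/
def affNeg (𝓡 : RootDatum ι X Y) (a : ι × ℤ) : ι × ℤ := (negIdx 𝓡 a.1, -a.2)

theorem affNeg_affNeg (a : ι × ℤ) : affNeg 𝓡 (affNeg 𝓡 a) = a := by
  simp [affNeg, negIdx_negIdx]

theorem affAct_affNeg (g : ExtWeyl 𝓡) (a : ι × ℤ) :
    affAct g (affNeg 𝓡 a) = affNeg 𝓡 (affAct g a) := by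
  refine Prod.ext (smul_negIdx _ _) ?_
  simp only [affAct, affNeg, smul_negIdx, coroot_negIdx, map_neg]
  ring

/-- The reflection in the hyperplane where an affine root vanishes. -/
def affRefl (𝓡 : RootDatum ι X Y) (a : ι × ℤ) : ExtWeyl 𝓡 :=
  ⟨Multiplicative.ofAdd (-a.2 • 𝓡.root a.1), RootPairing.weylGroup.ofIdx 𝓡 a.1⟩

theorem affRefl_affAct (g : ExtWeyl 𝓡) (a : ι × ℤ) :
    affRefl 𝓡 (affAct g a) * g = g * affRefl 𝓡 a := by
  refine extWeyl_ext ?_ ?_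
  · simp only [toAdd_mul_left, affRefl, affAct, toAdd_ofAdd, ofIdx_smul_apply, smul_zsmul_weyl,
      ← root_smul]
    module
  · change RootPairing.weylGroup.ofIdx 𝓡 (g.right • a.1) * g.right =
      g.right * RootPairing.weylGroup.ofIdx 𝓡 a.1
    rw [ofIdx_smul, inv_mul_cancel_right]

theorem affRefl_affNeg (a : ι × ℤ) : affRefl 𝓡 (affNeg 𝓡 a) = affRefl 𝓡 a := by
  refine extWeyl_ext ?_ (ofIdx_negIdx _)
  simp [affRefl, affNeg, root_negIdx]

theorem affAct_affRefl_self (a : ι × ℤ) : affAct (affRefl 𝓡 a) a = affNeg 𝓡 a := by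
  refine Prod.ext rfl ?_
  simp only [affRefl, affAct, affNeg, toAdd_ofAdd]
  rw [← negIdx, coroot_negIdx]
  simp only [map_neg, map_zsmul, neg_smul, LinearMap.neg_apply, LinearMap.smul_apply,
    pairing_root_self, smul_eq_mul]
  ring

theorem affRefl_mul_self (a : ι × ℤ) : affRefl 𝓡 a * affRefl 𝓡 a = 1 := by
  refine extWeyl_ext ?_ (refl_refl _)
  simp only [toAdd_mul_left, affRefl, toAdd_ofAdd, smul_zsmul_weyl]
  rw [← root_smul, ← negIdx, root_negIdx]
  simp

variable (b : 𝓡.Base)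

theorem affPos_affNeg (a : ι × ℤ) : AffPos b (affNeg 𝓡 a) ↔ ¬ AffPos b a := by
  have := isPos_negIdx b a.1
  simp only [AffPos, affNeg, this]
  by_cases h : b.IsPos a.1 <;> simp only [h] <;> grind

/-- The simple affine roots. -/
def simpleAffRoot : SAff b → ι × ℤ
  | Sum.inl i => (i.1, 0)
  | Sum.inr i => (negIdx 𝓡 i.1, 1)

theorem affRefl_simpleAffRoot (j : SAff b) : affRefl 𝓡 (simpleAffRoot b j) = sAff b j := by
  rcases j with j | j
  · refine extWeyl_ext ?_ rfl
    simp [affRefl, simpleAffRoot, sAff]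
  · refine extWeyl_ext ?_ (ofIdx_negIdx _)
    simp [affRefl, simpleAffRoot, sAff, root_negIdx]

theorem sAff_right (j : SAff b) :
    (sAff b j).right = RootPairing.weylGroup.ofIdx 𝓡 (simpleAffRoot b j).1 := by
  rw [← affRefl_simpleAffRoot]; rfl

theorem affPos_simpleAffRoot (j : SAff b) : AffPos b (simpleAffRoot b j) := by
  rcases j with j | j
  · exact Or.inr ⟨rfl, RootPairing.Base.isPos_of_mem_support j.2⟩
  · exact Or.inl one_pos

theorem affAct_sAff_simpleAffRoot (j : SAff b) :
    affAct (sAff b j) (simpleAffRoot b j) = affNeg 𝓡 (simpleAffRoot b j) := by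
  rw [← affRefl_simpleAffRoot, affAct_affRefl_self]

theorem sAff_mul_self (j : SAff b) : sAff b j * sAff b j = 1 := by
  rw [← affRefl_simpleAffRoot, affRefl_mul_self]

variable [Finite ι]

/-- A simple affine reflection permutes the positive affine roots other than its own. -/
theorem affPos_sAff (j : SAff b) {a : ι × ℤ} (ha : AffPos b a) (haj : a ≠ simpleAffRoot b j) :
    AffPos b (affAct (sAff b j) a) := by
  obtain ⟨i, k⟩ := a
  rcases j with j | ⟨m, hm⟩
  · simp only [AffPos, affAct, sAff, SemidirectProduct.right_inr, SemidirectProduct.left_inr,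
      toAdd_one, map_zero, LinearMap.zero_apply, sub_zero] at ha ⊢
    rcases ha with ha | ⟨h1, h2⟩
    · exact Or.inl ha
    · exact Or.inr ⟨h1, isPos_refl b h2 j.2 fun h => haj (Prod.ext h h1)⟩
  · have hdom := hm.dominant
    have h0 : 𝓡.toLinearMap (𝓡.root m) (𝓡.coroot (RootPairing.weylGroup.ofIdx 𝓡 m • i)) =
        -𝓡.toLinearMap (𝓡.root m) (𝓡.coroot i) := by
      rw [pairing_smul_right, ofIdx_inv, ofIdx_smul_apply, pairing_root_self]
      simp only [map_sub, map_zsmul, LinearMap.sub_apply, LinearMap.smul_apply, smul_eq_mul]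
      ring
    have h1 : affAct (sAff b (Sum.inr ⟨m, hm⟩)) (i, k) =
        (RootPairing.weylGroup.ofIdx 𝓡 m • i, k + 𝓡.toLinearMap (𝓡.root m) (𝓡.coroot i)) := by
      refine Prod.ext rfl ?_
      change k - 𝓡.toLinearMap (𝓡.root m) (𝓡.coroot (RootPairing.weylGroup.ofIdx 𝓡 m • i)) = _
      rw [h0, sub_neg_eq_add]
    rw [h1]
    -- For positive `α_i` the constant term does not decrease, because `α_m` is dominant. If it ends
    -- at 0, then `α_i` is orthogonal to `α_m` and is fixed by `s_m`.
    by_cases hi : b.IsPos i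
    · have h2 := pairing_nonneg_of_dominant b hdom hi
      have hk : 0 ≤ k := by rcases ha with h | h; exacts [h.le, h.1.ge]
      rcases lt_or_eq_of_le (add_nonneg hk h2) with h3 | h3
      · exact Or.inl h3
      · refine Or.inr ⟨h3.symm, ?_⟩
        have h4 : 𝓡.toLinearMap (𝓡.root m) (𝓡.coroot i) = 0 := by omega
        have h5 : RootPairing.weylGroup.ofIdx 𝓡 m • i = i := 𝓡.root.injective (by
          rw [root_smul, ofIdx_smul_apply, pairing_zero_comm.1 h4, zero_smul, sub_zero])
        change b.IsPos (RootPairing.weylGroup.ofIdx 𝓡 m • i)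
        rwa [h5]
    · have hk : 1 ≤ k := by
        rcases ha with h | h
        · exact h
        · exact absurd h.2 hi
      by_cases hm' : i = negIdx 𝓡 m
      · have h2 : 𝓡.toLinearMap (𝓡.root m) (𝓡.coroot i) = -2 := by
          rw [hm', coroot_negIdx, map_neg, pairing_root_self]
        have h3 : RootPairing.weylGroup.ofIdx 𝓡 m • i = m := by
          rw [hm', negIdx, ofIdx_smul_smul]
        -- The value `k = 1` would be the excluded simple affine root `(-α_m, 1)`; from `k = 2` on
        -- the image stays positive.
        have hk1 : k ≠ 1 := fun h => haj (Prod.ext hm' h)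
        rw [h2, h3]
        by_cases hk2 : k = 2
        · exact Or.inr ⟨by simp [hk2], hm.isPos⟩
        · exact Or.inl (by simp only; omega)
      -- Here `k ≥ 1` and the pairing is at least -1. If the sum vanishes, the pairing is -1, so
      -- `s_m α_i` has positive pairing with the dominant `α_m` and is a positive root.
      · have h2 := hm.pairing_le_one (i := negIdx 𝓡 i)
          (fun h => hm' (by rw [← h, negIdx_negIdx]))
        rw [coroot_negIdx, map_neg] at h2
        rcases lt_or_eq_of_le (by omega : 0 ≤ k + 𝓡.toLinearMap (𝓡.root m) (𝓡.coroot i)) with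
          h3 | h3
        · exact Or.inl h3
        · refine Or.inr ⟨h3.symm, ?_⟩
          by_contra h4
          have := pairing_nonpos_of_dominant b hdom h4
          simp only [h0] at this
          omega

theorem affPos_sAff_iff (j : SAff b) {a : ι × ℤ} (h1 : a ≠ simpleAffRoot b j)
    (h2 : a ≠ affNeg 𝓡 (simpleAffRoot b j)) :
    AffPos b (affAct (sAff b j) a) ↔ AffPos b a := by
  refine ⟨fun h => ?_, fun h => affPos_sAff b j h h1⟩
  by_contra hc
  rw [← affPos_affNeg] at hc
  have := affPos_sAff b j hc (fun h => h2 (by rw [← h, affNeg_affNeg]))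
  rw [affAct_affNeg, affPos_affNeg] at this
  exact this h

/-- The positive affine roots made negative by `g`. -/
def inversions (g : ExtWeyl 𝓡) : Set (ι × ℤ) := {a | AffPos b a ∧ ¬ AffPos b (affAct g a)}

omit [Finite ι] in
theorem len_eq (g : ExtWeyl 𝓡) : len b g = (inversions b g).ncard := rfl

theorem finite_inversions (g : ExtWeyl 𝓡) : (inversions b g).Finite := by
  obtain ⟨B, hB⟩ : ∃ B : ℤ, ∀ i, 𝓡.toLinearMap (Multiplicative.toAdd g.left) (𝓡.coroot i) ≤ B := by
    obtain ⟨B, hB⟩ := (Set.finite_range fun i =>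
      𝓡.toLinearMap (Multiplicative.toAdd g.left) (𝓡.coroot i)).bddAbove
    exact ⟨B, fun i => hB ⟨i, rfl⟩⟩
  refine (Set.finite_univ.prod (Set.finite_Icc 0 B)).subset ?_
  rintro ⟨i, k⟩ ⟨h1, h2⟩
  refine ⟨trivial, ?_, ?_⟩
  · rcases h1 with h | h
    exacts [h.le, h.1.ge]
  · by_contra! hc
    refine h2 (Or.inl ?_)
    have := hB (g.right • i)
    simp only [affAct] at hc ⊢
    omega

/-- The reflection `s_j` permutes the positive affine roots other than its own root `a_j`. So the
inversions of `g s_j` are the `s_j`-images of those of `g`, together with `a_j`. -/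
theorem inversions_mul_sAff (g : ExtWeyl 𝓡) (j : SAff b)
    (h : AffPos b (affAct g (simpleAffRoot b j))) :
    len b (g * sAff b j) = len b g + 1 := by
  have hss : ∀ a, affAct (sAff b j) (affAct (sAff b j) a) = a := fun a => by
    rw [← affAct_mul, sAff_mul_self, affAct_one]
  have h1 : inversions b (g * sAff b j) =
      insert (simpleAffRoot b j) (affAct (sAff b j) '' inversions b g) := by
    ext a
    simp only [inversions, Set.mem_ofPred_eq, Set.mem_insert_iff, Set.mem_image, affAct_mul]
    constructor
    · rintro ⟨h1, h2⟩
      by_cases ha : a = simpleAffRoot b j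
      · exact Or.inl ha
      · exact Or.inr ⟨_, ⟨affPos_sAff b j h1 ha, h2⟩, hss a⟩
    · rintro (rfl | ⟨c, ⟨h1, h2⟩, rfl⟩)
      · refine ⟨affPos_simpleAffRoot b j, ?_⟩
        rw [affAct_sAff_simpleAffRoot, affAct_affNeg, affPos_affNeg]
        exact not_not.2 h
      · rw [hss]
        exact ⟨affPos_sAff b j h1 (fun h3 => h2 (h3 ▸ h)), h2⟩
  have h2 : simpleAffRoot b j ∉ affAct (sAff b j) '' inversions b g := by
    rintro ⟨c, ⟨h1, h2⟩, h3⟩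
    have : c = affNeg 𝓡 (simpleAffRoot b j) := by
      rw [← affAct_sAff_simpleAffRoot, ← h3, hss]
    rw [this, affPos_affNeg] at h1
    exact h1 (affPos_simpleAffRoot b j)
  rw [len_eq, h1, Set.ncard_insert_of_notMem h2 ((finite_inversions b g).image _),
    Set.ncard_image_of_injective _ (affAct_injective _), len_eq]

theorem len_mul_sAff_of_neg (g : ExtWeyl 𝓡) (j : SAff b)
    (h : ¬ AffPos b (affAct g (simpleAffRoot b j))) :
    len b (g * sAff b j) + 1 = len b g := by
  have := inversions_mul_sAff b (g * sAff b j) j (by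
    rwa [affAct_mul, affAct_sAff_simpleAffRoot, affAct_affNeg, affPos_affNeg])
  rw [mul_assoc, sAff_mul_self, mul_one] at this
  exact this.symm

-- The map `a ↦ -g a` carries the inversions of `g` bijectively onto those of `g⁻¹`.
omit [Finite ι] in
theorem len_inv (g : ExtWeyl 𝓡) : len b g⁻¹ = len b g := by
  have : inversions b g⁻¹ = (fun a => affNeg 𝓡 (affAct g a)) '' inversions b g := by
    ext a
    constructor
    · rintro ⟨h1, h2⟩
      refine ⟨affNeg 𝓡 (affAct g⁻¹ a), ⟨(affPos_affNeg b _).2 h2, ?_⟩, ?_⟩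
      · rw [affAct_affNeg, affAct_affAct_inv, affPos_affNeg]
        exact not_not.2 h1
      · simp only [affAct_affNeg, affAct_affAct_inv, affNeg_affNeg]
    · rintro ⟨c, ⟨h1, h2⟩, rfl⟩
      refine ⟨(affPos_affNeg b _).2 h2, ?_⟩
      rw [affAct_affNeg, affAct_inv_affAct, affPos_affNeg]
      exact not_not.2 h1
  rw [len_eq, this, Set.ncard_image_of_injective, len_eq]
  intro a c h
  have := congrArg (affNeg 𝓡) h
  simp only [affNeg_affNeg] at this
  exact affAct_injective g this

theorem affPos_iff_of_len_eq_zero {u : ExtWeyl 𝓡} (hu : len b u = 0) (a : ι × ℤ) :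
    AffPos b (affAct u a) ↔ AffPos b a := by
  rw [len_eq, Set.ncard_eq_zero (finite_inversions b u)] at hu
  have key : ∀ a, AffPos b a → AffPos b (affAct u a) := by
    intro a ha
    by_contra hc
    exact Set.notMem_empty a (hu ▸ ⟨ha, hc⟩)
  refine ⟨fun h => ?_, key a⟩
  by_contra hc
  have := key _ ((affPos_affNeg b a).2 hc)
  rw [affAct_affNeg, affPos_affNeg] at this
  exact this h

/-- If all positive affine roots made negative by `h` remain negative under `g h`, then lengths
add. -/
theorem len_mul_of_forall {g h : ExtWeyl 𝓡}
    (H : ∀ a, AffPos b a → ¬ AffPos b (affAct h a) → ¬ AffPos b (affAct g (affAct h a))) :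
    len b (g * h) = len b g + len b h := by
  have h1 : inversions b (g * h) = inversions b h ∪ affAct h⁻¹ '' inversions b g := by
    ext a
    constructor
    · rintro ⟨h1, h2⟩
      by_cases h3 : AffPos b (affAct h a)
      · exact Or.inr ⟨_, ⟨h3, by rwa [affAct_mul] at h2⟩, affAct_inv_affAct h a⟩
      · exact Or.inl ⟨h1, h3⟩
    · rintro (⟨h1, h2⟩ | ⟨c, ⟨h1, h2⟩, rfl⟩)
      · exact ⟨h1, by rw [affAct_mul]; exact H a h1 h2⟩
      · refine ⟨?_, by rwa [affAct_mul, affAct_affAct_inv]⟩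
        by_contra hc
        have := H (affNeg 𝓡 (affAct h⁻¹ c)) ((affPos_affNeg b _).2 hc) (by
          rw [affAct_affNeg, affAct_affAct_inv, affPos_affNeg]
          exact not_not.2 h1)
        rw [affAct_affNeg, affAct_affAct_inv, affAct_affNeg, affPos_affNeg] at this
        exact this h2
  have h2 : Disjoint (inversions b h) (affAct h⁻¹ '' inversions b g) := by
    rw [Set.disjoint_left]
    rintro _ ⟨h1, h2⟩ ⟨c, ⟨h3, h4⟩, rfl⟩
    rw [affAct_affAct_inv] at h2
    exact h2 h3
  rw [len_eq, h1, Set.ncard_union_eq h2 (finite_inversions b h) ((finite_inversions b g).image _),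
    Set.ncard_image_of_injective _ (affAct_injective _), len_eq, len_eq, add_comm]

omit [Finite ι] in
theorem mul_sAff_of_affAct_eq {g : ExtWeyl 𝓡} {i j : SAff b}
    (h : affAct g (simpleAffRoot b j) = simpleAffRoot b i ∨
      affAct g (simpleAffRoot b j) = affNeg 𝓡 (simpleAffRoot b i)) :
    sAff b i * g = g * sAff b j := by
  rw [← affRefl_simpleAffRoot, ← affRefl_simpleAffRoot, ← affRefl_affAct]
  rcases h with h | h <;> rw [h]
  rw [affRefl_affNeg]

theorem affPos_iff_len (g : ExtWeyl 𝓡) (j : SAff b) :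
    AffPos b (affAct g (simpleAffRoot b j)) ↔ len b (g * sAff b j) = len b g + 1 := by
  constructor
  · exact inversions_mul_sAff b g j
  · intro h
    by_contra hc
    have := len_mul_sAff_of_neg b g j hc
    omega

/-- If `g a_j` is not `±a_i`, then `s_i` preserves its sign. Right multiplication by `s_j` would
then change the lengths of `g` and `s_i g` in the same direction, which is incompatible with the two
length equalities. -/
theorem exchange_sAff (g : ExtWeyl 𝓡) (i j : SAff b)
    (h1 : len b (sAff b i * g) = len b (g * sAff b j))
    (h2 : len b (sAff b i * g * sAff b j) = len b g) : sAff b i * g = g * sAff b j := by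
  apply mul_sAff_of_affAct_eq
  by_contra! hc
  have h3 := affPos_sAff_iff b i hc.1 hc.2
  rw [← affAct_mul, affPos_iff_len, affPos_iff_len] at h3
  by_cases h4 : AffPos b (affAct g (simpleAffRoot b j))
  · have := inversions_mul_sAff b g j h4
    omega
  · have := len_mul_sAff_of_neg b g j h4
    omega

/-- The affine function of an affine root, as an element of `Y × ℤ`. -/
def affVec (𝓡 : RootDatum ι X Y) (a : ι × ℤ) : Y × ℤ := (𝓡.coroot a.1, a.2)

omit [Finite ι] in
theorem affVec_ne_zero (a : ι × ℤ) : affVec 𝓡 a ≠ 0 := fun h =>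
  𝓡.ne_zero' a.1 (congrArg Prod.fst h)

/-- With `m` maximal above `i`, the vector `(-α_i^∨, 1)` is `(α_m^∨ - α_i^∨, 0) + (-α_m^∨, 1)`.
Adding `(α_i^∨, 0)` for a positive root gives `(0, 1)`, and these vectors yield all positive affine
roots. -/
theorem affVec_mem_closure {a : ι × ℤ} (ha : AffPos b a) :
    affVec 𝓡 a ∈ AddSubmonoid.closure (Set.range fun j => affVec 𝓡 (simpleAffRoot b j)) := by
  set S := AddSubmonoid.closure (Set.range fun j => affVec 𝓡 (simpleAffRoot b j)) with hS
  have h1 : ∀ y ∈ AddSubmonoid.closure (𝓡.coroot '' b.support), ((y, 0) : Y × ℤ) ∈ S := by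
    intro y hy
    induction hy using AddSubmonoid.closure_induction with
    | mem y hy =>
      obtain ⟨j, hj, rfl⟩ := hy
      exact AddSubmonoid.subset_closure ⟨Sum.inl ⟨j, hj⟩, rfl⟩
    | zero => exact zero_mem S
    | add y z _ _ hy hz => simpa using add_mem hy hz
  have h2 : ∀ i, ((-𝓡.coroot i, 1) : Y × ℤ) ∈ S := by
    intro i
    obtain ⟨m, hm, hmi⟩ := exists_isMaxCoroot b i
    have h3 : ((-𝓡.coroot m, 1) : Y × ℤ) ∈ S :=
      AddSubmonoid.subset_closure ⟨Sum.inr ⟨m, hm⟩, by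
        simp [affVec, simpleAffRoot, coroot_negIdx]⟩
    have h4 := add_mem (h1 _ hmi) h3
    have h5 : 𝓡.coroot m - 𝓡.coroot i + -𝓡.coroot m = -𝓡.coroot i := by abel
    rwa [Prod.mk_add_mk, zero_add, h5] at h4
  have h3 : ∀ _ : ι, ((0, 1) : Y × ℤ) ∈ S := by
    intro i
    by_cases hi : b.IsPos i
    · simpa using add_mem (h1 _ (coroot_mem_closure b hi)) (h2 i)
    · have := add_mem (h1 _ (coroot_mem_closure b ((isPos_negIdx b i).2 hi))) (h2 (negIdx 𝓡 i))
      simpa using this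
  obtain ⟨i, k⟩ := a
  rcases ha with ha | ⟨ha, hi⟩
  · obtain ⟨n, hn⟩ := Int.eq_ofNat_of_zero_le (by simp only at ha; omega : 0 ≤ k - 1)
    have h4 := h2 (negIdx 𝓡 i)
    rw [coroot_negIdx, neg_neg] at h4
    have h5 := add_mem h4 (nsmul_mem (h3 i) n)
    have h6 : affVec 𝓡 (i, k) = (𝓡.coroot i, 1) + n • (0, 1) := by
      refine Prod.ext ?_ ?_
      · simp [affVec]
      · simp only [affVec, Prod.snd_add, Prod.smul_snd, nsmul_eq_mul, mul_one]
        omega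
    rwa [h6]
  · simp only at ha hi
    rw [ha]
    exact h1 _ (coroot_mem_closure b hi)

/-- Positivity is the sign of the value at one interior point of the fundamental alcove. That value,
taken after applying `g`, is additive in the affine function, so positivity passes from simple
affine roots to their nonnegative combinations. -/
theorem affPos_of_forall_simple (g : ExtWeyl 𝓡)
    (h : ∀ j, AffPos b (affAct g (simpleAffRoot b j))) {a : ι × ℤ} (ha : AffPos b a) :
    AffPos b (affAct g a) := by
  -- The bound on `n` puts the point `2ρ/n` inside the fundamental alcove. Values are multiplied by
  -- `n` to stay integral.
  obtain ⟨n, hn0, hn⟩ : ∃ n : ℤ, 0 < n ∧ ∀ i, |𝓡.toLinearMap (twoRho b) (𝓡.coroot i)| < n := by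
    obtain ⟨B, hB⟩ := (Set.finite_range fun i =>
      |𝓡.toLinearMap (twoRho b) (𝓡.coroot i)|).bddAbove
    have hB' : ∀ i, |𝓡.toLinearMap (twoRho b) (𝓡.coroot i)| ≤ B := fun i => hB ⟨i, rfl⟩
    exact ⟨|B| + 1, by positivity, fun i => by have := hB' i; have := le_abs_self B; omega⟩
  have hval : ∀ a : ι × ℤ, AffPos b a ↔ 0 < n * a.2 + 𝓡.toLinearMap (twoRho b) (𝓡.coroot a.1) := by
    rintro ⟨i, k⟩
    have h1 := abs_lt.1 (hn i)
    rcases lt_trichotomy k 0 with hk | rfl | hk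
    · refine iff_of_false (by rintro (h | h) <;> simp only at h <;> omega) ?_
      simp only
      nlinarith
    · by_cases hi : b.IsPos i
      · have := pairing_twoRho_pos b hi
        exact iff_of_true (Or.inr ⟨rfl, hi⟩) (by simpa using this)
      · have := pairing_twoRho_neg b hi
        refine iff_of_false (by rintro (h | h); exacts [absurd h (lt_irrefl _), hi h.2]) ?_
        simp only
        omega
    · refine iff_of_true (Or.inl hk) ?_
      simp only
      nlinarith
  -- This is `n` times the point `g⁻¹(2ρ/n)`.
  set x := g.right⁻¹ • (twoRho b - n • Multiplicative.toAdd g.left) with hx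
  have hg : ∀ a : ι × ℤ, AffPos b (affAct g a) ↔
      0 < n * (affVec 𝓡 a).2 + 𝓡.toLinearMap x (affVec 𝓡 a).1 := by
    intro a
    rw [hval, affVec, hx, pairing_smul_left, inv_inv]
    simp only [affAct, map_sub, map_zsmul, LinearMap.sub_apply, LinearMap.smul_apply, smul_eq_mul]
    ring_nf
  rw [hg]
  refine Or.resolve_left ?_ (affVec_ne_zero (𝓡 := 𝓡) a)
  have := affVec_mem_closure b ha
  generalize affVec 𝓡 a = v at this
  induction this using AddSubmonoid.closure_induction with
  | mem y hy =>
    obtain ⟨j, rfl⟩ := hy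
    exact Or.inr ((hg _).1 (h j))
  | zero => exact Or.inl rfl
  | add y z _ _ hy hz =>
    rcases hy with rfl | hy
    · simpa using hz
    · rcases hz with rfl | hz
      · right; simpa using hy
      · right
        simp only [Prod.snd_add, Prod.fst_add, map_add]
        linarith

theorem exists_descent (g : ExtWeyl 𝓡) (hg : len b g ≠ 0) :
    ∃ j, len b (g * sAff b j) + 1 = len b g := by
  by_contra! hc
  apply hg
  rw [len_eq, Set.ncard_eq_zero (finite_inversions b g), Set.eq_empty_iff_forall_notMem]
  rintro a ⟨h1, h2⟩
  refine h2 (affPos_of_forall_simple b g (fun j => ?_) h1)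
  by_contra h3
  exact hc j (len_mul_sAff_of_neg b g j h3)

/-! ### Parameters of affine roots -/

variable (p : Params 𝓡)

omit [Finite ι] in
theorem qAff_eq (j : SAff b) : qAff b p j =
    p.q ^ (if Even (simpleAffRoot b j).2 then p.lam (simpleAffRoot b j).1
      else p.lamStar (simpleAffRoot b j).1) := by
  rcases j with j | j
  · simp [qAff, simpleAffRoot]
  · simp [qAff, simpleAffRoot, negIdx, p.lamStar_smul]

-- The affine root `(α, k)` carries `λ(α)` for even `k` and `λ*(α)` for odd `k`. A translation can
-- change the parity of `k` only if `α^∨ ∉ 2Y`, and then the two parameters agree.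
omit [Finite ι] in
theorem param_affAct (g : ExtWeyl 𝓡) (a : ι × ℤ) :
    (if Even (affAct g a).2 then p.lam (affAct g a).1 else p.lamStar (affAct g a).1) =
    if Even a.2 then p.lam a.1 else p.lamStar a.1 := by
  simp only [affAct, p.lam_smul, p.lamStar_smul]
  by_cases h : ∃ y : Y, 𝓡.coroot (g.right • a.1) = 2 • y
  · obtain ⟨y, hy⟩ := h
    have : Even (a.2 - 𝓡.toLinearMap (Multiplicative.toAdd g.left) (𝓡.coroot (g.right • a.1))) ↔
        Even a.2 := by
      rw [hy, map_nsmul, Int.even_sub]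
      simp
    simp only [this]
  · have := p.lamStar_eq _ h
    rw [p.lamStar_smul, p.lam_smul] at this
    simp [this]

omit [Finite ι] in
theorem param_affNeg (a : ι × ℤ) :
    (if Even (affNeg 𝓡 a).2 then p.lam (affNeg 𝓡 a).1 else p.lamStar (affNeg 𝓡 a).1) =
    if Even a.2 then p.lam a.1 else p.lamStar a.1 := by
  simp [affNeg, negIdx, p.lam_smul, p.lamStar_smul]

/-- The hypothesis gives `s_i (g a_j) = -g a_j`, whereas `s_i` changes the sign of no affine root
other than `±a_i`. -/
theorem affAct_eq_of_mul_sAff {g : ExtWeyl 𝓡} {i j : SAff b} (h : sAff b i * g = g * sAff b j) :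
    affAct g (simpleAffRoot b j) = simpleAffRoot b i ∨
      affAct g (simpleAffRoot b j) = affNeg 𝓡 (simpleAffRoot b i) := by
  by_contra! hc
  have h1 := affPos_sAff_iff b i hc.1 hc.2
  rw [← affAct_mul, h, affAct_mul, affAct_sAff_simpleAffRoot, affAct_affNeg, affPos_affNeg] at h1
  tauto

theorem lengthSystem : LengthSystem (len b) (sAff b) (qAff b p) where
  mul_self := sAff_mul_self b
  step g j := by
    by_cases h : AffPos b (affAct g (simpleAffRoot b j))
    · exact Or.inl (inversions_mul_sAff b g j h)
    · exact Or.inr (len_mul_sAff_of_neg b g j h)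
  descent := exists_descent b
  inv := len_inv b
  mul_of_zero g u hu := by
    rw [len_mul_of_forall b, hu, add_zero]
    intro a h1 h2
    exact absurd ((affPos_iff_of_len_eq_zero b hu a).2 h1) h2
  exchange := exchange_sAff b
  q_conj g i j h := by
    rw [qAff_eq, qAff_eq]
    congr 1
    rw [← param_affAct p g (simpleAffRoot b j)]
    rcases affAct_eq_of_mul_sAff b h with h | h <;> rw [h]
    rw [param_affNeg]

/-- The elements `N_w` form a basis of the affine Hecke algebra. -/
theorem heckeBasis : HeckeBasis (len b) (sAff b) (qAff b p) (heckeN b p) :=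
  (lengthSystem b p).heckeBasis

end AffineRoots

section FiniteWeylGroup

variable {ι X Y : Type*} [AddCommGroup X] [AddCommGroup Y] {𝓡 : RootDatum ι X Y}
variable (b : 𝓡.Base)

/-! ### Reduced words in parabolic subgroups -/

theorem sAff_inl (i : {i : ι // i ∈ b.support}) :
    sAff b (Sum.inl i) = SemidirectProduct.inr (RootPairing.weylGroup.ofIdx 𝓡 i.1) := rfl

variable {b} in
/-- The product of a word in simple reflections. -/
def wordProd {Q : Set b.support} (l : List Q) : 𝓡.weylGroup :=
  (l.map fun i => RootPairing.weylGroup.ofIdx 𝓡 i.1.1).prod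

variable {Q : Set b.support}

theorem wordProd_cons (i : Q) (l : List Q) :
    wordProd (i :: l) = RootPairing.weylGroup.ofIdx 𝓡 i.1.1 * wordProd l := by
  simp [wordProd]

theorem wordProd_concat (l : List Q) (i : Q) :
    wordProd (l ++ [i]) = wordProd l * RootPairing.weylGroup.ofIdx 𝓡 i.1.1 := by
  simp [wordProd]

theorem affPos_inr (w : 𝓡.weylGroup) (i : {i : ι // i ∈ b.support}) :
    AffPos b (affAct (SemidirectProduct.inr w : ExtWeyl 𝓡) (simpleAffRoot b (Sum.inl i))) ↔
      b.IsPos (w • i.1) := by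
  simp [AffPos, affAct, simpleAffRoot]

variable [Finite ι]

theorem len_mul_refl_of_pos (w : 𝓡.weylGroup) (i : {i : ι // i ∈ b.support})
    (h : b.IsPos (w • i.1)) :
    len b (SemidirectProduct.inr (w * RootPairing.weylGroup.ofIdx 𝓡 i.1) : ExtWeyl 𝓡) =
      len b (SemidirectProduct.inr w : ExtWeyl 𝓡) + 1 := by
  rw [map_mul, ← sAff_inl]
  exact inversions_mul_sAff b _ _ ((affPos_inr b w i).2 h)

theorem len_mul_refl_of_neg (w : 𝓡.weylGroup) (i : {i : ι // i ∈ b.support})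
    (h : ¬ b.IsPos (w • i.1)) :
    len b (SemidirectProduct.inr (w * RootPairing.weylGroup.ofIdx 𝓡 i.1) : ExtWeyl 𝓡) + 1 =
      len b (SemidirectProduct.inr w : ExtWeyl 𝓡) := by
  rw [map_mul, ← sAff_inl]
  exact len_mul_sAff_of_neg b _ _ (fun hc => h ((affPos_inr b w i).1 hc))

/-- The exchange condition. Reading the word from the right, some letter `i` turns the image of
`α_j` negative. Just before that letter the image is `α_i`, so deleting the letter amounts to
multiplying by `s_j` on the right. -/
theorem exists_word_mul_refl (l : List Q) (j : Q) (h : ¬ b.IsPos (wordProd l • j.1.1)) :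
    ∃ l' : List Q, wordProd l' = wordProd l * RootPairing.weylGroup.ofIdx 𝓡 j.1.1 ∧
      l'.length + 1 = l.length := by
  induction l with
  | nil =>
    exact absurd (by simpa [wordProd] using RootPairing.Base.isPos_of_mem_support j.1.2) h
  | cons i l ih =>
    by_cases h1 : b.IsPos (wordProd l • j.1.1)
    · refine ⟨l, ?_, rfl⟩
      rw [wordProd_cons, mul_smul] at h
      have h2 : wordProd l • j.1.1 = i.1.1 := by
        by_contra hne
        exact h (isPos_refl b h1 i.1.2 hne)
      rw [wordProd_cons, ← h2, ofIdx_smul, inv_mul_cancel_right, mul_assoc, refl_refl, mul_one]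
    · obtain ⟨l', h2, h3⟩ := ih h1
      exact ⟨i :: l', by rw [wordProd_cons, wordProd_cons, h2, mul_assoc], by simp [h3]⟩

/-- Every element of a parabolic subgroup has a reduced word in the parabolic subgroup. -/
theorem exists_reduced_word {w : 𝓡.weylGroup} (hw : w ∈ WPar b Q) :
    ∃ l : List Q, wordProd l = w ∧
      l.length = len b (SemidirectProduct.inr w : ExtWeyl 𝓡) := by
  have key : ∀ (u : 𝓡.weylGroup) (j : Q), (∃ l : List Q, wordProd l = u ∧
      l.length = len b (SemidirectProduct.inr u : ExtWeyl 𝓡)) →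
      ∃ l : List Q, wordProd l = u * RootPairing.weylGroup.ofIdx 𝓡 j.1.1 ∧
        l.length = len b (SemidirectProduct.inr (u * RootPairing.weylGroup.ofIdx 𝓡 j.1.1) :
          ExtWeyl 𝓡) := by
    rintro u j ⟨l, rfl, h2⟩
    by_cases h : b.IsPos (wordProd l • j.1.1)
    · refine ⟨l ++ [j], wordProd_concat b l j, ?_⟩
      rw [len_mul_refl_of_pos b _ j.1 h, ← h2]
      simp
    · obtain ⟨l', h3, h4⟩ := exists_word_mul_refl b l j h
      have := len_mul_refl_of_neg b _ j.1 h
      exact ⟨l', h3, by omega⟩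
  induction hw using Subgroup.closure_induction_right with
  | one => exact ⟨[], rfl, by rw [len_inr, posNeg_one, Set.ncard_empty]; rfl⟩
  | mul_right u _ y hy ih =>
    obtain ⟨j, hj, rfl⟩ := hy
    exact key u ⟨j, hj⟩ ih
  | mul_inv_cancel u _ y hy ih =>
    obtain ⟨j, hj, rfl⟩ := hy
    simp only [ofIdx_inv]
    exact key u ⟨j, hj⟩ ih

theorem len_wordProd_le (l : List Q) :
    len b (SemidirectProduct.inr (wordProd l) : ExtWeyl 𝓡) ≤ l.length := by
  induction l using List.reverseRecOn with
  | nil => simp [wordProd, len_inr, posNeg_one, -map_one]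
  | append_singleton l i ih =>
    rw [wordProd_concat, List.length_append, List.length_singleton]
    by_cases h : b.IsPos (wordProd l • i.1.1)
    · have := len_mul_refl_of_pos b _ i.1 h
      omega
    · have := len_mul_refl_of_neg b _ i.1 h
      omega

theorem WPar_univ : WPar b Set.univ = ⊤ := by
  have h1 : ∀ i, RootPairing.weylGroup.ofIdx 𝓡 i ∈ WPar b Set.univ := by
    intro i
    induction i using root_induction b with
    | h0 i hi => rwa [ofIdx_negIdx]
    | h1 i hi => exact Subgroup.subset_closure ⟨⟨i, hi⟩, trivial, rfl⟩
    | h2 i j hj hi =>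
      rw [ofIdx_smul]
      have h3 : RootPairing.weylGroup.ofIdx 𝓡 j ∈ WPar b Set.univ :=
        Subgroup.subset_closure ⟨⟨j, hj⟩, trivial, rfl⟩
      exact mul_mem (mul_mem h3 hi) (inv_mem h3)
  rw [Subgroup.eq_top_iff']
  rintro ⟨w, hw⟩
  induction hw using RootPairing.weylGroup.induction with
  | mem i => exact h1 i
  | one => exact one_mem _
  | mul x y hx hy h1 h2 => exact mul_mem h1 h2

theorem eq_one_of_len_inr_eq_zero {w : 𝓡.weylGroup}
    (h : len b (SemidirectProduct.inr w : ExtWeyl 𝓡) = 0) : w = 1 := by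
  obtain ⟨l, hl, h1⟩ := exists_reduced_word b (Q := Set.univ) (w := w)
    (by rw [WPar_univ]; trivial)
  rw [h, List.length_eq_zero_iff] at h1
  rw [← hl, h1]
  rfl

-- The action on roots is faithful: an element fixing every root has no inversions, hence length
-- zero.
include b in
theorem finite_weylGroup : Finite 𝓡.weylGroup := by
  refine Finite.of_injective (fun (w : 𝓡.weylGroup) (i : ι) => w • i) fun w u h => ?_
  have h1 : ∀ i : ι, (u⁻¹ * w) • i = i := fun i => by
    rw [mul_smul, show w • i = u • i from congrFun h i, inv_smul_smul]
  have h2 : u⁻¹ * w = 1 := by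
    apply eq_one_of_len_inr_eq_zero b
    rw [len_inr, Set.ncard_eq_zero (Set.toFinite _)]
    ext i
    simp [posNeg, h1]
  rw [← mul_one u, ← h2, mul_inv_cancel_left]

variable (p : Params 𝓡)

theorem finLengthSystem (Q : Set b.support) :
    LengthSystem (finLen b Q) (finS b Q) (finQ b p Q) := by
  have hcoe : ∀ j : Q, (SemidirectProduct.inr ((finS b Q j : WPar b Q) : 𝓡.weylGroup) :
      ExtWeyl 𝓡) = sAff b (Sum.inl j.1) := fun j => rfl
  have hinj : ∀ w u : WPar b Q, (SemidirectProduct.inr (w : 𝓡.weylGroup) : ExtWeyl 𝓡) =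
      SemidirectProduct.inr (u : 𝓡.weylGroup) → w = u := fun w u h =>
    Subtype.ext (SemidirectProduct.inr_injective h)
  have L := lengthSystem b p
  refine ⟨?_, ?_, ?_, ?_, ?_, ?_, ?_⟩
  · intro j
    exact Subtype.ext (refl_refl _)
  · intro g j
    simp only [finLen, Subgroup.coe_mul, map_mul, hcoe]
    exact L.step _ _
  · intro w hw
    obtain ⟨l, h1, h2⟩ := exists_reduced_word b w.2
    -- Descent is the one axiom not inherited from `W ⋉ X`, since the reflection must lie in `W_Q`.
    -- The last letter of a reduced word over `Q` serves.
    rcases List.eq_nil_or_concat l with rfl | ⟨l', j, rfl⟩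
    · exact absurd h2.symm hw
    · refine ⟨j, ?_⟩
      rw [List.concat_eq_append, wordProd_concat] at h1
      refine len_mul_refl_of_neg b _ j.1 fun h => ?_
      have h3 := len_mul_refl_of_pos b _ j.1 h
      have h4 := len_wordProd_le b l'
      rw [← h1, mul_assoc, refl_refl, mul_one, h1] at h3
      simp at h2
      omega
  · intro g
    simp only [finLen, Subgroup.coe_inv, map_inv]
    exact L.inv _
  · intro g u hu
    simp only [finLen, Subgroup.coe_mul, map_mul] at hu ⊢
    exact L.mul_of_zero _ _ hu
  · intro g i j h1 h2
    simp only [finLen, Subgroup.coe_mul, map_mul, hcoe] at h1 h2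
    apply hinj
    simp only [Subgroup.coe_mul, map_mul, hcoe]
    exact L.exchange _ _ _ h1 h2
  · intro g i j h
    have := L.q_conj (SemidirectProduct.inr (g : 𝓡.weylGroup)) (Sum.inl i.1) (Sum.inl j.1) (by
      have := congrArg (fun w : WPar b Q =>
        (SemidirectProduct.inr (w : 𝓡.weylGroup) : ExtWeyl 𝓡)) h
      simpa only [Subgroup.coe_mul, map_mul, hcoe] using this)
    exact this

end FiniteWeylGroup

open Filter

section Translations

variable {ι X Y : Type*} [AddCommGroup X] [AddCommGroup Y] {𝓡 : RootDatum ι X Y}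

/-! ### Translations -/

/-- The translation by `x`, as an element of `W ⋉ X`. -/
def trans (𝓡 : RootDatum ι X Y) (x : X) : ExtWeyl 𝓡 :=
  SemidirectProduct.inl (Multiplicative.ofAdd x)

theorem trans_add (x y : X) : trans 𝓡 (x + y) = trans 𝓡 x * trans 𝓡 y := by
  simp [trans]

theorem affAct_trans (x : X) (a : ι × ℤ) :
    affAct (trans 𝓡 x) a = (a.1, a.2 - 𝓡.toLinearMap x (𝓡.coroot a.1)) := by
  simp [affAct, trans]

theorem affAct_inr (w : 𝓡.weylGroup) (a : ι × ℤ) :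
    affAct (SemidirectProduct.inr w : ExtWeyl 𝓡) a = (w • a.1, a.2) := by
  simp [affAct]

theorem trans_mul_inr (g : ExtWeyl 𝓡) :
    trans 𝓡 (Multiplicative.toAdd g.left) * SemidirectProduct.inr g.right = g :=
  SemidirectProduct.inl_left_mul_inr_right g

theorem inr_mul_trans (w : 𝓡.weylGroup) (x : X) :
    (SemidirectProduct.inr w : ExtWeyl 𝓡) * trans 𝓡 x =
      trans 𝓡 (w • x) * SemidirectProduct.inr w := by
  refine extWeyl_ext ?_ ?_
  · simp only [trans, toAdd_mul_left, SemidirectProduct.left_inr, SemidirectProduct.left_inl,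
      SemidirectProduct.right_inr, SemidirectProduct.right_inl, toAdd_one, toAdd_ofAdd, zero_add,
      smul_zero, add_zero]
  · simp [trans]

variable (b : 𝓡.Base)

/-- `⟨x, α^∨⟩ ≥ 1` for all simple roots `α`. -/
def StrictlyDominant (x : X) : Prop := ∀ i ∈ b.support, 1 ≤ 𝓡.toLinearMap x (𝓡.coroot i)

variable {b} in
theorem StrictlyDominant.dominant {x : X} (hx : StrictlyDominant b x) : Dominant b x :=
  fun i hi => zero_le_one.trans (hx i hi)

variable {b} in
theorem Dominant.add {x y : X} (hx : Dominant b x) (hy : Dominant b y) : Dominant b (x + y) :=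
  fun i hi => by rw [map_add]; exact add_nonneg (hx i hi) (hy i hi)

variable [Finite ι]

variable {b} in
theorem StrictlyDominant.pairing_pos {x : X} (hx : StrictlyDominant b x) {i : ι}
    (hi : b.IsPos i) : 0 < 𝓡.toLinearMap x (𝓡.coroot i) := by
  have h1 := coroot_mem_closure b hi
  refine Or.resolve_left ?_ (𝓡.ne_zero' i)
  generalize 𝓡.coroot i = y at h1
  induction h1 using AddSubmonoid.closure_induction with
  | mem y hy => obtain ⟨j, hj, rfl⟩ := hy; exact Or.inr (hx j hj)
  | zero => exact Or.inl rfl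
  | add y z _ _ hy hz =>
    rcases hy with rfl | hy
    · simpa using hz
    · rcases hz with rfl | hz
      · right; simpa using hy
      · right; rw [map_add]; exact add_pos hy hz

theorem eventually_strictlyDominant (x : X) :
    ∀ᶠ n : ℕ in atTop, StrictlyDominant b (n • twoRho b + x) := by
  have h : ∀ i ∈ b.support, ∀ᶠ n : ℕ in atTop,
      1 ≤ 𝓡.toLinearMap (n • twoRho b + x) (𝓡.coroot i) := by
    intro i hi
    filter_upwards [eventually_ge_atTop (1 + |𝓡.toLinearMap x (𝓡.coroot i)|).toNat] with n hn
    rw [map_add, map_nsmul, LinearMap.add_apply, LinearMap.smul_apply, pairing_twoRho b hi]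
    have := neg_abs_le (𝓡.toLinearMap x (𝓡.coroot i))
    simp only [nsmul_eq_mul]
    omega
  simpa only [StrictlyDominant] using (eventually_all_finset b.support).2 h

theorem eventually_affPos_trans (a : ι × ℤ) :
    ∀ᶠ n : ℕ in atTop, AffPos b (affAct (trans 𝓡 (n • twoRho b)) a) ↔ ¬ b.IsPos a.1 := by
  filter_upwards [eventually_gt_atTop a.2.natAbs] with n hn
  have h1 : affAct (trans 𝓡 (n • twoRho b)) a =
      (a.1, a.2 - n * 𝓡.toLinearMap (twoRho b) (𝓡.coroot a.1)) := by
    rw [affAct_trans, map_nsmul, LinearMap.smul_apply, nsmul_eq_mul]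
  rw [h1]
  by_cases h : b.IsPos a.1
  · have h2 := pairing_twoRho_pos b h
    refine iff_of_false ?_ (not_not.2 h)
    rintro (h3 | h3)
    · simp only at h3
      have : (n : ℤ) ≤ n * 𝓡.toLinearMap (twoRho b) (𝓡.coroot a.1) := by nlinarith
      omega
    · have h3 := h3.1
      simp only at h3
      have : (n : ℤ) ≤ n * 𝓡.toLinearMap (twoRho b) (𝓡.coroot a.1) := by nlinarith
      omega
  · have h2 := pairing_twoRho_neg b h
    refine iff_of_true (Or.inl ?_) h
    simp only
    have : n * 𝓡.toLinearMap (twoRho b) (𝓡.coroot a.1) ≤ -(n : ℤ) := by nlinarith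
    omega

/-- A dominant translation pushes the constant term down on positive roots and up on negative ones.
An affine root made negative by one dominant translation is not made positive again by another. -/
theorem len_trans_mul_trans {x y : X} (hx : Dominant b x) (hy : Dominant b y) :
    len b (trans 𝓡 x * trans 𝓡 y) = len b (trans 𝓡 x) + len b (trans 𝓡 y) := by
  refine len_mul_of_forall b fun a h1 h2 h3 => h2 ?_
  rw [affAct_trans] at h2 ⊢
  rw [affAct_trans, affAct_trans] at h3
  by_cases h : b.IsPos a.1
  · have := pairing_nonneg_of_dominant b hx h
    rcases h3 with h3 | ⟨h3, -⟩ <;> simp only at h3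
    · exact Or.inl (by simp only; omega)
    · by_cases h0 : 𝓡.toLinearMap x (𝓡.coroot a.1) = 0
      · exact Or.inr ⟨by simp only; omega, h⟩
      · exact Or.inl (by simp only; omega)
  · have := pairing_nonpos_of_dominant b hy h
    rcases h1 with h1 | h1
    · exact Or.inl (by simp only; omega)
    · exact absurd h1.2 h

theorem len_inr_mul_trans (w : 𝓡.weylGroup) {x : X} (hx : Dominant b x) :
    len b (SemidirectProduct.inr w * trans 𝓡 x : ExtWeyl 𝓡) =
      len b (SemidirectProduct.inr w : ExtWeyl 𝓡) + len b (trans 𝓡 x) := by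
  refine len_mul_of_forall b fun a h1 h2 h3 => h2 ?_
  rw [affAct_trans] at h2 ⊢
  rw [affAct_trans, affAct_inr] at h3
  rcases h3 with h3 | h3
  · exact Or.inl h3
  · refine Or.inr ⟨h3.1, ?_⟩
    by_contra h
    have h4 := pairing_nonpos_of_dominant b hx h
    have h5 := h3.1
    simp only at h5 h h4
    rcases h1 with h1 | h1
    · omega
    · exact h h1.2

/-- The inversions of `w⁻¹` have constant term 0 and positive gradient, and a strictly dominant
translation makes all such affine roots negative. It follows that `N_{t_x w} = N_{t_x} N_{w⁻¹}⁻¹`.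
-/
theorem len_trans_mul_inr {x : X} (hx : StrictlyDominant b x) (w : 𝓡.weylGroup) :
    len b (trans 𝓡 x * SemidirectProduct.inr w * SemidirectProduct.inr w⁻¹ : ExtWeyl 𝓡) =
      len b (trans 𝓡 x * SemidirectProduct.inr w : ExtWeyl 𝓡) +
      len b (SemidirectProduct.inr w⁻¹ : ExtWeyl 𝓡) := by
  refine len_mul_of_forall b fun a h1 h2 h3 => ?_
  rw [← affAct_mul, mul_assoc, ← map_mul, mul_inv_cancel, map_one, mul_one, affAct_trans] at h3
  rw [affAct_inr] at h2
  rcases h1 with h1 | ⟨h1, h4⟩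
  · exact h2 (Or.inl h1)
  · have := hx.pairing_pos h4
    rcases h3 with h3 | ⟨h3, -⟩ <;> simp only at h3 <;> omega

end Translations

section Theta

variable {ι X Y : Type*} [AddCommGroup X] [AddCommGroup Y] {𝓡 : RootDatum ι X Y}
  {b : 𝓡.Base} {p : Params 𝓡} [Finite ι] {H : Type*} [Ring H] [Algebra ℂ H]
  {N : ExtWeyl 𝓡 → H} (L : HeckeBasis (len b) (sAff b) (qAff b p) N)

namespace HeckeBasis

/-! ### The elements `θ_x` -/

theorem U_trans_add {x y : X} (hx : Dominant b x) (hy : Dominant b y) :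
    L.U (trans 𝓡 (x + y)) = L.U (trans 𝓡 x) * L.U (trans 𝓡 y) := by
  rw [trans_add, L.U_mul (len_trans_mul_trans b hx hy)]

theorem commute_U_trans {x y : X} (hx : Dominant b x) (hy : Dominant b y) :
    Commute (L.U (trans 𝓡 x)) (L.U (trans 𝓡 y)) := by
  rw [Commute, SemiconjBy, ← L.U_trans_add hx hy, ← L.U_trans_add hy hx, add_comm]

theorem exists_dominant_sub (b : 𝓡.Base) (x : X) :
    ∃ x₁ x₂ : X, Dominant b x₁ ∧ Dominant b x₂ ∧ x = x₁ - x₂ := by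
  obtain ⟨n, h1, h2⟩ := ((eventually_strictlyDominant b x).and
    (eventually_strictlyDominant b 0)).exists
  exact ⟨_, _, h1.dominant, h2.dominant, by abel⟩

/-- The unit `θ_x`. -/
def theta (x : X) : Hˣ :=
  L.U (trans 𝓡 (exists_dominant_sub b x).choose) *
    (L.U (trans 𝓡 (exists_dominant_sub b x).choose_spec.choose))⁻¹

/-- Independence of the decomposition: dominant translations have additive lengths, so their basis
elements multiply and commute like elements of `X`. -/
theorem theta_sub {x₁ x₂ : X} (h1 : Dominant b x₁) (h2 : Dominant b x₂) :
    L.theta (x₁ - x₂) = L.U (trans 𝓡 x₁) * (L.U (trans 𝓡 x₂))⁻¹ := by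
  have hs := (exists_dominant_sub b (x₁ - x₂)).choose_spec.choose_spec
  rw [theta]
  set y₁ := (exists_dominant_sub b (x₁ - x₂)).choose
  set y₂ := (exists_dominant_sub b (x₁ - x₂)).choose_spec.choose
  obtain ⟨h3, h4, h5⟩ := hs
  have h6 : y₁ + x₂ = x₁ + y₂ := by
    rw [sub_eq_sub_iff_add_eq_add] at h5
    exact h5.symm
  have h7 := L.U_trans_add h3 h2
  rw [h6, L.U_trans_add h1 h4] at h7
  rw [mul_inv_eq_iff_eq_mul, mul_assoc, (L.commute_U_trans h2 h4).inv_left.eq, ← mul_assoc, h7,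
    mul_inv_cancel_right]

theorem theta_of_dominant {x : X} (h : Dominant b x) : L.theta x = L.U (trans 𝓡 x) := by
  have h1 := L.theta_sub (h.add h) h
  rwa [add_sub_cancel_right, L.U_trans_add h h, mul_inv_cancel_right] at h1

theorem theta_add (x y : X) : L.theta (x + y) = L.theta x * L.theta y := by
  obtain ⟨x₁, x₂, h1, h2, rfl⟩ := exists_dominant_sub b x
  obtain ⟨y₁, y₂, h3, h4, rfl⟩ := exists_dominant_sub b y
  rw [show x₁ - x₂ + (y₁ - y₂) = (x₁ + y₁) - (y₂ + x₂) by abel,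
    L.theta_sub (h1.add h3) (h4.add h2), L.theta_sub h1 h2, L.theta_sub h3 h4,
    L.U_trans_add h1 h3, L.U_trans_add h4 h2, mul_inv_rev, mul_assoc, mul_assoc]
  congr 1
  rw [← mul_assoc, ← mul_assoc, (L.commute_U_trans h2 h3).inv_left.eq, mul_assoc]

theorem theta_zero : L.theta 0 = 1 := by
  have := L.theta_add 0 0
  rwa [add_zero, left_eq_mul] at this

/-! ### Alcove walks -/

/-- The element `θ_x N_{w⁻¹}⁻¹`, for `t_x w ∈ W ⋉ X`. -/
def walk (g : ExtWeyl 𝓡) : Hˣ :=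
  L.theta (Multiplicative.toAdd g.left) * (L.U (SemidirectProduct.inr g.right⁻¹))⁻¹

theorem walk_trans (x : X) : L.walk (trans 𝓡 x) = L.theta x := by
  have : L.U (1 : ExtWeyl 𝓡) = 1 := Units.ext L.one
  simp [walk, trans, this]

theorem walk_trans_mul_inr (x : X) (w : 𝓡.weylGroup) :
    L.walk (trans 𝓡 x * SemidirectProduct.inr w) =
      L.theta x * (L.U (SemidirectProduct.inr w⁻¹))⁻¹ := by
  simp [walk, trans]

/-- Deep in the dominant chamber a walk becomes a genuine basis element. Identities between walks
therefore follow from those between the `N_g` by cancelling the unit `θ_{2nρ}`. -/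
theorem eventually_theta_mul_walk (g : ExtWeyl 𝓡) : ∀ᶠ n : ℕ in atTop,
    L.theta (n • twoRho b) * L.walk g = L.U (trans 𝓡 (n • twoRho b) * g) := by
  filter_upwards [eventually_strictlyDominant b (Multiplicative.toAdd g.left)] with n hn
  have h1 : trans 𝓡 (n • twoRho b) * g =
      trans 𝓡 (n • twoRho b + Multiplicative.toAdd g.left) * SemidirectProduct.inr g.right := by
    rw [trans_add, mul_assoc, trans_mul_inr]
  rw [walk, ← mul_assoc, ← L.theta_add, L.theta_of_dominant hn.dominant, h1,
    mul_inv_eq_iff_eq_mul, L.U_mul (len_trans_mul_inr b hn g.right), mul_assoc, ← map_mul,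
    mul_inv_cancel, map_one, mul_one]

theorem walk_mul_of_lenZero (g : ExtWeyl 𝓡) {u : ExtWeyl 𝓡} (hu : len b u = 0) :
    L.walk (g * u) = L.walk g * L.U u := by
  obtain ⟨n, h1, h2⟩ := ((L.eventually_theta_mul_walk g).and
    (L.eventually_theta_mul_walk (g * u))).exists
  rw [← mul_right_inj (L.theta (n • twoRho b)), h2, ← mul_assoc, ← mul_assoc, h1]
  exact (L.U_mul (by rw [L.mul_of_zero _ _ hu, hu, add_zero])).symm

/-- After a large dominant translation the sign of an affine root is opposite to that of its
gradient. A negative gradient thus means that the step by `s_j` raises the length. -/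
theorem walk_mul_of_neg (g : ExtWeyl 𝓡) (j : SAff b)
    (h : ¬ b.IsPos (g.right • (simpleAffRoot b j).1)) :
    L.walk (g * sAff b j) = L.walk g * L.U (sAff b j) := by
  obtain ⟨n, h1, h2, h3⟩ := ((L.eventually_theta_mul_walk g).and
    ((L.eventually_theta_mul_walk (g * sAff b j)).and
      (eventually_affPos_trans b (affAct g (simpleAffRoot b j))))).exists
  replace h3 := h3.2 h
  rw [← affAct_mul] at h3
  rw [← mul_right_inj (L.theta (n • twoRho b)), h2, ← mul_assoc, ← mul_assoc, h1]
  exact (L.U_mul (by rw [inversions_mul_sAff b _ _ h3, L.len_s])).symm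

theorem walk_mul_of_pos (g : ExtWeyl 𝓡) (j : SAff b)
    (h : b.IsPos (g.right • (simpleAffRoot b j).1)) :
    L.walk (g * sAff b j) = L.walk g * (L.U (sAff b j))⁻¹ := by
  have h1 : ¬ b.IsPos ((g * sAff b j).right • (simpleAffRoot b j).1) := by
    rw [SemidirectProduct.mul_right, sAff_right, mul_smul, ← negIdx, smul_negIdx, isPos_negIdx]
    exact not_not.2 h
  rw [eq_mul_inv_iff_mul_eq, ← L.walk_mul_of_neg _ j h1, mul_assoc, sAff_mul_self, mul_one]

theorem walk_one : L.walk 1 = 1 := by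
  have h2 := L.walk_trans 0
  rwa [L.theta_zero, trans, ofAdd_zero, map_one] at h2

/-- The span of the elements `θ_x N_{w⁻¹}⁻¹`, for fixed `w`. -/
def walkSpan (w : 𝓡.weylGroup) : Submodule ℂ H :=
  Submodule.span ℂ ((fun g => (L.walk g : H)) '' {g | g.right = w})

theorem walk_mem {g : ExtWeyl 𝓡} {w : 𝓡.weylGroup} (h : g.right = w) :
    (L.walk g : H) ∈ L.walkSpan w := Submodule.subset_span ⟨g, h, rfl⟩

omit [Finite ι] in
theorem U_inv_eq (j : SAff b) : (((L.U (sAff b j))⁻¹ : Hˣ) : H) =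
    L.U (sAff b j) - quadCoeff (qAff b p) j • (1 : H) := L.coe_U_s_inv j

theorem walkSpan_mul {w : 𝓡.weylGroup} {x : H} (hx : x ∈ L.walkSpan w) (j : SAff b) (y : H)
    (hy : ∀ g : ExtWeyl 𝓡, g.right = w → (L.walk g : H) * y = L.walk (g * sAff b j)) :
    x * y ∈ L.walkSpan (w * RootPairing.weylGroup.ofIdx 𝓡 (simpleAffRoot b j).1) := by
  induction hx using Submodule.span_induction with
  | mem x hx =>
    obtain ⟨g, hg, rfl⟩ := hx
    rw [hy g hg]
    refine L.walk_mem ?_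
    rw [SemidirectProduct.mul_right, sAff_right, hg]
  | zero => simp
  | add x y _ _ hx hy => rw [add_mul]; exact add_mem hx hy
  | smul c x _ hx => rw [Algebra.smul_mul_assoc]; exact Submodule.smul_mem _ c hx

/-- Left multiplication of an alcove walk by `N_s⁻¹` reflects the walk, up to folded walks. -/
theorem U_inv_mul_walk (i : {i : ι // i ∈ b.support}) (g : ExtWeyl 𝓡) :
    (((L.U (sAff b (Sum.inl i)))⁻¹ : Hˣ) : H) * L.walk g - L.walk (sAff b (Sum.inl i) * g) ∈
      L.walkSpan g.right := by
  classical
  induction g using L.induction_right with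
  | h0 u hu =>
    have h1 := L.walk_mul_of_lenZero 1 hu
    have h2 := L.walk_mul_of_lenZero (sAff b (Sum.inl i)) hu
    have h3 := L.walk_mul_of_pos 1 (Sum.inl i) (by
      simpa [simpleAffRoot] using RootPairing.Base.isPos_of_mem_support i.2)
    rw [one_mul, L.walk_one, one_mul] at h1 h3
    rw [h2, h1, h3, Units.val_mul, sub_self]
    exact zero_mem _
  | hs g j _ ih =>
    set s := sAff b (Sum.inl i) with hs
    set r := g.right • (simpleAffRoot b j).1 with hr
    set c := quadCoeff (qAff b p) j
    have hsr : (s * g).right • (simpleAffRoot b j).1 = RootPairing.weylGroup.ofIdx 𝓡 i.1 • r := by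
      rw [SemidirectProduct.mul_right, mul_smul]; rfl
    have hgr : (g * sAff b j).right =
        g.right * RootPairing.weylGroup.ofIdx 𝓡 (simpleAffRoot b j).1 := by
      rw [SemidirectProduct.mul_right, sAff_right]
    -- The factors `ε` and `δ` are the `N_s^{±1}` by which the walk and its reflected copy are
    -- extended. They differ only when the gradient is `±α_i`. The difference is then a scalar, and
    -- the reflected walk stopped one step earlier has the finite part required for the span.
    obtain ⟨ε, δ, hε, hδ, hc⟩ : ∃ ε δ : Hˣ,
        (∀ h : ExtWeyl 𝓡, h.right = g.right → L.walk (h * sAff b j) = L.walk h * ε) ∧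
        L.walk (s * g * sAff b j) = L.walk (s * g) * δ ∧
        (ε = δ ∨ (g * sAff b j).right = (s * g).right ∧
          ∃ d : ℂ, (ε : H) = δ + d • (1 : H)) := by
      have hcase : r = i.1 ∨ r = negIdx 𝓡 i.1 →
          (g * sAff b j).right = (s * g).right := by
        intro h
        have h1 : RootPairing.weylGroup.ofIdx 𝓡 r = RootPairing.weylGroup.ofIdx 𝓡 i.1 := by
          rcases h with h | h <;> rw [h]
          rw [ofIdx_negIdx]
        rw [hr, ofIdx_smul] at h1
        rw [hgr, SemidirectProduct.mul_right, ← mul_inv_eq_iff_eq_mul, h1]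
        rfl
      by_cases h1 : b.IsPos r
      · refine ⟨(L.U (sAff b j))⁻¹, if b.IsPos (RootPairing.weylGroup.ofIdx 𝓡 i.1 • r) then
          (L.U (sAff b j))⁻¹ else L.U (sAff b j), fun h hh => L.walk_mul_of_pos h j (by
            rwa [hh]), ?_, ?_⟩
        · split_ifs with h2
          · exact L.walk_mul_of_pos _ j (by rwa [hsr])
          · exact L.walk_mul_of_neg _ j (by rwa [hsr])
        · split_ifs with h2
          · exact Or.inl rfl
          · refine Or.inr ⟨hcase (Or.inl ?_), -c, ?_⟩
            · by_contra hne
              exact h2 (isPos_refl b h1 i.2 hne)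
            · rw [L.U_inv_eq, neg_smul, sub_eq_add_neg]
      · refine ⟨L.U (sAff b j), if b.IsPos (RootPairing.weylGroup.ofIdx 𝓡 i.1 • r) then
          (L.U (sAff b j))⁻¹ else L.U (sAff b j), fun h hh => L.walk_mul_of_neg h j (by
            rwa [hh]), ?_, ?_⟩
        · split_ifs with h2
          · exact L.walk_mul_of_pos _ j (by rwa [hsr])
          · exact L.walk_mul_of_neg _ j (by rwa [hsr])
        · split_ifs with h2
          · refine Or.inr ⟨hcase (Or.inr ?_), c, ?_⟩
            · by_contra hne
              have hne2 : r ≠ i.1 := fun h =>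
                h1 (h ▸ RootPairing.Base.isPos_of_mem_support i.2)
              exact h1 ((isPos_refl_iff b i.2 hne2 hne).1 h2)
            · rw [L.U_inv_eq, sub_add_cancel]
          · exact Or.inl rfl
    have h1 := L.walkSpan_mul ih j ε (fun h hh => by rw [hε h hh, Units.val_mul])
    rw [← hgr] at h1
    have h2 : (((L.U s)⁻¹ : Hˣ) : H) * L.walk (g * sAff b j) - L.walk (s * (g * sAff b j)) =
        ((((L.U s)⁻¹ : Hˣ) : H) * L.walk g - L.walk (s * g)) * ε +
          (L.walk (s * g) * ε - L.walk (s * g) * δ) := by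
      rw [← mul_assoc s, hδ, hε g rfl, Units.val_mul, Units.val_mul]
      noncomm_ring
    rw [h2]
    refine add_mem h1 ?_
    rcases hc with rfl | ⟨hc, d, hd⟩
    · rw [sub_self]; exact zero_mem _
    · rw [hd, mul_add, add_sub_cancel_left, Algebra.mul_smul_comm, mul_one]
      exact Submodule.smul_mem _ _ (L.walk_mem hc.symm)

/-- The span of the elements `θ_x`. -/
def thetaSpan : Submodule ℂ H := Submodule.span ℂ (Set.range fun x => (L.theta x : H))

theorem theta_mem (x : X) : (L.theta x : H) ∈ L.thetaSpan := Submodule.subset_span ⟨x, rfl⟩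

theorem walkSpan_one_le : L.walkSpan 1 ≤ L.thetaSpan := by
  refine Submodule.span_le.2 ?_
  rintro _ ⟨g, hg, rfl⟩
  have h1 := trans_mul_inr g
  rw [show g.right = 1 from hg, map_one, mul_one] at h1
  have := L.theta_mem (Multiplicative.toAdd g.left)
  rwa [← L.walk_trans, h1] at this

/-- The Bernstein relation, up to elements of the span of the `θ_x`. -/
theorem bernstein (i : {i : ι // i ∈ b.support}) (x : X) :
    N (sAff b (Sum.inl i)) * L.theta x -
      L.theta (RootPairing.weylGroup.ofIdx 𝓡 i.1 • x) * N (sAff b (Sum.inl i)) ∈ L.thetaSpan := by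
  have h1 := L.walkSpan_one_le (L.U_inv_mul_walk i (trans 𝓡 x))
  have h2 : sAff b (Sum.inl i) * trans 𝓡 x =
      trans 𝓡 (RootPairing.weylGroup.ofIdx 𝓡 i.1 • x) *
        SemidirectProduct.inr (RootPairing.weylGroup.ofIdx 𝓡 i.1) := inr_mul_trans _ _
  rw [h2, L.walk_trans_mul_inr, L.walk_trans, ofIdx_inv, ← sAff_inl, Units.val_mul, L.U_inv_eq,
    L.coe_U] at h1
  -- The walk relation compares `N_s⁻¹ θ_x` with `θ_{s x} N_s⁻¹`. Passing from `N_s⁻¹` to `N_s`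
  -- costs only multiples of `θ_x` and `θ_{s x}`.
  have h3 := add_mem h1 (Submodule.smul_mem _ (quadCoeff (qAff b p) (Sum.inl i))
    (sub_mem (L.theta_mem x) (L.theta_mem (RootPairing.weylGroup.ofIdx 𝓡 i.1 • x))))
  convert h3 using 1
  simp only [sub_mul, mul_sub, Algebra.smul_mul_assoc, Algebra.mul_smul_comm, one_mul, mul_one,
    smul_sub]
  abel

end HeckeBasis

end Theta

open Filter

section Spans

variable {ι X Y : Type*} [AddCommGroup X] [AddCommGroup Y] {𝓡 : RootDatum ι X Y}
  {b : 𝓡.Base} {p : Params 𝓡} [Finite ι] {H : Type*} [Ring H] [Algebra ℂ H]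
  {N : ExtWeyl 𝓡 → H} (L : HeckeBasis (len b) (sAff b) (qAff b p) N)

theorem WPar_induction (p : Params 𝓡) {Q : Set b.support} {P : 𝓡.weylGroup → Prop} (h1 : P 1)
    (hs : ∀ w ∈ WPar b Q, ∀ j ∈ Q,
      len b (SemidirectProduct.inr w * sAff b (Sum.inl j) : ExtWeyl 𝓡) =
        len b (SemidirectProduct.inr w : ExtWeyl 𝓡) + 1 →
      P w → P (w * RootPairing.weylGroup.ofIdx 𝓡 j.1))
    {w : 𝓡.weylGroup} (hw : w ∈ WPar b Q) : P w := by
  have := (finLengthSystem b p Q).induction_right (p := fun u => P u.1)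
    (fun u hu => by rw [eq_one_of_len_inr_eq_zero b hu]; exact h1)
    (fun u j hj ih => hs u.1 u.2 j.1 j.2 (by
      simp only [finLen, Subgroup.coe_mul, map_mul] at hj
      exact hj) ih)
  exact this ⟨w, hw⟩

namespace HeckeBasis

/-! ### Parabolic subalgebras as products of spans -/

omit [Finite ι] in
/-- The span of the elements `N_w`, for `w` in a parabolic subgroup of the finite Weyl group. -/
def parSpan (_ : HeckeBasis (len b) (sAff b) (qAff b p) N) (Q : Set b.support) :
    Submodule ℂ H :=
  Submodule.span ℂ ((fun w : 𝓡.weylGroup => N (SemidirectProduct.inr w)) '' WPar b Q)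

variable {Q : Set b.support}

omit [Finite ι] in
theorem N_mem_parSpan {w : 𝓡.weylGroup} (hw : w ∈ WPar b Q) :
    N (SemidirectProduct.inr w) ∈ L.parSpan Q := Submodule.subset_span ⟨w, hw, rfl⟩

omit [Finite ι] in
theorem ofIdx_mem_WPar {j : b.support} (hj : j ∈ Q) :
    RootPairing.weylGroup.ofIdx 𝓡 j.1 ∈ WPar b Q := Subgroup.subset_closure ⟨j, hj, rfl⟩

omit [Finite ι] in
theorem N_s_mem_parSpan {j : b.support} (hj : j ∈ Q) : N (sAff b (Sum.inl j)) ∈ L.parSpan Q :=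
  L.N_mem_parSpan (ofIdx_mem_WPar hj)

omit [Finite ι] in
theorem one_mem_parSpan : (1 : H) ∈ L.parSpan Q := by
  have := L.N_mem_parSpan (one_mem (WPar b Q))
  rwa [map_one, L.one] at this

omit [Finite ι] in
theorem parSpan_mul_s {x : H} (hx : x ∈ L.parSpan Q) {j : b.support} (hj : j ∈ Q) :
    x * N (sAff b (Sum.inl j)) ∈ L.parSpan Q := by
  induction hx using Submodule.span_induction with
  | mem x hx =>
    obtain ⟨w, hw, rfl⟩ := hx
    have h1 : N (SemidirectProduct.inr w * sAff b (Sum.inl j)) ∈ L.parSpan Q := by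
      rw [sAff_inl, ← map_mul]
      exact L.N_mem_parSpan (mul_mem hw (ofIdx_mem_WPar hj))
    rcases L.step (SemidirectProduct.inr w) (Sum.inl j) with h | h
    · simp only [L.up h, h1]
    · simp only [L.down h]
      exact add_mem h1 (Submodule.smul_mem _ _ (L.N_mem_parSpan hw))
  | zero => simp
  | add x y _ _ hx hy => rw [add_mul]; exact add_mem hx hy
  | smul c x _ hx => rw [Algebra.smul_mul_assoc]; exact Submodule.smul_mem _ c hx

omit [Finite ι] in
include L in
theorem N_mul_s_eq {w : 𝓡.weylGroup} {j : b.support}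
    (h : len b (SemidirectProduct.inr w * sAff b (Sum.inl j) : ExtWeyl 𝓡) =
      len b (SemidirectProduct.inr w : ExtWeyl 𝓡) + 1) :
    N (SemidirectProduct.inr (w * RootPairing.weylGroup.ofIdx 𝓡 j.1)) =
      N (SemidirectProduct.inr w) * N (sAff b (Sum.inl j)) := by
  rw [L.up h, sAff_inl, map_mul]

theorem parSpan_mul_parSpan : L.parSpan Q * L.parSpan Q ≤ L.parSpan Q := by
  refine Submodule.mul_le.2 fun x hx y hy => ?_
  induction hy using Submodule.span_induction with
  | mem y hy =>
    obtain ⟨w, hw, rfl⟩ := hy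
    refine WPar_induction p (P := fun w => x * N (SemidirectProduct.inr w) ∈ L.parSpan Q)
      ?_ ?_ hw
    · rwa [map_one, L.one, mul_one]
    · intro w _ j hj hl ih
      rw [L.N_mul_s_eq hl, ← mul_assoc]
      exact L.parSpan_mul_s ih hj
  | zero => simp
  | add y z _ _ hy hz => rw [mul_add]; exact add_mem hy hz
  | smul c y _ hy => rw [Algebra.mul_smul_comm]; exact Submodule.smul_mem _ c hy

omit [Finite ι] in
theorem U_s_inv_mem {j : b.support} (hj : j ∈ Q) :
    (((L.U (sAff b (Sum.inl j)))⁻¹ : Hˣ) : H) ∈ L.parSpan Q := by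
  rw [L.U_inv_eq]
  exact sub_mem (L.N_s_mem_parSpan hj) (Submodule.smul_mem _ _ L.one_mem_parSpan)

theorem U_inv_mem {w : 𝓡.weylGroup} (hw : w ∈ WPar b Q) :
    (((L.U (SemidirectProduct.inr w))⁻¹ : Hˣ) : H) ∈ L.parSpan Q := by
  refine WPar_induction p
    (P := fun w => (((L.U (SemidirectProduct.inr w))⁻¹ : Hˣ) : H) ∈ L.parSpan Q) ?_ ?_ hw
  · have h1 : L.U (1 : ExtWeyl 𝓡) = 1 := Units.ext L.one
    rw [map_one, h1, inv_one, Units.val_one]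
    exact L.one_mem_parSpan
  · intro w _ j hj hl ih
    have : L.U (SemidirectProduct.inr (w * RootPairing.weylGroup.ofIdx 𝓡 j.1)) =
        L.U (SemidirectProduct.inr w) * L.U (sAff b (Sum.inl j)) :=
      Units.ext (L.N_mul_s_eq hl)
    rw [this, mul_inv_rev, Units.val_mul]
    exact L.parSpan_mul_parSpan (Submodule.mul_mem_mul (L.U_s_inv_mem hj) ih)

theorem one_mem_thetaSpan : (1 : H) ∈ L.thetaSpan := by
  have := L.theta_mem 0
  rwa [L.theta_zero, Units.val_one] at this

theorem thetaSpan_mul_thetaSpan : L.thetaSpan * L.thetaSpan ≤ L.thetaSpan := by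
  rw [thetaSpan, Submodule.span_mul_span]
  refine Submodule.span_le.2 ?_
  rintro _ ⟨_, ⟨x, rfl⟩, _, ⟨y, rfl⟩, rfl⟩
  have := L.theta_mem (x + y)
  rwa [L.theta_add, Units.val_mul] at this

theorem exists_s_mul_eq (j : b.support) {a : H} (ha : a ∈ L.thetaSpan) :
    ∃ a₁ ∈ L.thetaSpan, ∃ a₂ ∈ L.thetaSpan,
      N (sAff b (Sum.inl j)) * a = a₁ * N (sAff b (Sum.inl j)) + a₂ := by
  induction ha using Submodule.span_induction with
  | mem a ha =>
    obtain ⟨x, rfl⟩ := ha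
    exact ⟨_, L.theta_mem _, _, L.bernstein j x, by abel⟩
  | zero => exact ⟨0, zero_mem _, 0, zero_mem _, by simp⟩
  | add x y _ _ hx hy =>
    obtain ⟨a₁, h1, a₂, h2, h3⟩ := hx
    obtain ⟨c₁, h4, c₂, h5, h6⟩ := hy
    exact ⟨_, add_mem h1 h4, _, add_mem h2 h5, by rw [mul_add, h3, h6, add_mul]; abel⟩
  | smul c x _ hx =>
    obtain ⟨a₁, h1, a₂, h2, h3⟩ := hx
    exact ⟨_, Submodule.smul_mem _ c h1, _, Submodule.smul_mem _ c h2, by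
      rw [Algebra.mul_smul_comm, h3, Algebra.smul_mul_assoc, smul_add]⟩

theorem exists_mul_s_eq (j : b.support) {a : H} (ha : a ∈ L.thetaSpan) :
    ∃ a₁ ∈ L.thetaSpan, ∃ a₂ ∈ L.thetaSpan,
      a * N (sAff b (Sum.inl j)) = N (sAff b (Sum.inl j)) * a₁ + a₂ := by
  induction ha using Submodule.span_induction with
  | mem a ha =>
    obtain ⟨x, rfl⟩ := ha
    have := L.bernstein j (RootPairing.weylGroup.ofIdx 𝓡 j.1 • x)
    rw [smul_smul, refl_refl, one_smul] at this
    exact ⟨_, L.theta_mem _, _, neg_mem this, by abel⟩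
  | zero => exact ⟨0, zero_mem _, 0, zero_mem _, by simp⟩
  | add x y _ _ hx hy =>
    obtain ⟨a₁, h1, a₂, h2, h3⟩ := hx
    obtain ⟨c₁, h4, c₂, h5, h6⟩ := hy
    exact ⟨_, add_mem h1 h4, _, add_mem h2 h5, by rw [add_mul, h3, h6, mul_add]; abel⟩
  | smul c x _ hx =>
    obtain ⟨a₁, h1, a₂, h2, h3⟩ := hx
    exact ⟨_, Submodule.smul_mem _ c h1, _, Submodule.smul_mem _ c h2, by
      rw [Algebra.smul_mul_assoc, h3, Algebra.mul_smul_comm, smul_add]⟩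

theorem parSpan_mul_thetaSpan : L.parSpan Q * L.thetaSpan ≤ L.thetaSpan * L.parSpan Q := by
  refine Submodule.mul_le.2 fun x hx a ha => ?_
  induction hx using Submodule.span_induction with
  | mem x hx =>
    obtain ⟨w, hw, rfl⟩ := hx
    refine WPar_induction p (P := fun w => ∀ a ∈ L.thetaSpan,
      N (SemidirectProduct.inr w) * a ∈ L.thetaSpan * L.parSpan Q) ?_ ?_ hw a ha
    · intro a ha
      rw [map_one, L.one, one_mul, ← mul_one a]
      exact Submodule.mul_mem_mul ha L.one_mem_parSpan
    · intro w _ j hj hl ih a ha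
      obtain ⟨a₁, h1, a₂, h2, h3⟩ := L.exists_s_mul_eq j ha
      rw [L.N_mul_s_eq hl, mul_assoc, h3, mul_add, ← mul_assoc]
      refine add_mem ?_ (ih _ h2)
      have h4 := Submodule.mul_mem_mul (ih _ h1) (L.N_s_mem_parSpan hj)
      rw [mul_assoc] at h4
      exact mul_le_mul' le_rfl L.parSpan_mul_parSpan h4
  | zero => simp
  | add y z _ _ hy hz => rw [add_mul]; exact add_mem hy hz
  | smul c y _ hy => rw [Algebra.smul_mul_assoc]; exact Submodule.smul_mem _ c hy

theorem thetaSpan_mul_parSpan : L.thetaSpan * L.parSpan Q ≤ L.parSpan Q * L.thetaSpan := by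
  refine Submodule.mul_le.2 fun a ha x hx => ?_
  induction hx using Submodule.span_induction with
  | mem x hx =>
    obtain ⟨w, hw, rfl⟩ := hx
    refine WPar_induction p (P := fun w =>
      a * N (SemidirectProduct.inr w) ∈ L.parSpan Q * L.thetaSpan) ?_ ?_ hw
    · rw [map_one, L.one, mul_one, ← one_mul a]
      exact Submodule.mul_mem_mul L.one_mem_parSpan ha
    · intro w _ j hj hl ih
      rw [L.N_mul_s_eq hl, ← mul_assoc]
      refine Submodule.mul_induction_on ih (fun k hk a ha => ?_) (fun x y hx hy => ?_)
      · obtain ⟨a₁, h1, a₂, h2, h3⟩ := L.exists_mul_s_eq j ha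
        rw [mul_assoc, h3, mul_add, ← mul_assoc]
        exact add_mem (Submodule.mul_mem_mul (L.parSpan_mul_s hk hj) h1)
          (Submodule.mul_mem_mul hk h2)
      · rw [add_mul]; exact add_mem hx hy
  | zero => simp
  | add y z _ _ hy hz => rw [mul_add]; exact add_mem hy hz
  | smul c y _ hy => rw [Algebra.mul_smul_comm]; exact Submodule.smul_mem _ c hy

variable (Q) in
/-- The products of elements of the span of the `θ_x` and elements `N_w` with `w ∈ W_Q` span a
subalgebra. -/
def parAlgebra : Subalgebra ℂ H :=
  (L.thetaSpan * L.parSpan Q).toSubalgebra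
    (by simpa using Submodule.mul_mem_mul L.one_mem_thetaSpan (L.one_mem_parSpan (Q := Q)))
    (fun x y hx hy => by
      have h1 : L.thetaSpan * L.parSpan Q * (L.thetaSpan * L.parSpan Q) ≤
          L.thetaSpan * L.parSpan Q := by
        calc L.thetaSpan * L.parSpan Q * (L.thetaSpan * L.parSpan Q)
            = L.thetaSpan * (L.parSpan Q * L.thetaSpan) * L.parSpan Q := by
              simp only [mul_assoc]
          _ ≤ L.thetaSpan * (L.thetaSpan * L.parSpan Q) * L.parSpan Q :=
              mul_le_mul' (mul_le_mul' le_rfl L.parSpan_mul_thetaSpan) le_rfl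
          _ = (L.thetaSpan * L.thetaSpan) * (L.parSpan Q * L.parSpan Q) := by
              simp only [mul_assoc]
          _ ≤ L.thetaSpan * L.parSpan Q :=
              mul_le_mul' L.thetaSpan_mul_thetaSpan L.parSpan_mul_parSpan
      exact h1 (Submodule.mul_mem_mul hx hy))

theorem mem_parAlgebra {x : H} : x ∈ L.parAlgebra Q ↔ x ∈ L.thetaSpan * L.parSpan Q := Iff.rfl

theorem thetaSpan_le_parAlgebra {x : H} (hx : x ∈ L.thetaSpan) : x ∈ L.parAlgebra Q := by
  have := Submodule.mul_mem_mul hx (L.one_mem_parSpan (Q := Q))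
  rwa [mul_one] at this

theorem parSpan_le_parAlgebra {x : H} (hx : x ∈ L.parSpan Q) : x ∈ L.parAlgebra Q := by
  have := Submodule.mul_mem_mul L.one_mem_thetaSpan hx
  rwa [one_mul] at this

theorem walk_mem_parAlgebra (g : ExtWeyl 𝓡) : (L.walk g : H) ∈ L.parAlgebra Set.univ := by
  rw [walk, Units.val_mul]
  exact Submodule.mul_mem_mul (L.theta_mem _) (L.U_inv_mem (by rw [WPar_univ]; trivial))

/-- The walk of a simple affine reflection `s` is `N_s` or `N_s⁻¹`, and that of a length-zero
element `u` is `N_u`. All walks lie in the algebra by their definition, so the affine reflections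
`s'_α` need no separate argument. -/
theorem parAlgebra_univ : L.parAlgebra Set.univ = ⊤ := by
  rw [eq_top_iff, ← L.adjoin]
  refine Algebra.adjoin_le ?_
  rintro _ ⟨g, rfl⟩
  have hs : ∀ j, N (sAff b j) ∈ L.parAlgebra Set.univ := by
    intro j
    have h1 := L.walk_mem_parAlgebra (sAff b j)
    by_cases h : b.IsPos ((1 : ExtWeyl 𝓡).right • (simpleAffRoot b j).1)
    · have h2 := L.walk_mul_of_pos 1 j h
      rw [one_mul, L.walk_one, one_mul] at h2
      rw [h2, L.U_inv_eq] at h1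
      have := add_mem h1 (Subalgebra.smul_mem _ (one_mem (L.parAlgebra Set.univ))
        (quadCoeff (qAff b p) j))
      rwa [sub_add_cancel] at this
    · have h2 := L.walk_mul_of_neg 1 j h
      rw [one_mul, L.walk_one, one_mul] at h2
      rwa [h2] at h1
  change N g ∈ L.parAlgebra Set.univ
  induction g using L.induction_right with
  | h0 u hu =>
    have h1 := L.walk_mem_parAlgebra u
    have h2 := L.walk_mul_of_lenZero 1 hu
    rw [one_mul, L.walk_one, one_mul] at h2
    rwa [h2] at h1
  | hs g j hj ih =>
    rw [← L.up hj]
    exact mul_mem ih (hs j)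

theorem adjoin_le_parAlgebra :
    Algebra.adjoin ℂ ({h : H | ∃ x : X, h = (L.theta x : H)} ∪
      {h : H | ∃ w ∈ WPar b Q, h = N (SemidirectProduct.inr w)}) ≤ L.parAlgebra Q := by
  refine Algebra.adjoin_le ?_
  rintro _ (⟨x, rfl⟩ | ⟨w, hw, rfl⟩)
  · exact L.thetaSpan_le_parAlgebra (L.theta_mem x)
  · exact L.parSpan_le_parAlgebra (L.N_mem_parSpan hw)

theorem mem_parSpan_mul_thetaSpan (h : H) : h ∈ L.parSpan Set.univ * L.thetaSpan :=
  L.thetaSpan_mul_parSpan (L.mem_parAlgebra.1 (by rw [L.parAlgebra_univ]; trivial))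

/-! ### Linear independence -/

/-- Multiplication by `θ_{2nρ}` makes the finitely many weights dominant. Each `N_w θ_x` then
becomes a basis element `N_{w t_x}`, and only `w = 1` contributes to pure translations, so the
coefficient at `1` detects `x`. -/
theorem linearIndependent_mul_theta {I : Type*} [Fintype I] (f : I → 𝓡.weylGroup)
    (hf : Function.Injective f) (c : I → ℂ) (i₀ : I) (h1 : f i₀ = 1) (hc : c i₀ ≠ 0) :
    LinearIndependent ℂ fun x : X =>
      (∑ i, c i • N (SemidirectProduct.inr (f i))) * (L.theta x : H) := by
  classical
  rw [linearIndependent_iff]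
  intro l hl
  obtain ⟨n, hn⟩ := ((eventually_all_finset l.support).2
    fun x _ => eventually_strictlyDominant b x).exists
  obtain ⟨n', hn'⟩ := (eventually_strictlyDominant b 0).exists
  obtain ⟨Ψ, hΨ⟩ := L.coord
  have hd : ∀ x ∈ l.support, (∑ i, c i • N (SemidirectProduct.inr (f i))) * (L.theta x : H) *
      L.theta (n • twoRho b) =
      ∑ i, c i • N (SemidirectProduct.inr (f i) * trans 𝓡 (n • twoRho b + x)) := by
    intro x hx
    rw [mul_assoc, ← Units.val_mul, ← L.theta_add, add_comm x,
      L.theta_of_dominant (hn x hx).dominant, Finset.sum_mul]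
    refine Finset.sum_congr rfl fun i _ => ?_
    rw [Algebra.smul_mul_assoc, L.coe_U, L.N_mul (len_inr_mul_trans b _ (hn x hx).dominant)]
  have h2 : ∑ x ∈ l.support, l x • ∑ i, c i •
      N (SemidirectProduct.inr (f i) * trans 𝓡 (n • twoRho b + x)) = 0 := by
    have := congrArg (· * (L.theta (n • twoRho b) : H)) hl
    rw [zero_mul, Finsupp.linearCombination_apply, Finsupp.sum, Finset.sum_mul] at this
    rw [← this]
    refine Finset.sum_congr rfl fun x hx => ?_
    rw [Algebra.smul_mul_assoc, hd x hx]
  have h3 := congrArg Ψ h2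
  simp only [map_sum, map_smul, hΨ, map_zero] at h3
  ext x₀
  by_cases hx₀ : x₀ ∈ l.support
  · have h4 := DFunLike.congr_fun h3 (trans 𝓡 (n • twoRho b + x₀))
    have h5 : ∀ x i, (SemidirectProduct.inr (f i) * trans 𝓡 (n • twoRho b + x) : ExtWeyl 𝓡) =
        trans 𝓡 (n • twoRho b + x₀) ↔ x = x₀ ∧ i = i₀ := by
      intro x i
      constructor
      · intro h
        have h6 := congrArg SemidirectProduct.right h
        simp only [trans, SemidirectProduct.mul_right, SemidirectProduct.right_inr,
          SemidirectProduct.right_inl, mul_one] at h6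
        have hi : i = i₀ := hf (h6.trans h1.symm)
        rw [hi, h1, map_one, one_mul] at h
        exact ⟨add_left_cancel (Multiplicative.ofAdd.injective
          (SemidirectProduct.inl_injective h)), hi⟩
      · rintro ⟨rfl, rfl⟩
        rw [h1, map_one, one_mul]
    simp only [Finsupp.coe_finsetSum, Finset.sum_apply, Finsupp.smul_apply,
      Finsupp.single_apply, h5, Finsupp.coe_zero, Pi.zero_apply] at h4
    rw [Finset.sum_eq_single x₀ (fun x _ hx => by simp [hx]) (fun h => absurd hx₀ h),
      Finset.sum_eq_single i₀ (fun i _ hi => by simp [hi]) (by simp)] at h4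
    simp only [and_self, if_true, smul_eq_mul, mul_one, mul_eq_zero, hc, or_false] at h4
    simpa using h4
  · simpa using hx₀

end HeckeBasis

end Spans

section Idempotent

variable {G J H : Type*} [Group G] [Ring H] [Algebra ℂ H] {len : G → ℕ} {s : J → G} {q : J → ℝ}
  {N : G → H} (L : HeckeBasis len s q N)
include L

namespace HeckeBasis

/-! ### The idempotent of a character -/

theorem left_up {g : G} {j : J} (h : len (s j * g) = len g + 1) : N (s j) * N g = N (s j * g) :=
  L.N_mul (by rw [h, L.len_s, add_comm])

theorem left_down {g : G} {j : J} (h : len (s j * g) + 1 = len g) :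
    N (s j) * N g = N (s j * g) + quadCoeff q j • N g := by
  have h1 : s j * (s j * g) = g := by rw [← mul_assoc, L.mul_self, one_mul]
  have h2 := L.left_up (g := s j * g) (j := j) (by rw [h1, h])
  rw [h1] at h2
  rw [← h2, ← mul_assoc, L.N_s_sq, add_mul, one_mul, Algebra.smul_mul_assoc]

/-- The multiple of the idempotent of the character `St`. -/
def charSum (_ : HeckeBasis len s q N) [Fintype G] (St : H →ₐ[ℂ] ℂ) : H := ∑ g, St (N g) • N g

variable [Fintype G] (St : H →ₐ[ℂ] ℂ)

/-- The two terms at `g` and `g s` together form an eigenvector for right multiplication by `N_s`,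
because `St(N_s)` satisfies the quadratic relation. -/
theorem charSum_mul_s (j : J) : L.charSum St * N (s j) = St (N (s j)) • L.charSum St := by
  have key : ∀ g, St (N g) • (N g * N (s j)) + St (N (g * s j)) • (N (g * s j) * N (s j)) =
      St (N (s j)) • (St (N g) • N g + St (N (g * s j)) • N (g * s j)) := by
    have hsq := congrArg St (L.N_s_sq j)
    simp only [map_mul, map_add, map_one, map_smul, smul_eq_mul] at hsq
    have aux : ∀ g, len (g * s j) = len g + 1 →
        St (N g) • (N g * N (s j)) + St (N (g * s j)) • (N (g * s j) * N (s j)) =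
        St (N (s j)) • (St (N g) • N g + St (N (g * s j)) • N (g * s j)) := by
      intro g hg
      have h1 := L.up hg
      have h2 := L.down (w := g * s j) (j := j) (by rw [L.mul_s_mul_s, hg])
      rw [L.mul_s_mul_s] at h2
      have h3 : St (N (g * s j)) = St (N g) * St (N (s j)) := by rw [← h1, map_mul]
      have h4 : St (N (s j)) * St (N (g * s j)) =
          St (N g) + St (N (g * s j)) * quadCoeff q j := by
        rw [h3]
        linear_combination St (N g) * hsq
      rw [h1, h2, smul_add (St (N (s j))), smul_smul, smul_smul, h4, h3]
      module
    intro g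
    rcases L.step g j with h | h
    · exact aux g h
    · have := aux (g * s j) (by rw [L.mul_s_mul_s, h])
      rw [L.mul_s_mul_s] at this
      rw [add_comm, this, add_comm (St (N g) • N g)]
  -- Summing over all `g` counts each pair `{g, g s}` twice. Doubling avoids a choice of coset
  -- representatives.
  have h2 : (2 : ℂ) • (L.charSum St * N (s j)) = (2 : ℂ) • St (N (s j)) • L.charSum St := by
    have e1 : L.charSum St * N (s j) = ∑ g, St (N g) • (N g * N (s j)) := by
      simp only [charSum, Finset.sum_mul, Algebra.smul_mul_assoc]
    have e2 : L.charSum St * N (s j) =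
        ∑ g, St (N (g * s j)) • (N (g * s j) * N (s j)) := by
      rw [e1]
      exact (Equiv.sum_comp (Equiv.mulRight (s j)) fun g => St (N g) • (N g * N (s j))).symm
    have e3 : L.charSum St = ∑ g, St (N (g * s j)) • N (g * s j) :=
      (Equiv.sum_comp (Equiv.mulRight (s j)) fun g => St (N g) • N g).symm
    rw [two_smul, two_smul]
    nth_rewrite 1 [e1]
    nth_rewrite 1 [e2]
    rw [← Finset.sum_add_distrib, Finset.sum_congr rfl fun g _ => key g, ← Finset.smul_sum,
      Finset.sum_add_distrib, ← e3, smul_add]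
    rfl
  exact smul_right_injective H (two_ne_zero (α := ℂ)) h2

theorem s_mul_charSum (j : J) : N (s j) * L.charSum St = St (N (s j)) • L.charSum St := by
  have key : ∀ g, St (N g) • (N (s j) * N g) + St (N (s j * g)) • (N (s j) * N (s j * g)) =
      St (N (s j)) • (St (N g) • N g + St (N (s j * g)) • N (s j * g)) := by
    have hsq := congrArg St (L.N_s_sq j)
    simp only [map_mul, map_add, map_one, map_smul, smul_eq_mul] at hsq
    have hss : ∀ g, s j * (s j * g) = g := fun g => by rw [← mul_assoc, L.mul_self, one_mul]
    have aux : ∀ g, len (s j * g) = len g + 1 →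
        St (N g) • (N (s j) * N g) + St (N (s j * g)) • (N (s j) * N (s j * g)) =
        St (N (s j)) • (St (N g) • N g + St (N (s j * g)) • N (s j * g)) := by
      intro g hg
      have h1 := L.left_up hg
      have h2 := L.left_down (g := s j * g) (j := j) (by rw [hss, hg])
      rw [hss] at h2
      have h3 : St (N (s j * g)) = St (N g) * St (N (s j)) := by rw [← h1, map_mul, mul_comm]
      have h4 : St (N (s j)) * St (N (s j * g)) =
          St (N g) + St (N (s j * g)) * quadCoeff q j := by
        rw [h3]
        linear_combination St (N g) * hsq
      rw [h1, h2, smul_add (St (N (s j))), smul_smul, smul_smul, h4, h3]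
      module
    intro g
    rcases L.left_step g j with h | h
    · exact aux g h
    · have := aux (s j * g) (by rw [hss, h])
      rw [hss] at this
      rw [add_comm, this, add_comm (St (N g) • N g)]
  have h2 : (2 : ℂ) • (N (s j) * L.charSum St) = (2 : ℂ) • St (N (s j)) • L.charSum St := by
    have e1 : N (s j) * L.charSum St = ∑ g, St (N g) • (N (s j) * N g) := by
      simp only [charSum, Finset.mul_sum, Algebra.mul_smul_comm]
    have e2 : N (s j) * L.charSum St =
        ∑ g, St (N (s j * g)) • (N (s j) * N (s j * g)) := by
      rw [e1]
      exact (Equiv.sum_comp (Equiv.mulLeft (s j)) fun g => St (N g) • (N (s j) * N g)).symm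
    have e3 : L.charSum St = ∑ g, St (N (s j * g)) • N (s j * g) :=
      (Equiv.sum_comp (Equiv.mulLeft (s j)) fun g => St (N g) • N g).symm
    rw [two_smul, two_smul]
    nth_rewrite 1 [e1]
    nth_rewrite 1 [e2]
    rw [← Finset.sum_add_distrib, Finset.sum_congr rfl fun g _ => key g, ← Finset.smul_sum,
      Finset.sum_add_distrib, ← e3, smul_add]
    rfl
  exact smul_right_injective H (two_ne_zero (α := ℂ)) h2

theorem charSum_mul (h1 : ∀ u, len u = 0 → u = 1) (h : H) :
    L.charSum St * h = St h • L.charSum St := by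
  have key : ∀ g, L.charSum St * N g = St (N g) • L.charSum St := by
    intro g
    induction g using L.induction_right with
    | h0 u hu => rw [h1 u hu, L.one, map_one, one_smul, mul_one]
    | hs g j hj ih =>
      rw [← L.up hj, ← mul_assoc, ih, Algebra.smul_mul_assoc, L.charSum_mul_s, smul_smul, map_mul]
  have hh : h ∈ Submodule.span ℂ (Set.range N) := by rw [L.span_N]; trivial
  induction hh using Submodule.span_induction with
  | mem h hh => obtain ⟨g, rfl⟩ := hh; exact key g
  | zero => simp
  | add x y _ _ hx hy => rw [mul_add, hx, hy, map_add, add_smul]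
  | smul c x _ hx => rw [Algebra.mul_smul_comm, hx, map_smul, smul_smul, smul_eq_mul]

theorem mul_charSum (h1 : ∀ u, len u = 0 → u = 1) (h : H) :
    h * L.charSum St = St h • L.charSum St := by
  have key : ∀ g, N g * L.charSum St = St (N g) • L.charSum St := by
    intro g
    induction g using L.induction_left with
    | h0 u hu => rw [h1 u hu, L.one, map_one, one_smul, one_mul]
    | hs g j hj ih =>
      rw [← L.left_up hj, mul_assoc, ih, Algebra.mul_smul_comm, L.s_mul_charSum, smul_smul,
        map_mul, mul_comm (St (N g))]
  have hh : h ∈ Submodule.span ℂ (Set.range N) := by rw [L.span_N]; trivial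
  induction hh using Submodule.span_induction with
  | mem h hh => obtain ⟨g, rfl⟩ := hh; exact key g
  | zero => simp
  | add x y _ _ hx hy => rw [add_mul, hx, hy, map_add, add_smul]
  | smul c x _ hx => rw [Algebra.smul_mul_assoc, hx, map_smul, smul_smul, smul_eq_mul]

theorem char_charSum_ne_zero (hr : ∀ g, ∃ r : ℝ, St (N g) = r) : St (L.charSum St) ≠ 0 := by
  choose r hr using hr
  have h1 : r 1 = 1 := by
    have := hr 1
    rw [L.one, map_one] at this
    exact_mod_cast this.symm
  have h2 : St (L.charSum St) = ((∑ g, r g * r g : ℝ) : ℂ) := by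
    simp only [charSum, map_sum, map_smul, smul_eq_mul, hr, Complex.ofReal_sum,
      Complex.ofReal_mul]
  rw [h2, Complex.ofReal_ne_zero]
  refine (Finset.sum_pos' (fun g _ => mul_self_nonneg _) ⟨1, Finset.mem_univ _, ?_⟩).ne'
  rw [h1]
  norm_num

end HeckeBasis

end Idempotent

/-! ### Modules over finitely generated commutative algebras -/

/-- Here `V` is `A` modulo the annihilator of `v₀`. A maximal ideal above the annihilator has
residue field `ℂ` by the Nullstellensatz, and the resulting character descends to a functional on
`V`. -/
theorem exists_character {A S V : Type*} [CommRing A] [Algebra ℂ A] [Algebra.FiniteType ℂ A]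
    [Ring S] [Algebra ℂ S] [AddCommGroup V] [Module ℂ V] [Module S V] [IsScalarTower ℂ S V]
    (τ : A →ₐ[ℂ] S) {v₀ : V} (h0 : v₀ ≠ 0) (hspan : ∀ v : V, ∃ a : A, τ a • v₀ = v) :
    ∃ (χ : A →ₐ[ℂ] ℂ) (g : V →ₗ[ℂ] ℂ), g v₀ = 1 ∧ ∀ a v, g (τ a • v) = χ a * g v := by
  let I : Ideal A :=
    { carrier := {a | τ a • v₀ = 0}
      zero_mem' := by simp
      add_mem' := fun {a c} ha hc => by
        simp only [Set.mem_ofPred_eq] at ha hc ⊢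
        rw [map_add, add_smul, ha, hc, add_zero]
      smul_mem' := fun c a ha => by
        simp only [Set.mem_ofPred_eq] at ha ⊢
        rw [smul_eq_mul, map_mul, mul_smul, ha, smul_zero] }
  have hI : I ≠ ⊤ := by
    rw [Ideal.ne_top_iff_one]
    intro h
    have : τ 1 • v₀ = 0 := h
    rw [map_one, one_smul] at this
    exact h0 this
  obtain ⟨m, hm, hIm⟩ := Ideal.exists_le_maximal I hI
  let _ : Field (A ⧸ m) := Ideal.Quotient.field m
  have : Module.Finite ℂ (A ⧸ m) := finite_of_finite_type_of_isJacobsonRing ℂ (A ⧸ m)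
  have hb := IsAlgClosed.algebraMap_bijective_of_isIntegral (k := ℂ) (K := A ⧸ m)
  let φ : ℂ ≃ₐ[ℂ] (A ⧸ m) := AlgEquiv.ofBijective (Algebra.ofId ℂ (A ⧸ m)) hb
  let χ : A →ₐ[ℂ] ℂ := φ.symm.toAlgHom.comp (Ideal.Quotient.mkₐ ℂ m)
  have hχ : ∀ a c : A, τ a • v₀ = τ c • v₀ → χ a = χ c := by
    intro a c h
    have h1 : a - c ∈ I := by
      change τ (a - c) • v₀ = 0
      rw [map_sub, sub_smul, h, sub_self]
    have h2 : Ideal.Quotient.mk m a = Ideal.Quotient.mk m c := Ideal.Quotient.eq.2 (hIm h1)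
    change φ.symm (Ideal.Quotient.mk m a) = φ.symm (Ideal.Quotient.mk m c)
    rw [h2]
  choose r hr using hspan
  refine ⟨χ, ⟨⟨fun v => χ (r v), fun v w => ?_⟩, fun c v => ?_⟩, ?_, fun a v => ?_⟩
  · rw [← map_add]
    refine hχ _ _ ?_
    rw [map_add, add_smul, hr, hr, hr]
  · rw [RingHom.id_apply, ← map_smul]
    refine hχ _ _ ?_
    rw [map_smul, smul_assoc, hr, hr]
  · have := hχ (r v₀) 1 (by rw [hr, map_one, one_smul])
    rw [map_one] at this
    exact this
  · change χ (r (τ a • v)) = χ a * χ (r v)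
    rw [← map_mul]
    refine hχ _ _ ?_
    rw [map_mul, mul_smul, hr, hr]

/-- If `S F = A F` for a commutative finitely generated subalgebra `A` of `S`, then `F` has rank at
most one on all simple `S`-modules. -/
theorem exists_smul_eq_of_isSimpleModule {A S V : Type*} [CommRing A] [Algebra ℂ A]
    [Algebra.FiniteType ℂ A] [Ring S] [Algebra ℂ S] [AddCommGroup V] [Module ℂ V] [Module S V]
    [IsScalarTower ℂ S V] [IsSimpleModule S V] (τ : A →ₐ[ℂ] S) {F : S}
    (hF : F * F = F) (hS : ∀ y, ∃ a, y * F = τ a * F) {v₀ : V} (h0 : v₀ ≠ 0) (hv : F • v₀ = v₀)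
    (w : V) : ∃ c : ℂ, F • w = c • v₀ := by
  have hgen : ∀ u : V, u ≠ 0 → F • u = u → ∀ v, ∃ a : A, τ a • u = v := by
    intro u hu hFu v
    obtain ⟨y, rfl⟩ := (IsSimpleModule.toSpanSingleton_surjective S hu) v
    obtain ⟨a, ha⟩ := hS y
    refine ⟨a, ?_⟩
    rw [LinearMap.toSpanSingleton_apply, ← hFu, ← mul_smul, ← mul_smul, ha]
  obtain ⟨χ, g, hg, hχ⟩ := exists_character τ h0 (hgen v₀ h0 hv)
  -- This scalar puts `F w - c v₀` in the kernel of `g`. If that vector were nonzero it would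
  -- generate `V` over `A`, although the kernel is `A`-stable and misses `v₀`.
  refine ⟨g (F • w), ?_⟩
  by_contra hne
  have hu : F • w - g (F • w) • v₀ ≠ 0 := sub_ne_zero.2 hne
  obtain ⟨a, ha⟩ := hgen _ hu (by
    rw [smul_sub, ← mul_smul, hF, ← algebraMap_smul S (g (F • w)) v₀, ← mul_smul,
      ← Algebra.commutes, mul_smul, hv]) v₀
  have h1 := hχ a (F • w - g (F • w) • v₀)
  rw [ha, hg, map_sub, g.map_smul, hg] at h1
  simp at h1

/-! ### Subquotients on which an idempotent has rank one -/

section Subquotients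

variable {H M : Type*} [Ring H] [Algebra ℂ H] [AddCommGroup M] [Module H M]
  {E : H} {m₀ : M} (h0 : m₀ ≠ 0) (hm : E • m₀ = m₀)
  (hM : ∀ m : M, ∃ c : ℂ, E • m = algebraMap ℂ H c • m₀)

/-- The elements of `H m₀` that do not generate `m₀`, for `E` of rank one with image spanned by
`m₀`. -/
def genericRadical (E : H) (m₀ : M) : Submodule H M where
  carrier := {n | n ∈ Submodule.span H {m₀} ∧ ∀ h : H, E • h • n = 0}
  zero_mem' := ⟨zero_mem _, by simp⟩
  add_mem' := fun {x y} hx hy => ⟨add_mem hx.1 hy.1, fun h => by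
    rw [smul_add, smul_add, hx.2, hy.2, add_zero]⟩
  smul_mem' := fun c x hx => ⟨Submodule.smul_mem _ c hx.1, fun h => by
    rw [← mul_smul h c x, hx.2]⟩

omit [Algebra ℂ H] in
theorem genericRadical_le : genericRadical E m₀ ≤ Submodule.span H {m₀} := fun _ h => h.1

omit [Algebra ℂ H] in
include h0 hm in
theorem notMem_genericRadical : m₀ ∉ genericRadical E m₀ := fun h => by
  have := h.2 1
  rw [one_smul, hm] at this
  exact h0 this

include hM in
theorem mem_of_smul_ne_zero {B : Submodule H M} {n : M} (hn : n ∈ B) (h : E • n ≠ 0) :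
    m₀ ∈ B := by
  obtain ⟨c, hc⟩ := hM n
  have hc0 : c ≠ 0 := by
    rintro rfl
    rw [map_zero, zero_smul] at hc
    exact h hc
  have h1 : m₀ = algebraMap ℂ H c⁻¹ • E • n := by
    rw [hc, ← mul_smul, ← map_mul, inv_mul_cancel₀ hc0, map_one, one_smul]
  rw [h1]
  exact B.smul_mem _ (B.smul_mem _ hn)

include hM in
theorem smul_eq_zero_of_notMem {B : Submodule H M} {n : M} (hn : n ∈ B) (h : m₀ ∉ B) :
    E • n = 0 := by
  by_contra hne
  exact h (mem_of_smul_ne_zero hM hn hne)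

-- A submodule of `H m₀` strictly above the radical has an element on which some `E h` is nonzero.
-- By rank one it contains `m₀`, hence everything.
include h0 hm hM in
theorem isSimpleModule_subquot :
    IsSimpleModule H (Subquot (genericRadical E m₀) (Submodule.span H {m₀})) := by
  rw [isSimpleModule_iff_isCoatom]
  constructor
  · intro h
    have h1 : (⟨m₀, Submodule.mem_span_singleton_self m₀⟩ : Submodule.span H {m₀}) ∈
        (genericRadical E m₀).submoduleOf (Submodule.span H {m₀}) := by rw [h]; trivial
    exact notMem_genericRadical h0 hm h1
  · intro C hC
    obtain ⟨x, hx, hxA⟩ := SetLike.exists_of_lt hC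
    have h1 : ∃ h : H, E • h • (x : M) ≠ 0 := by
      by_contra hc
      push Not at hc
      exact hxA ⟨x.2, hc⟩
    obtain ⟨h, hh⟩ := h1
    have h2 : m₀ ∈ C.map (Submodule.span H {m₀}).subtype :=
      mem_of_smul_ne_zero hM (Submodule.smul_mem _ h ⟨x, hx, rfl⟩) hh
    refine top_unique ?_
    obtain ⟨y, hy, hy2⟩ := h2
    rintro ⟨z, hz⟩ -
    obtain ⟨k, rfl⟩ := Submodule.mem_span_singleton.1 hz
    have : (⟨k • m₀, hz⟩ : Submodule.span H {m₀}) = k • y := by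
      ext
      change k • m₀ = k • (y : M)
      exact congrArg (k • ·) hy2.symm
    rw [this]
    exact C.smul_mem k hy

omit [Algebra ℂ H] in
include h0 hm in
theorem exists_smul_subquot_ne_zero :
    ∃ x : Subquot (genericRadical E m₀) (Submodule.span H {m₀}), E • x ≠ 0 := by
  refine ⟨Submodule.Quotient.mk ⟨m₀, Submodule.mem_span_singleton_self m₀⟩, ?_⟩
  rw [← Submodule.Quotient.mk_smul, Ne, Submodule.Quotient.mk_eq_zero]
  intro h
  have h1 : E • m₀ ∈ genericRadical E m₀ := h
  rw [hm] at h1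
  exact notMem_genericRadical h0 hm h1

include hM in
theorem mem_and_notMem_of_smul_ne_zero {A' B' : Submodule H M}
    (h : ∃ x : Subquot A' B', E • x ≠ 0) : m₀ ∈ B' ∧ m₀ ∉ A' := by
  obtain ⟨x, hx⟩ := h
  obtain ⟨⟨n, hn⟩, rfl⟩ := Submodule.Quotient.mk_surjective _ x
  rw [← Submodule.Quotient.mk_smul, Ne, Submodule.Quotient.mk_eq_zero] at hx
  replace hx : E • n ∉ A' := hx
  have h1 : E • n ≠ 0 := fun h => hx (by rw [h]; exact zero_mem _)
  refine ⟨mem_of_smul_ne_zero hM hn h1, fun h2 => hx ?_⟩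
  obtain ⟨c, hc⟩ := hM n
  rw [hc]
  exact A'.smul_mem _ h2

-- Since `m₀` lies in `B'` but not in `A'`, the map `H m₀ → B'/A'` is nonzero, hence onto by
-- simplicity. Its kernel is the radical.
include h0 hm hM in
theorem nonempty_equiv_subquot {A' B' : Submodule H M} [IsSimpleModule H (Subquot A' B')]
    (h : ∃ x : Subquot A' B', E • x ≠ 0) :
    Nonempty (Subquot A' B' ≃ₗ[H] Subquot (genericRadical E m₀) (Submodule.span H {m₀})) := by
  obtain ⟨hB, hA⟩ := mem_and_notMem_of_smul_ne_zero hM h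
  have hle : Submodule.span H {m₀} ≤ B' := (Submodule.span_singleton_le_iff_mem _ _).2 hB
  let f : Submodule.span H {m₀} →ₗ[H] Subquot A' B' :=
    (Submodule.mkQ _).comp (Submodule.inclusion hle)
  have hf : ∀ x, f x = 0 ↔ (x : M) ∈ A' := fun x => Submodule.Quotient.mk_eq_zero _
  have hker : LinearMap.ker f =
      (genericRadical E m₀).submoduleOf (Submodule.span H {m₀}) := by
    ext x
    rw [LinearMap.mem_ker, hf]
    constructor
    · intro hx
      exact ⟨x.2, fun k => smul_eq_zero_of_notMem hM (A'.smul_mem k hx) hA⟩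
    · intro hx
      -- Otherwise simplicity gives `k` with `k x - m₀ ∈ A'`. Now `E` kills this difference, because
      -- `m₀ ∉ A'`, and it kills `k x`, because `x` is in the radical. So `m₀ = E m₀` would vanish.
      by_contra hxA
      have hne : f x ≠ 0 := fun h => hxA ((hf x).1 h)
      obtain ⟨k, hk⟩ := IsSimpleModule.toSpanSingleton_surjective H hne
        (f ⟨m₀, Submodule.mem_span_singleton_self m₀⟩)
      rw [LinearMap.toSpanSingleton_apply, ← map_smul, ← sub_eq_zero, ← map_sub, hf] at hk
      have h1 : E • (k • (x : M) - m₀) = 0 := smul_eq_zero_of_notMem hM hk hA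
      have h2 : E • k • (x : M) = 0 := hx.2 k
      rw [smul_sub, h2, zero_sub, neg_eq_zero, hm] at h1
      exact h0 h1
  have hsurj : Function.Surjective f := by
    refine (LinearMap.surjective_or_eq_zero f).resolve_right fun hz => hA ?_
    rw [← hf ⟨m₀, Submodule.mem_span_singleton_self m₀⟩, hz]
    rfl
  exact ⟨((Submodule.quotEquivOfEq _ _ hker.symm).trans
    (f.quotKerEquivOfSurjective hsurj)).symm⟩

-- A step of a chain isomorphic to this subquotient must be one at which `m₀` enters, and there is
-- at most one such step. The two-term chain from the radical to `H m₀` attains the value 1.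
include h0 hm hM in
theorem simpleMult_subquot :
    simpleMult H (Subquot (genericRadical E m₀) (Submodule.span H {m₀})) M = 1 := by
  have hgen : ∀ {A' B' : Submodule H M},
      Nonempty (Subquot A' B' ≃ₗ[H] Subquot (genericRadical E m₀) (Submodule.span H {m₀})) →
      m₀ ∈ B' ∧ m₀ ∉ A' := by
    rintro A' B' ⟨φ⟩
    refine mem_and_notMem_of_smul_ne_zero hM ?_
    obtain ⟨x, hx⟩ := exists_smul_subquot_ne_zero (E := E) h0 hm
    refine ⟨φ.symm x, fun h => hx ?_⟩
    rw [← map_smul, LinearEquiv.map_eq_zero_iff] at h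
    exact h
  refine le_antisymm (iSup_le fun c => ?_) ?_
  · have : Subsingleton {i : Fin c.length // Nonempty (Subquot (c i.castSucc) (c i.succ) ≃ₗ[H]
        Subquot (genericRadical E m₀) (Submodule.span H {m₀}))} := by
      refine ⟨?_⟩
      rintro ⟨i, hi⟩ ⟨j, hj⟩
      have h1 := hgen hi
      have h2 := hgen hj
      refine Subtype.ext ?_
      by_contra hne
      rcases lt_or_gt_of_ne hne with hlt | hlt
      · exact h2.2 (c.monotone (Fin.succ_le_castSucc_iff.2 hlt) h1.1)
      · exact h1.2 (c.monotone (Fin.succ_le_castSucc_iff.2 hlt) h2.1)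
    have h1 := Finite.card_le_one_iff_subsingleton.2 this
    exact_mod_cast h1
  · have hlt : genericRadical E m₀ < Submodule.span H {m₀} :=
      lt_of_le_of_ne genericRadical_le fun h => notMem_genericRadical h0 hm (by
        rw [h]; exact Submodule.mem_span_singleton_self m₀)
    have key : ∀ (c : LTSeries (Submodule H M)) (i : Fin c.length),
        c i.castSucc = genericRadical E m₀ → c i.succ = Submodule.span H {m₀} →
        1 ≤ Nat.card {i : Fin c.length // Nonempty (Subquot (c i.castSucc) (c i.succ) ≃ₗ[H]
          Subquot (genericRadical E m₀) (Submodule.span H {m₀}))} := by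
      intro c i h1 h2
      have : Nonempty {i : Fin c.length // Nonempty (Subquot (c i.castSucc) (c i.succ) ≃ₗ[H]
          Subquot (genericRadical E m₀) (Submodule.span H {m₀}))} :=
        ⟨⟨i, by rw [h1, h2]; exact ⟨LinearEquiv.refl _ _⟩⟩⟩
      exact Finite.card_pos
    let c : LTSeries (Submodule H M) :=
      { length := 1
        toFun := ![genericRadical E m₀, Submodule.span H {m₀}]
        step := fun i => by
          rw [Subsingleton.elim i 0]
          exact hlt }
    refine le_trans ?_ (le_iSup _ c)
    have h1 := key c (0 : Fin 1) rfl rfl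
    exact_mod_cast h1

end Subquotients

section Generic

variable {ι X Y : Type*} [AddCommGroup X] [AddCommGroup Y] [Finite ι] {𝓡 : RootDatum ι X Y}
  (b : 𝓡.Base) (p : Params 𝓡) (Q : Set b.support)

/-! ### The idempotent of the Steinberg representation -/

theorem finHeckeBasis : HeckeBasis (finLen b Q) (finS b Q) (finQ b p Q) (finN b p Q) :=
  (finLengthSystem b p Q).heckeBasis

omit [Finite ι] in
theorem stChar_mem_range (w : 𝓡.weylGroup) : ∃ r : ℝ, stChar b p w = r := by
  refine finprod_mem_induction (fun z : ℂ => ∃ r : ℝ, z = r) ⟨1, by simp⟩ ?_ ?_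
  · rintro _ _ ⟨r, rfl⟩ ⟨t, rfl⟩
    exact ⟨r * t, by simp⟩
  · exact fun i _ => ⟨-((p.q ^ p.lam i) ^ (-(1 / 2) : ℝ)), by simp [stVal]⟩

theorem steinberg_finN (w : WPar b Q) : steinberg b p Q (finN b p Q w) = stChar b p w := by
  simp [steinberg, IwahoriHecke.N]

instance finite_WPar : Finite (WPar b Q) :=
  have := finite_weylGroup b
  inferInstance

/-- The idempotent of the Steinberg representation of `ℋ(W_Q, q^λ)`. -/
def stIdem : FinHecke b p Q :=
  letI := Fintype.ofFinite (WPar b Q)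
  (steinberg b p Q ((finHeckeBasis b p Q).charSum (steinberg b p Q)))⁻¹ •
    (finHeckeBasis b p Q).charSum (steinberg b p Q)

theorem finLen_eq_zero {u : WPar b Q} (hu : finLen b Q u = 0) : u = 1 :=
  Subtype.ext (eq_one_of_len_inr_eq_zero b hu)

theorem mul_stIdem (h : FinHecke b p Q) :
    h * stIdem b p Q = steinberg b p Q h • stIdem b p Q := by
  let _ := Fintype.ofFinite (WPar b Q)
  rw [stIdem, Algebra.mul_smul_comm,
    (finHeckeBasis b p Q).mul_charSum _ fun u => finLen_eq_zero b Q, smul_comm]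

theorem stIdem_mul (h : FinHecke b p Q) :
    stIdem b p Q * h = steinberg b p Q h • stIdem b p Q := by
  let _ := Fintype.ofFinite (WPar b Q)
  rw [stIdem, Algebra.smul_mul_assoc,
    (finHeckeBasis b p Q).charSum_mul _ fun u => finLen_eq_zero b Q, smul_comm]

theorem steinberg_charSum_ne_zero [Fintype (WPar b Q)] :
    steinberg b p Q ((finHeckeBasis b p Q).charSum (steinberg b p Q)) ≠ 0 :=
  (finHeckeBasis b p Q).char_charSum_ne_zero _ fun g => by
    rw [steinberg_finN]; exact stChar_mem_range b p _

theorem steinberg_stIdem : steinberg b p Q (stIdem b p Q) = 1 := by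
  let _ := Fintype.ofFinite (WPar b Q)
  rw [stIdem, map_smul, smul_eq_mul, inv_mul_cancel₀ (steinberg_charSum_ne_zero b p Q)]

theorem exists_stIdem_eq_sum [Fintype (WPar b Q)] :
    ∃ c : WPar b Q → ℂ, c 1 ≠ 0 ∧ stIdem b p Q = ∑ w, c w • finN b p Q w := by
  have hf : Fintype.ofFinite (WPar b Q) = ‹_› := Subsingleton.elim _ _
  refine ⟨fun w => (steinberg b p Q ((finHeckeBasis b p Q).charSum (steinberg b p Q)))⁻¹ *
    steinberg b p Q (finN b p Q w), ?_, ?_⟩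
  · refine mul_ne_zero (inv_ne_zero (steinberg_charSum_ne_zero b p Q)) ?_
    rw [steinberg_finN, Subgroup.coe_one, stChar_one]
    exact one_ne_zero
  · rw [stIdem, hf]
    nth_rewrite 2 [HeckeBasis.charSum]
    rw [Finset.smul_sum]
    simp only [smul_smul]

/-- The image of the idempotent is the `St`-isotypic part of the module. -/
theorem containsSt_iff {A : Type*} [Ring A] [Algebra ℂ A] (φ : FinHecke b p Q →ₐ[ℂ] A)
    (V : Type*) [AddCommGroup V] [Module A V] :
    ContainsSt b p Q φ V ↔ ∃ v : V, φ (stIdem b p Q) • v ≠ 0 := by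
  constructor
  · rintro ⟨v, hv, h⟩
    refine ⟨v, ?_⟩
    rwa [h, steinberg_stIdem, map_one, one_smul]
  · rintro ⟨v, hv⟩
    refine ⟨_, hv, fun h => ?_⟩
    rw [← mul_smul, ← map_mul, mul_stIdem, map_smul, Algebra.smul_def, mul_smul]

/-- The image in `ℋ` of the idempotent of the Steinberg representation of `ℋ(W_Q, q^λ)`. -/
def stProj : Hecke b p := finToHecke b p Q (stIdem b p Q)

theorem stProj_mul_self : stProj b p Q * stProj b p Q = stProj b p Q := by
  rw [stProj, ← map_mul, mul_stIdem, steinberg_stIdem, one_smul]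

theorem mem_homSt_iff {M : Type*} [AddCommGroup M] [Module ℂ M] [Module (Hecke b p) M]
    [IsScalarTower ℂ (Hecke b p) M] (f : Module.Dual ℂ M) :
    f ∈ homSt b p M ↔ ∀ m, f (stProj b p Set.univ • m) = f m := by
  constructor
  · intro hf m
    have := hf (stIdem b p Set.univ) m
    rwa [steinberg_stIdem, one_mul] at this
  · intro hf h m
    rw [← hf, ← mul_smul, stProj, ← map_mul, stIdem_mul, map_smul (finToHecke b p _), smul_assoc, f.map_smul,
      smul_eq_mul]
    congr 1
    exact hf m

/-! ### The structure of parabolic subalgebras -/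

theorem isTheta_iff (x : X) (h : Hecke b p) :
    IsTheta b p x h ↔ h = (heckeBasis b p).theta x := by
  constructor
  · rintro ⟨x₁, x₂, h1, h2, rfl, u, hu, rfl⟩
    have : u = (heckeBasis b p).U (trans 𝓡 x₂) := Units.ext hu
    rw [(heckeBasis b p).theta_sub h1 h2, this]
    rfl
  · rintro rfl
    obtain ⟨x₁, x₂, h1, h2, rfl⟩ := HeckeBasis.exists_dominant_sub b x
    refine ⟨x₁, x₂, h1, h2, rfl, (heckeBasis b p).U (trans 𝓡 x₂), rfl, ?_⟩
    rw [(heckeBasis b p).theta_sub h1 h2]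
    rfl

theorem theta_mem_heckePar (x : X) :
    ((heckeBasis b p).theta x : Hecke b p) ∈ heckePar b p Q :=
  Algebra.subset_adjoin (Or.inl ⟨x, (isTheta_iff b p x _).2 rfl⟩)

theorem heckePar_le : heckePar b p Q ≤ (heckeBasis b p).parAlgebra Q := by
  have h1 : {h | ∃ x : X, IsTheta b p x h} =
      {h : Hecke b p | ∃ x : X, h = ((heckeBasis b p).theta x : Hecke b p)} := by
    simp only [isTheta_iff]
  rw [heckePar, h1]
  exact (heckeBasis b p).adjoin_le_parAlgebra

/-- The span of the `θ_x`, as the image of the group algebra of `X`. -/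
def thetaHom : AddMonoidAlgebra ℂ X →ₐ[ℂ] heckePar b p Q :=
  AddMonoidAlgebra.lift ℂ _ X
    { toFun := fun x => ⟨(heckeBasis b p).theta x.toAdd, theta_mem_heckePar b p Q _⟩
      map_one' := Subtype.ext (congrArg Units.val (heckeBasis b p).theta_zero)
      map_mul' := fun x y => Subtype.ext
        (congrArg Units.val ((heckeBasis b p).theta_add x.toAdd y.toAdd)) }

theorem thetaHom_single (x : X) : (thetaHom b p Q (AddMonoidAlgebra.single x 1) : Hecke b p) =
    (heckeBasis b p).theta x := by
  simp [thetaHom]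

theorem exists_thetaHom_eq {a : Hecke b p} (ha : a ∈ (heckeBasis b p).thetaSpan) :
    ∃ t, (thetaHom b p Q t : Hecke b p) = a := by
  induction ha using Submodule.span_induction with
  | mem a ha =>
    obtain ⟨x, rfl⟩ := ha
    exact ⟨_, thetaHom_single b p Q x⟩
  | zero => exact ⟨0, by rw [map_zero]; rfl⟩
  | add x y _ _ hx hy =>
    obtain ⟨t, rfl⟩ := hx
    obtain ⟨u, rfl⟩ := hy
    exact ⟨t + u, by rw [map_add]; rfl⟩
  | smul c x _ hx =>
    obtain ⟨t, rfl⟩ := hx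
    exact ⟨c • t, by rw [map_smul]; rfl⟩

/-- The same scalar serves for both idempotents since the Steinberg character of `W` restricts to
that of `W_Q`. This is what links the idempotent of `W` to that of `W_Q`. -/
theorem exists_stProj_mul_eq {x : Hecke b p} (hx : x ∈ (heckeBasis b p).parSpan Q) :
    ∃ c : ℂ, stProj b p Q * x = c • stProj b p Q ∧
      stProj b p Set.univ * x = c • stProj b p Set.univ ∧ x * stProj b p Q = c • stProj b p Q := by
  induction hx using Submodule.span_induction with
  | mem x hx =>
    obtain ⟨w, hw, rfl⟩ := hx
    refine ⟨stChar b p w, ?_, ?_, ?_⟩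
    · have := congrArg (finToHecke b p Q) (stIdem_mul b p Q (finN b p Q ⟨w, hw⟩))
      rwa [map_mul, finToHecke_N, map_smul, steinberg_finN] at this
    · have h1 : w ∈ WPar b Set.univ := by rw [WPar_univ]; trivial
      have := congrArg (finToHecke b p Set.univ) (stIdem_mul b p _ (finN b p Set.univ ⟨w, h1⟩))
      rwa [map_mul, finToHecke_N, map_smul, steinberg_finN] at this
    · have := congrArg (finToHecke b p Q) (mul_stIdem b p Q (finN b p Q ⟨w, hw⟩))
      rwa [map_mul, finToHecke_N, map_smul, steinberg_finN] at this
  | zero => exact ⟨0, by simp⟩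
  | add x y _ _ hx hy =>
    obtain ⟨c, h1, h2, h3⟩ := hx
    obtain ⟨d, h4, h5, h6⟩ := hy
    exact ⟨c + d, by rw [mul_add, h1, h4, add_smul], by rw [mul_add, h2, h5, add_smul],
      by rw [add_mul, h3, h6, add_smul]⟩
  | smul a x _ hx =>
    obtain ⟨c, h1, h2, h3⟩ := hx
    exact ⟨a * c, by rw [Algebra.mul_smul_comm, h1, smul_smul],
      by rw [Algebra.mul_smul_comm, h2, smul_smul],
      by rw [Algebra.smul_mul_assoc, h3, smul_smul]⟩

theorem stProj_mem_parSpan : stProj b p Q ∈ (heckeBasis b p).parSpan Q := by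
  have := Fintype.ofFinite (WPar b Q)
  obtain ⟨c, -, hc⟩ := exists_stIdem_eq_sum b p Q
  rw [stProj, hc, map_sum]
  refine sum_mem fun w _ => ?_
  rw [map_smul, finToHecke_N]
  exact Submodule.smul_mem _ _ ((heckeBasis b p).N_mem_parSpan w.2)

theorem exists_mul_finToPar_stIdem (y : heckePar b p Q) :
    ∃ t, y * finToPar b p Q (stIdem b p Q) =
      thetaHom b p Q t * finToPar b p Q (stIdem b p Q) := by
  have hy : (y : Hecke b p) ∈ (heckeBasis b p).thetaSpan * (heckeBasis b p).parSpan Q :=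
    heckePar_le b p Q y.2
  have key : ∃ t, (y : Hecke b p) * stProj b p Q =
      (thetaHom b p Q t : Hecke b p) * stProj b p Q := by
    refine Submodule.mul_induction_on hy (fun a ha k hk => ?_) (fun x z hx hz => ?_)
    · obtain ⟨t, rfl⟩ := exists_thetaHom_eq b p Q ha
      obtain ⟨c, -, -, hc⟩ := exists_stProj_mul_eq b p Q hk
      refine ⟨c • t, ?_⟩
      rw [mul_assoc, hc, map_smul, Algebra.mul_smul_comm, Subalgebra.coe_smul,
        Algebra.smul_mul_assoc]
    · obtain ⟨t, ht⟩ := hx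
      obtain ⟨u, hu⟩ := hz
      exact ⟨t + u, by rw [add_mul, ht, hu, map_add, Subalgebra.coe_add, add_mul]⟩
  obtain ⟨t, ht⟩ := key
  exact ⟨t, Subtype.ext ht⟩

theorem linearIndependent_stProj_mul_theta : LinearIndependent ℂ fun x : X =>
    stProj b p Q * ((heckeBasis b p).theta x : Hecke b p) := by
  have := Fintype.ofFinite (WPar b Q)
  obtain ⟨c, hc, h1⟩ := exists_stIdem_eq_sum b p Q
  have := (heckeBasis b p).linearIndependent_mul_theta (fun w : WPar b Q => (w : 𝓡.weylGroup))
    Subtype.val_injective c 1 rfl hc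
  have h2 : stProj b p Q = ∑ w, c w • heckeN b p (SemidirectProduct.inr w.1) := by
    rw [stProj, h1, map_sum]
    simp only [map_smul, finToHecke_N]
  rwa [h2]

/-- The product is a multiple of the larger idempotent, with the same scalar as in `e_Q e_Q = c
e_Q`; since `e_Q ≠ 0`, that scalar is 1. -/
theorem stProj_univ_mul_stProj :
    stProj b p Set.univ * stProj b p Q = stProj b p Set.univ := by
  have h0 : stProj b p Q ≠ 0 := left_ne_zero_of_mul
    ((linearIndependent_stProj_mul_theta b p Q).ne_zero 0)
  obtain ⟨c, h1, h2, -⟩ := exists_stProj_mul_eq b p Q (stProj_mem_parSpan b p Q)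
  rw [stProj_mul_self] at h1
  have hc : c = 1 := smul_left_injective ℂ h0 (by simpa using h1.symm)
  rw [h2, hc, one_smul]

/-- The projection of `ℋ` to the span of the `θ_x` along the left annihilator of the idempotent of
the Steinberg representation. -/
theorem exists_thetaPart : ∃ Φ : Hecke b p →ₗ[ℂ] heckePar b p Q,
    (∀ h, stProj b p Set.univ * h = stProj b p Set.univ * Φ h) ∧
    (∀ h h', stProj b p Set.univ * h = stProj b p Set.univ * h' → Φ h = Φ h') ∧
    Φ 1 = 1 ∧ ∀ y ∈ heckePar b p Q, stProj b p Q * y = stProj b p Q * Φ y := by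
  set E := stProj b p Set.univ with hE
  have hli := linearIndependent_stProj_mul_theta b p Set.univ
  -- The map `R` reads off coefficients with respect to the independent elements `e θ_x`. It is an
  -- arbitrary extension from their span, which is all of `e ℋ`.
  obtain ⟨R, hR⟩ := LinearMap.exists_leftInverse_of_injective
    (Finsupp.linearCombination ℂ fun x : X => E * ((heckeBasis b p).theta x : Hecke b p))
    (LinearMap.ker_eq_bot.2 hli)
  let T : (X →₀ ℂ) →ₗ[ℂ] heckePar b p Q := Finsupp.linearCombination ℂ fun x =>
    ⟨(heckeBasis b p).theta x, theta_mem_heckePar b p Q x⟩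
  let Φ := T.comp (R.comp (LinearMap.mulLeft ℂ E))
  have hcongr : ∀ h h', E * h = E * h' → Φ h = Φ h' := fun h h' hh =>
    congrArg (fun z => T (R z)) hh
  have hθ : ∀ a ∈ (heckeBasis b p).thetaSpan, (Φ a : Hecke b p) = a := by
    intro a ha
    induction ha using Submodule.span_induction with
    | mem a ha =>
      obtain ⟨x, rfl⟩ := ha
      have h1 := LinearMap.congr_fun hR (Finsupp.single x 1)
      rw [LinearMap.comp_apply, Finsupp.linearCombination_single, one_smul] at h1
      change ((T (R (E * _)) : heckePar b p Q) : Hecke b p) = _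
      rw [h1, LinearMap.id_apply, Finsupp.linearCombination_single, one_smul]
    | zero => rw [map_zero]; rfl
    | add x y _ _ hx hy => rw [map_add, Subalgebra.coe_add, hx, hy]
    | smul c x _ hx => rw [map_smul, Subalgebra.coe_smul, hx]
  have hmul : ∀ k a (c : ℂ), a ∈ (heckeBasis b p).thetaSpan → E * k = c • E →
      (Φ (k * a) : Hecke b p) = c • a := by
    intro k a c ha hk
    have : Φ (k * a) = Φ (c • a) := hcongr _ _ (by
      rw [← mul_assoc, hk, Algebra.smul_mul_assoc, Algebra.mul_smul_comm])
    rw [this, map_smul, Subalgebra.coe_smul, hθ a ha]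
  refine ⟨Φ, fun h => ?_, hcongr, Subtype.ext (hθ 1 (heckeBasis b p).one_mem_thetaSpan),
    fun y hy => ?_⟩
  · refine Submodule.mul_induction_on ((heckeBasis b p).mem_parSpan_mul_thetaSpan h)
      (fun k hk a ha => ?_) (fun x z hx hz => ?_)
    · obtain ⟨c, -, hc, -⟩ := exists_stProj_mul_eq b p _ hk
      rw [hmul k a c ha hc, ← mul_assoc, hc, Algebra.smul_mul_assoc, Algebra.mul_smul_comm]
    · rw [mul_add, hx, hz, map_add, Subalgebra.coe_add, mul_add]
  -- For `y = k a` with `k` in the span of `W_Q`, the scalar by which `k` acts on `e` also gives its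
  -- action on `e_Q`. So the `𝒜`-part of `y` is correct for the smaller idempotent too.
  · refine Submodule.mul_induction_on
      ((heckeBasis b p).thetaSpan_mul_parSpan (heckePar_le b p Q hy))
      (fun k hk a ha => ?_) (fun x z hx hz => ?_)
    · obtain ⟨c, hc, hc', -⟩ := exists_stProj_mul_eq b p _ hk
      rw [hmul k a c ha hc', ← mul_assoc, hc, Algebra.smul_mul_assoc, Algebra.mul_smul_comm]
    · rw [mul_add, hx, hz, map_add, Subalgebra.coe_add, mul_add]

end Generic

section Induction

variable {ι X Y : Type*} [AddCommGroup X] [AddCommGroup Y] [Finite ι] {𝓡 : RootDatum ι X Y}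
  (b : 𝓡.Base) (p : Params 𝓡) (Q : Set b.support)
  {V : Type*} [AddCommGroup V] [Module ℂ V] [Module (heckePar b p Q) V]

/-! ### Parabolic induction and the Steinberg representation -/

/-- The class of `h ⊗ v` in the induced module. -/
def indMk (h : Hecke b p) (v : V) : Ind b p Q V :=
  Submodule.Quotient.mk (h ⊗ₜ[ℂ] v)

omit [Finite ι] in
theorem indMk_mul (h : Hecke b p) (a : heckePar b p Q) (v : V) :
    indMk b p Q (h * a) v = indMk b p Q h (a • v) :=
  (Submodule.Quotient.eq _).2 (Submodule.subset_span ⟨h, a, v, rfl⟩)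

omit [Finite ι] in
theorem smul_indMk (g h : Hecke b p) (v : V) :
    g • indMk b p Q h v = indMk b p Q (g * h) v := by
  rw [indMk, ← Submodule.Quotient.mk_smul, TensorProduct.smul_tmul', smul_eq_mul, indMk]

omit [Finite ι] in
theorem indMk_add (h : Hecke b p) (v w : V) :
    indMk b p Q h (v + w) = indMk b p Q h v + indMk b p Q h w := by
  rw [indMk, TensorProduct.tmul_add]
  rfl

omit [Finite ι] in
theorem indMk_zero (h : Hecke b p) : indMk b p Q h (0 : V) = 0 := by
  rw [indMk, TensorProduct.tmul_zero]
  rfl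

omit [Finite ι] in
theorem indMk_smul (h : Hecke b p) (c : ℂ) (v : V) :
    indMk b p Q h (c • v) = c • indMk b p Q h v := by
  rw [indMk, TensorProduct.tmul_smul]
  rfl

/-- The idempotent of the Steinberg representation, in the parabolic subalgebra. -/
def stPar : heckePar b p Q := finToPar b p Q (stIdem b p Q)

theorem stPar_mul_self : stPar b p Q * stPar b p Q = stPar b p Q :=
  Subtype.ext (stProj_mul_self b p Q)

theorem indMk_stProj (v : V) : indMk b p Q (stProj b p Set.univ) (stPar b p Q • v) =
    indMk b p Q (stProj b p Set.univ) v := by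
  rw [← indMk_mul]
  congr 1
  exact stProj_univ_mul_stProj b p Q

/-- From `e h = e Φ(h)`, with `Φ(h)` in the parabolic subalgebra, one gets `e h ⊗ v = e ⊗ Φ(h) v`.
Then `e e_Q = e` inserts the smaller idempotent. -/
theorem exists_stProj_smul_eq (m : Ind b p Q V) :
    ∃ v : V, stProj b p Set.univ • m = indMk b p Q (stProj b p Set.univ) (stPar b p Q • v) := by
  obtain ⟨t, rfl⟩ := Submodule.Quotient.mk_surjective _ m
  induction t using TensorProduct.induction_on with
  | zero => exact ⟨0, by rw [Submodule.Quotient.mk_zero, smul_zero, smul_zero, indMk_zero]⟩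
  | tmul h v =>
    obtain ⟨Φ, hΦ, -⟩ := exists_thetaPart b p Q
    refine ⟨Φ h • v, ?_⟩
    rw [indMk_stProj, ← indMk_mul, ← hΦ]
    exact smul_indMk b p Q _ h v
  | add x y hx hy =>
    obtain ⟨v, hv⟩ := hx
    obtain ⟨w, hw⟩ := hy
    exact ⟨v + w, by rw [Submodule.Quotient.mk_add, smul_add, hv, hw, smul_add, indMk_add]⟩

variable [IsScalarTower ℂ (heckePar b p Q) V]

/-- Functionals of type `St` on `V` extend to functionals of type `St` on the induced module. -/
theorem exists_functional_ind (f : Module.Dual ℂ V) (hf : ∀ v, f (stPar b p Q • v) = f v) :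
    ∃ F ∈ homSt b p (Ind b p Q V), ∀ v, F (indMk b p Q 1 v) = f v := by
  obtain ⟨Φ, h1, h2, h3, h4⟩ := exists_thetaPart b p Q
  -- The functional sees only the `e_Q`-part of a vector, and on it `y` and `Φ(y)` act alike.
  have hΦ : ∀ (y : heckePar b p Q) (v : V), f (Φ y • v) = f (y • v) := by
    intro y v
    have h5 : stPar b p Q * y = stPar b p Q * Φ y := Subtype.ext (h4 y y.2)
    rw [← hf (y • v), ← mul_smul, h5, mul_smul, hf]
  let F₀ : Hecke b p ⊗[ℂ] V →ₗ[ℂ] ℂ := TensorProduct.lift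
    (LinearMap.mk₂ ℂ (fun h v => f (Φ h • v))
      (fun h h' v => by rw [map_add, add_smul, map_add])
      (fun c h v => by rw [Φ.map_smul, smul_assoc, f.map_smul])
      (fun h v w => by rw [smul_add, map_add])
      (fun c h v => by rw [smul_comm (Φ h) c v, f.map_smul]))
  have hF₀ : ∀ h v, F₀ (h ⊗ₜ v) = f (Φ h • v) := fun h v => by
    rw [TensorProduct.lift.tmul, LinearMap.mk₂_apply]
  -- The factor `g` is carried along because `F₀` is only `ℂ`-linear while the relations span an
  -- `ℋ`-submodule.
  have hker : ∀ t ∈ indRel b p Q V, ∀ g : Hecke b p, F₀ (g • t) = 0 := by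
    intro t ht
    induction ht using Submodule.span_induction with
    | mem t ht =>
      obtain ⟨h, a, v, rfl⟩ := ht
      intro g
      rw [smul_sub, TensorProduct.smul_tmul', TensorProduct.smul_tmul', map_sub, hF₀, hF₀,
        sub_eq_zero, smul_eq_mul, smul_eq_mul, ← mul_smul, ← mul_assoc]
      -- Both arguments have the same product with `e`, and `Φ` depends only on that product.
      have h5 : Φ (g * h * a) = Φ ((Φ (g * h) * a : heckePar b p Q) : Hecke b p) := by
        refine h2 _ _ ?_
        rw [Subalgebra.coe_mul, ← mul_assoc _ (g * h), ← mul_assoc _ (Φ (g * h) : Hecke b p), h1]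
      rw [h5, hΦ]
    | zero => intro g; rw [smul_zero, map_zero]
    | add x y _ _ hx hy => intro g; rw [smul_add, map_add, hx, hy, add_zero]
    | smul c x _ hx => intro g; rw [← mul_smul, hx]
  let F : Module.Dual ℂ (Ind b p Q V) :=
    ((indRel b p Q V).restrictScalars ℂ).liftQ F₀ (fun t ht => by
      have := hker t ht 1
      rwa [one_smul] at this) ∘ₗ
    (Submodule.Quotient.restrictScalarsEquiv ℂ (indRel b p Q V)).symm.toLinearMap
  have hF : ∀ h v, F (indMk b p Q h v) = f (Φ h • v) := hF₀
  refine ⟨F, (mem_homSt_iff b p F).2 fun m => ?_, fun v => by rw [hF, h3, one_smul]⟩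
  obtain ⟨t, rfl⟩ := Submodule.Quotient.mk_surjective _ m
  induction t using TensorProduct.induction_on with
  | zero => rw [Submodule.Quotient.mk_zero, smul_zero]
  | tmul h v =>
    change F (_ • indMk b p Q h v) = F (indMk b p Q h v)
    rw [smul_indMk, hF, hF, h2 _ h]
    rw [← mul_assoc, stProj_mul_self]
  | add x y hx hy => rw [Submodule.Quotient.mk_add, smul_add, map_add, hx, hy, map_add]

/-- Composing a functional that is nonzero at `e_Q v` with `e_Q` makes it extendable. The extension
shows that `e ⊗ v` does not vanish in the quotient. -/
theorem exists_mem_homSt_ne_zero {v : V} (hv : stPar b p Q • v ≠ 0) :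
    ∃ F ∈ homSt b p (Ind b p Q V), F (indMk b p Q (stProj b p Set.univ) v) ≠ 0 := by
  obtain ⟨f, hf⟩ : ∃ f : Module.Dual ℂ V, f (stPar b p Q • v) ≠ 0 := by
    by_contra hc
    push Not at hc
    exact hv ((Module.forall_dual_apply_eq_zero_iff ℂ _).1 hc)
  obtain ⟨F, hF, hF1⟩ := exists_functional_ind b p Q
    (f ∘ₗ Algebra.lsmul ℂ ℂ V (stPar b p Q)) (fun w => by
      simp only [LinearMap.comp_apply, Algebra.lsmul_coe, ← mul_smul, stPar_mul_self])
  refine ⟨F, hF, ?_⟩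
  have h1 := (mem_homSt_iff b p F).1 hF (indMk b p Q 1 v)
  rw [smul_indMk, mul_one, hF1] at h1
  rw [h1]
  exact hf

theorem isGenericPar_iff_isGeneric_ind :
    IsGenericPar b p Q V ↔ IsGeneric b p (Ind b p Q V) := by
  rw [IsGenericPar, IsGeneric, containsSt_iff, containsSt_iff]
  constructor
  · rintro ⟨v, hv⟩
    obtain ⟨F, -, hF⟩ := exists_mem_homSt_ne_zero b p Q hv
    refine ⟨indMk b p Q 1 v, fun h => hF ?_⟩
    change stProj b p Set.univ • indMk b p Q 1 v = 0 at h
    rw [smul_indMk, mul_one] at h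
    rw [h, map_zero]
  · rintro ⟨m, hm⟩
    obtain ⟨v, hv⟩ := exists_stProj_smul_eq b p Q m
    refine ⟨v, fun h => hm ?_⟩
    change stPar b p Q • v = 0 at h
    rw [h, indMk_zero] at hv
    exact hv

/-- For a generic simple module `V`, the idempotent of the Steinberg representation has rank one on
the induced module. -/
theorem exists_generator_ind [Module.Finite ℤ X] [IsSimpleModule (heckePar b p Q) V]
    (hV : IsGenericPar b p Q V) :
    ∃ m₀ : Ind b p Q V, m₀ ≠ 0 ∧ stProj b p Set.univ • m₀ = m₀ ∧
      (∀ m : Ind b p Q V, ∃ c : ℂ, stProj b p Set.univ • m = c • m₀) ∧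
      ∃ F ∈ homSt b p (Ind b p Q V), F m₀ ≠ 0 := by
  rw [IsGenericPar, containsSt_iff] at hV
  obtain ⟨v, hv⟩ := hV
  change stPar b p Q • v ≠ 0 at hv
  have hFv : stPar b p Q • stPar b p Q • v = stPar b p Q • v := by
    rw [← mul_smul, stPar_mul_self]
  obtain ⟨F, hF, hF0⟩ := exists_mem_homSt_ne_zero b p Q (hFv.symm ▸ hv)
  -- Finite generation of the lattice makes the group algebra `ℂ[X]` of finite type, as the
  -- Nullstellensatz argument requires.
  have : AddGroup.FG X := Module.Finite.iff_addGroup_fg.1 inferInstance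
  have : AddMonoid.FG X := AddGroup.fg_iff_addMonoid_fg.1 inferInstance
  refine ⟨indMk b p Q (stProj b p Set.univ) (stPar b p Q • v),
    fun h => hF0 (by rw [h, map_zero]), ?_, fun m => ?_, F, hF, hF0⟩
  · rw [smul_indMk, stProj_mul_self]
  · obtain ⟨w, hw⟩ := exists_stProj_smul_eq b p Q m
    obtain ⟨c, hc⟩ := exists_smul_eq_of_isSimpleModule (thetaHom b p Q) (stPar_mul_self b p Q)
      (exists_mul_finToPar_stIdem b p Q) hv hFv w
    exact ⟨c, by rw [hw, hc, indMk_smul]⟩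

/-- A functional of type `St` factors through the idempotent, so its value at `m₀` determines it. -/
theorem finrank_homSt_eq_one {M : Type*} [AddCommGroup M] [Module ℂ M] [Module (Hecke b p) M]
    [IsScalarTower ℂ (Hecke b p) M] {m₀ : M}
    (hM : ∀ m : M, ∃ c : ℂ, stProj b p Set.univ • m = c • m₀)
    (h : ∃ F ∈ homSt b p M, F m₀ ≠ 0) : Module.finrank ℂ (homSt b p M) = 1 := by
  obtain ⟨F, hF, hF0⟩ := h
  refine finrank_eq_one_iff_of_nonzero' (⟨F, hF⟩ : homSt b p M)
    (fun h => hF0 (LinearMap.congr_fun (congrArg Subtype.val h) m₀)) |>.2 ?_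
  rintro ⟨G, hG⟩
  refine ⟨G m₀ / F m₀, Subtype.ext (LinearMap.ext fun m => ?_)⟩
  obtain ⟨c, hc⟩ := hM m
  change G m₀ / F m₀ * F m = G m
  rw [← (mem_homSt_iff b p F).1 hF m, ← (mem_homSt_iff b p G).1 hG m, hc, F.map_smul, G.map_smul,
    smul_eq_mul, smul_eq_mul]
  field_simp

end Induction

end AffHecke

end

/-! ### The theorem on genericity of induced modules. -/

open AffHecke in
theorem lemma6p5 {ι X Y : Type*} [Finite ι] [AddCommGroup X] [AddCommGroup Y]
    [Module.Finite ℤ X] [Module.Finite ℤ Y] (𝓡 : RootDatum ι X Y) (b : 𝓡.Base)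
    (p : Params 𝓡) (hq : ∀ s : SAff b, 1 ≤ qAff b p s) (P : Set b.support)
    (V : Type*) [AddCommGroup V] [Module ℂ V] [Module (heckePar b p P) V]
    [IsScalarTower ℂ (heckePar b p P) V] :
    (IsGenericPar b p P V ↔ IsGeneric b p (Ind b p P V)) ∧
    (IsSimpleModule (heckePar b p P) V → IsGenericPar b p P V →
      Module.finrank ℂ (homSt b p (Ind b p P V)) = 1 ∧
      ∃ A B : Submodule (Hecke b p) (Ind b p P V), A ≤ B ∧
        IsSimpleModule (Hecke b p) (Subquot A B) ∧ IsGeneric b p (Subquot A B) ∧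
        (∀ A' B' : Submodule (Hecke b p) (Ind b p P V), A' ≤ B' →
          IsSimpleModule (Hecke b p) (Subquot A' B') → IsGeneric b p (Subquot A' B') →
          Nonempty (Subquot A' B' ≃ₗ[Hecke b p] Subquot A B)) ∧
        simpleMult (Hecke b p) (Subquot A B) (Ind b p P V) = 1) := by
  refine ⟨isGenericPar_iff_isGeneric_ind b p P, fun hs hV => ?_⟩
  obtain ⟨m₀, h0, hm, hM, hF⟩ := exists_generator_ind b p P hV
  -- The results on subquotients use only the `ℋ`-module structure, so complex scalars are passed
  -- through `ℋ`.
  have hM' : ∀ m : Ind b p P V, ∃ c : ℂ,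
      stProj b p Set.univ • m = algebraMap ℂ (Hecke b p) c • m₀ := by
    intro m
    obtain ⟨c, hc⟩ := hM m
    exact ⟨c, by rw [hc, algebraMap_smul]⟩
  refine ⟨finrank_homSt_eq_one b p hM hF, genericRadical (stProj b p Set.univ) m₀,
    Submodule.span (Hecke b p) {m₀}, genericRadical_le, isSimpleModule_subquot h0 hm hM', ?_, ?_,
    simpleMult_subquot h0 hm hM'⟩
  · rw [IsGeneric, containsSt_iff]
    exact exists_smul_subquot_ne_zero h0 hm
  · intro A' B' _ hs' hg
    rw [IsGeneric, containsSt_iff] at hg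
    exact nonempty_equiv_subquot h0 hm hM' hg
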